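/- Let $\Sigma$ be a finite alphabet with a linear order $\le$. A (finite) $\Sigma$-tree is a partial mapping $t:\{0,1\}^*\to\Sigma$ with finite domain such that $uv\in\mathrm{dom}(t)$ implies $u\in\mathrm{dom}(t)$ and $u1\in\mathrm{dom}(t)$ implies $u0\in\mathrm{dom}(t)$; the empty tree is allowed. For $u\in\{0,1\}^*$, $t{\restriction}_u$ is the tree $v\mapsto t(uv)$ (empty if $u\notin\mathrm{dom}(t)$), and $t{\restriction}_{0^*}$ is the word $t(\varepsilon)\,t(0)\,t(00)\cdots$ of labels on the main branch $0^*\cap\mathrm{dom}(t)$. For words $u,v$ over $\Sigma$, $u<_{\mathrm{llex}}v$ means that $|u|<|v|$, or $|u|=|v|$ and $u$ is strictly lexicographically smaller than $v$. The linear order $\le_{\mathrm{trees}}$ on the set of all $\Sigma$-trees is the reflexive closure of the relation $<_{\mathrm{trees}}$ defined recursively by: $s<_{\mathrm{trees}}t$ iff - $s=\emptyset\neq t$, or - $s{\restriction}_{0^*}<_{\mathrm{llex}}t{\restriction}_{0^*}$, or - $s{\restriction}_{0^*}=t{\restriction}_{0^*}$ and there is $i$ with $0^i\in\mathrm{dom}(s)$,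 $s{\restriction}_{0^j1}=t{\restriction}_{0^j1}$ for all $0\le j<i$, and $s{\restriction}_{0^i1}<_{\mathrm{trees}}t{\restriction}_{0^i1}$. A tree automaton is a tuple $(Q,\iota,\Delta,F)$ with a finite set $Q$ of states, $\iota\in Q$, $\Delta\subseteq Q\times\Sigma\times Q^2$ and $F\subseteq Q$. A run on $t$ is a mapping $\rho:\mathrm{dom}(t)\to Q$, extended by the value $\iota$ to all of $\{0,1\}^*$, with $(\rho(u),t(u),\rho(u0),\rho(u1))\in\Delta$ for all $u\in\mathrm{dom}(t)$; it is accepting if $\rho(\varepsilon)\in F$. The language of the automaton is the set of all trees that admit an accepting run; such sets of trees are called regular. A linear order is scattered if $(\mathbb Q;\le)$ does not embed into it. A set is $\Pi^0_1$-hard if every $\Pi^0_1$ set $P\subseteq\mathbb N$ (that is, every complement of a recursively enumerable set) is many-one reducible to it by a computable function. **Theorem.** There are a finite linearly ordered alphabet $\Sigma$ and a scattered linear order $\mathcal L$ such that the set of regular languages $L$ of $\Sigma$-trees with $(L;\le_{\mathrm{trees}})\cong\mathcal L$ is $\Pi^0_1$-hard, where regular languages are given by (finite descriptions of) tree automata over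 $\Sigma$ that accept them. -/

import Mathlib

/-- A finite `α`-labelled tree: a partial mapping `{0,1}* → α` with finite domain such that
`uv ∈ dom` implies `u ∈ dom`, and `u1 ∈ dom` implies `u0 ∈ dom`.  The letters `0`, `1` are
`false`, `true`, and `label u = none` means `u ∉ dom`.  The empty tree is allowed. -/
@[ext]
structure LTree (α : Type*) where
  label : List Bool → Option α
  finite_dom : {u | label u ≠ none}.Finite
  prefix_closed : ∀ u v, label (u ++ v) ≠ none → label u ≠ none
  left_of_right : ∀ u, label (u ++ [true]) ≠ none → label (u ++ [false]) ≠ none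

namespace LTree

variable {α : Type*}

/-- The domain of a tree. -/
def dom (t : LTree α) : Set (List Bool) := {u | t.label u ≠ none}

/-- The empty tree. -/
def empty : LTree α where
  label _ := none
  finite_dom := by simp
  prefix_closed := by simp
  left_of_right := by simp

/-- The subtree of `t` rooted at `u`; it is the empty tree if `u ∉ dom t`. -/
def subtree (t : LTree α) (u : List Bool) : LTree α where
  label v := t.label (u ++ v)
  finite_dom := by
    have h : Function.Injective (fun v : List Bool => u ++ v) :=
      fun _ _ h => List.append_cancel_left h
    exact t.finite_dom.preimage h.injOn
  prefix_closed v w h := t.prefix_closed (u ++ v) w (by simpa [List.append_assoc] using h)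
  left_of_right v h := by
    have := t.left_of_right (u ++ v) (by simpa [List.append_assoc] using h)
    simpa [List.append_assoc] using this

/-- The node `0^i` on the main branch. -/
def mainNode (i : ℕ) : List Bool := List.replicate i false

/-- The side tree of `t` at the node `0^i 1`. -/
def sideTree (t : LTree α) (i : ℕ) : LTree α := t.subtree (mainNode i ++ [true])

/-- The word `t(ε) t(0) t(00) …` of the labels on the main branch `0* ∩ dom t`.  (The nodes
`0^i` of `dom t` all satisfy `i < |dom t|`; see `mainBranch_getElem?`.) -/
noncomputable def mainBranch (t : LTree α) : List α :=
  (List.range t.dom.ncard).filterMap fun i => t.label (mainNode i)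

/-- Strict order `s <_trees t`: the main branches are compared length-lexicographically and, if
these are equal, the tuples of side trees are compared lexicographically, recursively.
Side trees have strictly fewer nodes, so the recursive characterization has exactly
one solution, which is this inductively defined relation. -/
inductive TreesLT [LinearOrder α] : LTree α → LTree α → Prop
  | empty_lt (t : LTree α) : t ≠ empty → TreesLT empty t
  | main (s t : LTree α) :
      List.Shortlex (· < ·) s.mainBranch t.mainBranch → TreesLT s t
  | side (s t : LTree α) (i : ℕ) :
      s.mainBranch = t.mainBranch → mainNode i ∈ s.dom →
      (∀ j < i, s.sideTree j = t.sideTree j) →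
      TreesLT (s.sideTree i) (t.sideTree i) → TreesLT s t

/-- The order `≤_trees` on the set of all finite trees over a linearly ordered alphabet. -/
def TreesLE [LinearOrder α] (s t : LTree α) : Prop := s = t ∨ TreesLT s t

theorem mainNode_mem_of_le (t : LTree α) {i j : ℕ} (h : i ≤ j) (hj : mainNode j ∈ t.dom) :
    mainNode i ∈ t.dom := by
  refine t.prefix_closed (mainNode i) (mainNode (j - i)) ?_
  have : mainNode i ++ mainNode (j - i) = mainNode j := by
    simp only [mainNode, ← List.replicate_add]
    congr 1
    omega
  rw [this]
  exact hj

theorem lt_ncard_of_mem (t : LTree α) {i : ℕ} (hi : mainNode i ∈ t.dom) : i < t.dom.ncard := by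
  have hinj : Function.Injective mainNode := by
    intro a b h
    simpa [mainNode] using congrArg List.length h
  have hsub : mainNode '' (Set.Iic i) ⊆ t.dom := by
    rintro _ ⟨j, hj, rfl⟩
    exact t.mainNode_mem_of_le hj hi
  have := Set.ncard_le_ncard hsub t.finite_dom
  rw [Set.ncard_image_of_injective _ hinj] at this
  have h2 : (Set.Iic i).ncard = i + 1 := by
    rw [← Finset.coe_Iic, Set.ncard_coe_finset]
    simp
  omega

theorem filterMap_range_getElem? (f : ℕ → Option α) (hf : ∀ i j, i ≤ j → f j ≠ none → f i ≠ none)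
    (n : ℕ) (i : ℕ) :
    ((List.range n).filterMap f)[i]? = if i < n then f i else none := by
  have key : ∀ n, ((List.range n).filterMap f).length ≤ n ∧
      (f n ≠ none → ((List.range n).filterMap f).length = n) := by
    intro n
    refine ⟨(List.length_filterMap_le _ _).trans (by simp), fun h => ?_⟩
    induction n with
    | zero => simp
    | succ n ih =>
      have hn := hf n (n + 1) (by omega) h
      obtain ⟨a, ha⟩ := Option.ne_none_iff_exists'.1 hn
      rw [List.range_succ, List.filterMap_append, List.length_append, ih hn]
      simp [ha]
  induction n with
  | zero => simp
  | succ n ih =>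
    rw [List.range_succ, List.filterMap_append]
    cases hfn : f n with
    | none =>
      simp only [List.filterMap_cons, hfn, List.filterMap_nil, List.append_nil, ih]
      by_cases h : i < n
      · simp [h, Nat.lt_succ_of_lt h]
      · by_cases h' : i = n
        · simp [h', hfn]
        · have : ¬ i < n + 1 := by omega
          simp [h, this]
    | some a =>
      have hl := (key n).2 (by simp [hfn])
      simp only [List.filterMap_cons, hfn, List.filterMap_nil]
      by_cases h : i < n
      · rw [List.getElem?_append_left (by omega), ih]
        simp [h, Nat.lt_succ_of_lt h]
      · rw [List.getElem?_append_right (by omega), hl]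
        by_cases h' : i = n
        · simp [h', hfn]
        · have h1 : ¬ i < n + 1 := by omega
          have h2 : i - n ≠ 0 := by omega
          simp [h1, h2]

/-- `mainBranch t` is the word whose `i`-th letter is `t(0^i)`. -/
theorem mainBranch_getElem? (t : LTree α) (i : ℕ) :
    t.mainBranch[i]? = t.label (mainNode i) := by
  rw [mainBranch, filterMap_range_getElem? _ (fun i j h hj => t.mainNode_mem_of_le h hj)]
  split_ifs with h
  · rfl
  · by_contra hne
    exact h (t.lt_ncard_of_mem (Ne.symm hne))

end LTree

/-- A (nondeterministic, bottom up) tree automaton over the alphabet `α` with state set `Q`. -/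
structure TreeAutomaton (α Q : Type*) where
  init : Q
  trans : Set (Q × α × Q × Q)
  final : Set Q

namespace TreeAutomaton

variable {α Q : Type*}

/-- Runs of `A` on `t`.  The mapping `ρ : dom t → Q` is extended to all of `{0,1}*` by the
initial state. -/
def IsRun (A : TreeAutomaton α Q) (t : LTree α) (ρ : List Bool → Q) : Prop :=
  (∀ u ∉ t.dom, ρ u = A.init) ∧
  ∀ u a, t.label u = some a → (ρ u, a, ρ (u ++ [false]), ρ (u ++ [true])) ∈ A.trans

/-- The language of `A`: all trees with a run whose value at the root is final. -/
def language (A : TreeAutomaton α Q) : Set (LTree α) :=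
  {t | ∃ ρ, A.IsRun t ρ ∧ ρ [] ∈ A.final}

end TreeAutomaton

/-- Finite descriptions of tree automata over the alphabet `{0 < ⋯ < k - 1}`: a tuple
`(n, i, Δ, F)`, where the states are `0, …, n`, the initial state is `i` (modulo `n + 1`), and
`Δ`, `F` list the transitions and the final states. -/
abbrev TreeAutomatonCode (k : ℕ) : Type :=
  ℕ × ℕ × List (ℕ × Fin k × ℕ × ℕ) × List ℕ

/-- The tree automaton with the description `c`. -/
def TreeAutomatonCode.toAutomaton {k : ℕ} (c : TreeAutomatonCode k) :
    TreeAutomaton (Fin k) (Fin (c.1 + 1)) where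
  init := Fin.ofNat (c.1 + 1) c.2.1
  trans := {p | ((p.1 : ℕ), p.2.1, (p.2.2.1 : ℕ), (p.2.2.2 : ℕ)) ∈ c.2.2.1}
  final := {q | (q : ℕ) ∈ c.2.2.2}

/-- The regular tree language with the description `c`. -/
def TreeAutomatonCode.language {k : ℕ} (c : TreeAutomatonCode k) : Set (LTree (Fin k)) :=
  c.toAutomaton.language

/-- A linear order is scattered if the rational line does not embed into it. -/
def IsScattered (X : Type*) [LinearOrder X] : Prop := IsEmpty (ℚ ↪o X)

/-- `Π⁰₁` sets of natural numbers: those with a recursively enumerable complement. -/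
def IsPiZeroOne (P : ℕ → Prop) : Prop := REPred fun n => ¬ P n

/-- `S` is `Π⁰₁`-hard: every `Π⁰₁` set is many-one reducible to `S` by a computable function. -/
def PiZeroOneHard {β : Type*} [Primcodable β] (S : β → Prop) : Prop :=
  ∀ P : ℕ → Prop, IsPiZeroOne P → ManyOneReducible P S

/-- `(L; ≤_trees)` is isomorphic to the linear order `X`. -/
def TreesIso {α : Type*} [LinearOrder α] (L : Set (LTree α)) (X : Type*) [LinearOrder X] : Prop :=
  Nonempty ((fun s t : L => LTree.TreesLE (s : LTree α) t) ≃r ((· ≤ ·) : X → X → Prop))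

/-! Non-acceptance of a universal computation is turned into a question of ordinal absorption: `ω ^
N + β = β` holds exactly when `ω ^ (N + 1) ≤ β`. For a machine and an input `g`, consider the sum of
rows `ω* + A w + B w`, with `w` running through all words in length-lexicographic order. The part `A
w` is nonempty only if `w` codes a candidate for an accepting history on `g`, and then its type lies
in `[ω ^ N, ω ^ (N + 1))`, with `N` proportional to the length of `w`. The part `B w` does not
depend on `g`; for a word that codes a history, its type reaches `ω ^ (N + 1)` exactly if some step
of that history is wrong. So all `A w` are absorbed if and only if the machine does not accept, and
the fixed order is the sum of the rows `ω* + B w` (`AffineMachine.nonempty_iso_iff`).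

The segments `ω*` make the rows recognizable: an infinite descent between two points exists if and
only if they lie in different rows. As the rows are well-ordered, an isomorphism maps each row to
itself and can only shift its main part by finitely many points (`RowSum.exists_type_le_of_iso`).
The same analysis shows that the order is scattered.

Powers of `ω` come from flags. A finite transducer marks some letters of `w`, and arbitrary numbers
may be attached to the marked positions. Ordered lexicographically, the resulting sequences have
type at least `ω ^ n` if some run sets `n` flags (`Content.pow_le_type_box`), and type below `ω ^ (n
+ 1)` if no run sets more than `n` (`Content.exists_rank`). The word becomes the main branch of a
tree, the numbers become the lengths of unary side trees, and the first side tree is a tag that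
selects `ω*`, `A` or `B` (`treesIso_codedSet`, `FlagTransducer.language_spineAutomaton`).

Wrong steps are detected by counting. The machine has two registers and rules that are affine
equations between old and new values (`AffineMachine`), and a history writes the values in unary. A
test guesses a rule, a register and a sign and gives each letter the weight `B` plus or minus a
coefficient, so that the total is `B` times the length plus or minus the difference of the two sides
of the equation. It exceeds the neutral value for one of the signs if and only if the equation fails
(`AffineMachine.le_of_validHistory`, `AffineMachine.exists_runs_of_not_validHistory`). A Turing
machine is such a machine when the two halves of its tape are read as numbers in a base `b`.

The input `g` enters only through a counter of states, so descriptions of the automata are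
computable from `g` (`FlagTransducer.exists_primrec_code`). -/

/-! ### Order types of sets of finitely supported sequences -/

/-- Sequences of natural numbers, ordered lexicographically. -/
abbrev Content : Type := Lex (ℕ → ℕ)

namespace Content

open Ordinal

theorem lt_iff {c d : Content} : c < d ↔ ∃ i, (∀ j < i, c j = d j) ∧ c i < d i := Iff.rfl

/-- The sequence without its first entry. -/
def tail (c : Content) : Content := toLex fun i => c (i + 1)

theorem lt_iff_head_tail {c d : Content} : c < d ↔ c 0 < d 0 ∨ c 0 = d 0 ∧ c.tail < d.tail := by
  constructor
  · rintro ⟨i, h1, h2⟩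
    cases i with
    | zero => exact .inl h2
    | succ i => exact .inr ⟨h1 0 (by omega), i, fun j hj => h1 (j + 1) (by omega), h2⟩
  · rintro (h | ⟨h, i, h1, h2⟩)
    · exact ⟨0, fun j hj => by omega, h⟩
    · refine ⟨i + 1, fun j hj => ?_, h2⟩
      cases j with
      | zero => exact h
      | succ j => exact h1 j (by omega)

/-- The number of nonzero entries among the first `n`. -/
def weight (n : ℕ) (c : Content) : ℕ := ∑ i ∈ Finset.range n, if c i = 0 then 0 else 1

theorem weight_succ (n : ℕ) (c : Content) :
    weight (n + 1) c = weight n c.tail + if c 0 = 0 then 0 else 1 := by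
  rw [weight, Finset.sum_range_succ']
  rfl

theorem isPrincipal_add_omega0_pow (N : ℕ) : IsPrincipal (· + ·) (ω ^ N : Ordinal.{0}) := by
  rw [← opow_natCast]
  exact isPrincipal_add_omega0_opow _

theorem mul_omega0_le_of_lt_pow {T : Ordinal.{0}} {N : ℕ} (h : T < ω ^ (N + 1)) :
    T * ω ≤ ω ^ (N + 1) := by
  have h' : T < ω ^ Order.succ (N : Ordinal.{0}) := by
    have : Order.succ (N : Ordinal.{0}) = ((N + 1 : ℕ) : Ordinal.{0}) := by simp
    rwa [this, opow_natCast]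
  obtain ⟨k, hk⟩ := lt_omega0_opow_succ.1 h'
  have hk0 : 0 < k := by
    rcases Nat.eq_zero_or_pos k with rfl | h
    · simp at hk
    · exact h
  calc T * ω ≤ (ω ^ (N : Ordinal.{0}) * k) * ω := mul_le_mul_left hk.le _
    _ = ω ^ (N + 1) := by rw [mul_assoc, natCast_mul_omega0 hk0, opow_natCast, pow_succ]

/-- Sequences that vanish from `n` on and have at most `N` nonzero entries can be ranked strictly
monotonically by ordinals below some bound `T < ω ^ (N + 1)`. -/
theorem exists_rank (n N : ℕ) : ∃ (r : Content → Ordinal.{0}) (T : Ordinal.{0}),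
    T < ω ^ (N + 1) ∧ (∀ c, weight n c ≤ N → r c < T) ∧
    ∀ c d : Content, (∀ i ≥ n, c i = 0) → (∀ i ≥ n, d i = 0) → weight n c ≤ N → weight n d ≤ N →
      c < d → r c < r d := by
  induction n generalizing N with
  | zero =>
    refine ⟨fun _ => 0, 1, ?_, by simp, fun c d hc hd _ _ ⟨i, _, h⟩ => ?_⟩
    · exact one_lt_pow₀ one_lt_omega0 (by simp)
    · rw [hd i (Nat.zero_le i)] at h
      exact absurd h (Nat.not_lt_zero _)
  | succ n ih =>
    obtain ⟨r, T, hT, hr, hmono⟩ := ih N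
    -- A nonzero first entry leaves at most `N - 1` nonzero entries for the tail. No such tail
    -- exists for `N = 0`, where the bound `0` serves.
    have key : ∃ (r' : Content → Ordinal.{0}) (T' : Ordinal.{0}), T' * ω ≤ ω ^ N ∧
        (∀ c, weight n c + 1 ≤ N → r' c < T') ∧
        ∀ c d : Content, (∀ i ≥ n, c i = 0) → (∀ i ≥ n, d i = 0) → weight n c + 1 ≤ N →
          weight n d + 1 ≤ N → c < d → r' c < r' d := by
      cases N with
      | zero => exact ⟨fun _ => 0, 0, by simp, by simp, by simp⟩
      | succ M =>
        obtain ⟨r', T', hT', hr', hmono'⟩ := ih M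
        exact ⟨r', T', mul_omega0_le_of_lt_pow hT', fun c hc => hr' c (by omega),
          fun c d hc hd h1 h2 => hmono' c d hc hd (by omega) (by omega)⟩
    obtain ⟨r', T', hT', hr', hmono'⟩ := key
    have hblock : ∀ (v : ℕ) (c : Content), weight n c + 1 ≤ N →
        T' * v + r' c < T' * ((v + 1 : ℕ) : Ordinal.{0}) := by
      intro v c hc
      rw [Nat.cast_add, Nat.cast_one, mul_add, mul_one]
      exact (add_lt_add_iff_left _).2 (hr' c hc)
    have hw : ∀ c : Content, c 0 = 0 → weight (n + 1) c ≤ N → weight n c.tail ≤ N := by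
      intro c h0 h
      simpa [weight_succ, h0] using h
    have hw' : ∀ c : Content, c 0 ≠ 0 → weight (n + 1) c ≤ N → weight n c.tail + 1 ≤ N := by
      intro c h0 h
      simpa [weight_succ, h0] using h
    -- Sequences starting with `0` are ranked below `T`; those starting with `v > 0` form the `v`-th
    -- block of length `T'` after `T`.
    refine ⟨fun c => if c 0 = 0 then r c.tail else T + (T' * (c 0 : ℕ) + r' c.tail),
      T + T' * ω, ?_, fun c hc => ?_, fun c d hc hd hwc hwd hlt => ?_⟩
    · refine isPrincipal_add_omega0_pow (N + 1) hT (hT'.trans_lt ?_)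
      exact pow_lt_pow_right₀ one_lt_omega0 (by omega)
    · by_cases h0 : c 0 = 0
      · simp only [h0, if_true]
        exact (hr _ (hw c h0 hc)).trans_le le_self_add
      · simp only [h0, if_false]
        refine (add_lt_add_iff_left _).2 ((hblock _ _ (hw' c h0 hc)).trans_le ?_)
        exact mul_le_mul_right (natCast_lt_omega0 _).le _
    · have hc' : ∀ i ≥ n, c.tail i = 0 := fun i hi => hc (i + 1) (by omega)
      have hd' : ∀ i ≥ n, d.tail i = 0 := fun i hi => hd (i + 1) (by omega)
      rcases lt_iff_head_tail.1 hlt with h | ⟨h, ht⟩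
      · have hd0 : d 0 ≠ 0 := by omega
        by_cases h0 : c 0 = 0
        · simp only [h0, hd0, if_true, if_false]
          exact (hr _ (hw c h0 hwc)).trans_le le_self_add
        · simp only [h0, hd0, if_false]
          refine (add_lt_add_iff_left _).2 ((hblock _ _ (hw' c h0 hwc)).trans_le ?_)
          refine le_trans ?_ le_self_add
          exact mul_le_mul_right (by exact_mod_cast h) _
      · by_cases h0 : c 0 = 0
        · have hd0 : d 0 = 0 := by omega
          simp only [h0, hd0, if_true]
          exact hmono _ _ hc' hd' (hw c h0 hwc) (hw d hd0 hwd) ht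
        · have hd0 : d 0 ≠ 0 := by omega
          simp only [h0, hd0, if_false]
          rw [h]
          refine (add_lt_add_iff_left _).2 ((add_lt_add_iff_left _).2 ?_)
          exact hmono' _ _ hc' hd' (hw' c h0 hwc) (hw' d hd0 hwd) ht

theorem weight_le (n : ℕ) (c : Content) : weight n c ≤ n := by
  refine (Finset.sum_le_card_nsmul _ _ 1 fun i _ => ?_).trans (by simp)
  split_ifs <;> simp

theorem wellFoundedLT_of_bounded {X : Set Content} (n : ℕ) (h : ∀ c ∈ X, ∀ i ≥ n, c i = 0) :
    WellFoundedLT X := by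
  obtain ⟨r, T, -, -, hmono⟩ := exists_rank n n
  have : StrictMono fun c : X => r c := fun c d hcd =>
    hmono c d (h c c.2) (h d d.2) (weight_le _ _) (weight_le _ _) hcd
  exact this.wellFoundedLT

theorem type_lt_pow {X : Set Content} [WellFoundedLT X] {n N : ℕ}
    (h : ∀ c ∈ X, ∀ i ≥ n, c i = 0) (hN : ∀ c ∈ X, weight n c ≤ N) :
    typeLT X < ω ^ (N + 1) := by
  obtain ⟨r, T, hT, hr, hmono⟩ := exists_rank n N
  refine lt_of_le_of_lt ?_ hT
  rw [← type_toType T]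
  let f : X → T.ToType := fun c => ToType.mk ⟨r c, hr c (hN c c.2)⟩
  have hf : StrictMono f := fun c d hcd => ToType.mk.strictMono
    (hmono c d (h c c.2) (h d d.2) (hN c c.2) (hN d d.2) hcd)
  exact (RelEmbedding.ofMonotone f fun a b h => hf h).ordinal_type_le

/-- The sequences supported in `S`. -/
def box (S : Finset ℕ) : Set Content := {c | ∀ i, c i ≠ 0 → i ∈ S}

theorem wellFoundedLT_of_subset_box {X : Set Content} (S : Finset ℕ) (h : X ⊆ box S) :
    WellFoundedLT X := by
  refine wellFoundedLT_of_bounded (S.sup id + 1) fun c hc i hi => ?_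
  by_contra h0
  have : i ≤ S.sup id := Finset.le_sup (f := id) (h hc i h0)
  omega

instance (S : Finset ℕ) : WellFoundedLT (box S) := wellFoundedLT_of_subset_box S subset_rfl

/-- Adding a new least position `a` to the support makes the entry at `a` the most significant one,
so the new box contains `ω` consecutive copies of the old one. -/
theorem pow_le_type_box (S : Finset ℕ) : ω ^ S.card ≤ typeLT (box S) := by
  induction S using Finset.induction_on_min with
  | empty =>
    rw [Finset.card_empty, pow_zero, Order.one_le_iff_ne_zero, Ne, type_eq_zero_iff_isEmpty]
    exact fun h => h.false ⟨toLex fun _ => 0, fun i hi => absurd rfl hi⟩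
  | insert a S ha ih =>
    have haS : a ∉ S := fun h => lt_irrefl a (ha a h)
    rw [Finset.card_insert_of_notMem haS, pow_succ]
    refine (mul_le_mul_left ih _).trans ?_
    have hω : (ω : Ordinal.{0}) = typeLT ℕ := (type_nat_lt).symm
    rw [hω, ← type_prod_lex]
    let f : ℕ × box S → box (insert a S) := fun p =>
      ⟨toLex (Function.update (ofLex p.2.1) a p.1), fun i hi => by
        by_cases h : i = a
        · simp [h]
        · have : p.2.1 i ≠ 0 := by simpa [h] using hi
          exact Finset.mem_insert_of_mem (p.2.2 i this)⟩
    have hz : ∀ (c : box S) (i : ℕ), i ≤ a → c.1 i = 0 := fun c i hi => by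
      by_contra h
      exact absurd (ha i (c.2 i h)) (by omega)
    refine (RelEmbedding.ofMonotone (r := Prod.Lex (· < ·) (· < ·)) f ?_).ordinal_type_le
    rintro ⟨v, c⟩ ⟨w, d⟩ h
    rw [Prod.lex_def] at h
    show (f (v, c)).1 < (f (w, d)).1
    rcases h with h | ⟨h, hcd⟩
    · refine ⟨a, fun j hj => ?_, by simpa [f] using h⟩
      simp [f, hj.ne, hz c j hj.le, hz d j hj.le]
    · obtain ⟨i, h1, h2⟩ := lt_iff.1 (show c.1 < d.1 from hcd)
      have hai : a < i := by
        by_contra hle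
        rw [hz c i (by omega), hz d i (by omega)] at h2
        exact absurd h2 (lt_irrefl _)
      refine ⟨i, fun j hj => ?_, by simpa [f, hai.ne'] using h2⟩
      by_cases hja : j = a
      · simpa [f, hja] using h
      · simpa [f, hja] using h1 j hj

end Content

/-! ### Rigidity and scatteredness of sums of rows `ω* + D i` -/

open Ordinal in
theorem Ordinal.type_le_of_strictMono {X : Type} [LinearOrder X] [WellFoundedLT X]
    {T : Ordinal.{0}} (r : X → Ordinal.{0}) (hr : StrictMono r) (hT : ∀ x, r x < T) :
    typeLT X ≤ T := by
  rw [← type_toType T]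
  let f : X → T.ToType := fun c => ToType.mk ⟨r c, hT c⟩
  have hf : StrictMono f := fun c d hcd => ToType.mk.strictMono (hr hcd)
  exact (RelEmbedding.ofMonotone f fun a b h => hf h).ordinal_type_le

/-- The lexicographic sum, over the index order `I`, of the orders `ω* + D i`. -/
abbrev RowSum {I : Type} (D : I → Type) : Type := Σₗ i : I, ℕᵒᵈ ⊕ₗ D i

namespace RowSum

open Ordinal OrderDual

variable {I : Type} [LinearOrder I] {D D' : I → Type} [∀ i, LinearOrder (D i)]
  [∀ i, LinearOrder (D' i)]

/-- A point in the initial segment `ω*` of a row. -/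
def low (D : I → Type) (i : I) (n : ℕ) : RowSum D := toLex ⟨i, toLex (.inl (toDual n))⟩

/-- A point in the main part of a row. -/
def high (i : I) (d : D i) : RowSum D := toLex ⟨i, toLex (.inr d)⟩

/-- The row of a point. -/
def row (z : RowSum D) : I := (ofLex z).1

@[simp] theorem row_low (i : I) (n : ℕ) : row (low D i n) = i := rfl

@[simp] theorem row_high (i : I) (d : D i) : row (high i d) = i := rfl

theorem cases (z : RowSum D) : (∃ i n, z = low D i n) ∨ ∃ i d, z = high i d := by
  obtain ⟨i, y⟩ := z
  rcases y with n | d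
  · exact .inl ⟨i, ofDual n, rfl⟩
  · exact .inr ⟨i, d, rfl⟩

theorem lt_of_row_lt {z w : RowSum D} (h : row z < row w) : z < w := Sigma.Lex.left _ _ h

theorem row_le_of_le {z w : RowSum D} (h : z ≤ w) : row z ≤ row w := by
  by_contra hlt
  exact absurd (lt_of_row_lt (not_le.1 hlt)) (not_lt.2 h)

theorem mk_lt_mk (i : I) (a b : ℕᵒᵈ ⊕ₗ D i) :
    (toLex ⟨i, a⟩ : RowSum D) < toLex ⟨i, b⟩ ↔ a < b := by
  constructor
  · intro h
    rcases Sigma.Lex.lt_def.1 h with h | ⟨_, h⟩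
    · exact absurd h (lt_irrefl _)
    · exact h
  · exact fun h => Sigma.Lex.right _ _ h

@[simp] theorem low_lt_low (i : I) (m n : ℕ) : low D i m < low D i n ↔ n < m := by
  rw [low, low, mk_lt_mk, Sum.Lex.inl_lt_inl_iff]
  exact Iff.rfl

@[simp] theorem low_lt_high (i : I) (m : ℕ) (d : D i) : low D i m < high i d := by
  rw [low, high, mk_lt_mk]
  exact Sum.Lex.inl_lt_inr _ _

@[simp] theorem high_lt_high (i : I) (c d : D i) : high i c < high i d ↔ c < d := by
  rw [high, high, mk_lt_mk, Sum.Lex.inr_lt_inr_iff]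

/-- There is an infinite descending sequence between `z` and `w`. -/
def Descends {X : Type} [LinearOrder X] (z w : X) : Prop :=
  ∃ f : ℕ → X, StrictAnti f ∧ ∀ n, f n ∈ Set.Icc z w

/-- The segment `ω*` at the start of the row of `w` descends and stays above all earlier rows. -/
theorem descends_of_row_lt {z w : RowSum D} (h : row z < row w) : Descends z w := by
  have hz : ∀ n, z ≤ low D (row w) n := fun n => (lt_of_row_lt (by simpa using h)).le
  rcases cases w with ⟨i, m, rfl⟩ | ⟨i, d, rfl⟩
  · refine ⟨fun n => low D i (m + n), fun a b hab => ?_, fun n => ⟨hz _, ?_⟩⟩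
    · simpa using hab
    · rw [← not_lt]
      simp
  · refine ⟨fun n => low D i n, fun a b hab => ?_, fun n => ⟨hz _, ?_⟩⟩
    · simpa using hab
    · exact (low_lt_high _ _ _).le

variable [∀ i, WellFoundedLT (D i)] [∀ i, WellFoundedLT (D' i)]

/-- A rank of the points of a row that are not below the `m`-th point of its segment `ω*`. -/
noncomputable def rank (m : ℕ) (z : RowSum D) : Ordinal.{0} :=
  match (ofLex (ofLex z).2) with
  | .inl n => ((m - ofDual n : ℕ) : Ordinal.{0})
  | .inr d => ((m + 1 : ℕ) : Ordinal.{0}) + typein (α := D (row z)) (· < ·) d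

theorem rank_low (m : ℕ) (i : I) (n : ℕ) : rank m (low D i n) = ((m - n : ℕ) : Ordinal.{0}) := rfl

theorem rank_high (m : ℕ) (i : I) (d : D i) :
    rank m (high i d) = ((m + 1 : ℕ) : Ordinal.{0}) + typein (α := D i) (· < ·) d := rfl

theorem rank_lt_rank {m : ℕ} {i : I} {z w : RowSum D} (hz : row z = i) (hw : row w = i)
    (h : ∀ n, z = low D i n → n ≤ m) (hlt : z < w) : rank m z < rank m w := by
  rcases cases z with ⟨j, n, rfl⟩ | ⟨j, d, rfl⟩
  · obtain rfl : j = i := by simpa using hz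
    have hn := h n rfl
    rcases cases w with ⟨j', n', rfl⟩ | ⟨j', d', rfl⟩
    · obtain rfl : j' = j := by simpa using hw
      rw [rank_low, rank_low]
      have : n' < n := by simpa using hlt
      exact_mod_cast (by omega : m - n < m - n')
    · obtain rfl : j' = j := by simpa using hw
      rw [rank_low, rank_high]
      refine lt_of_lt_of_le ?_ le_self_add
      exact_mod_cast (by omega : m - n < m + 1)
  · obtain rfl : j = i := by simpa using hz
    rcases cases w with ⟨j', n', rfl⟩ | ⟨j', d', rfl⟩
    · obtain rfl : j' = j := by simpa using hw
      exact absurd hlt (not_lt.2 (low_lt_high _ _ _).le)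
    · obtain rfl : j' = j := by simpa using hw
      rw [rank_high, rank_high]
      refine (add_lt_add_iff_left _).2 ?_
      rw [typein_lt_typein]
      simpa using hlt

theorem exists_bound (z : RowSum D) : ∃ m, ∀ w, z ≤ w → row w = row z →
    ∀ n, w = low D (row z) n → n ≤ m := by
  rcases cases z with ⟨i, k, rfl⟩ | ⟨i, d, rfl⟩
  · refine ⟨k, fun w hw _ n hn => ?_⟩
    subst hn
    rw [row_low, ← not_lt] at hw
    simpa using hw
  · refine ⟨0, fun w hw _ n hn => ?_⟩
    subst hn
    exact absurd (low_lt_high i n d) (not_lt.2 hw)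

/-- Within one row, only finitely many points of `ω*` lie above `z`, so the part of the row above
`z` is well-ordered. -/
theorem row_lt_of_descends {z w : RowSum D} (h : Descends z w) : row z < row w := by
  obtain ⟨f, hf, hfm⟩ := h
  have hle : row z ≤ row w := row_le_of_le ((hfm 0).1.trans (hfm 0).2)
  refine lt_of_le_of_ne hle fun heq => ?_
  obtain ⟨m, hm⟩ := exists_bound z
  have hrow : ∀ n, row (f n) = row z := fun n =>
    le_antisymm ((row_le_of_le (hfm n).2).trans heq.ge) (row_le_of_le (hfm n).1)
  have : StrictAnti fun n => rank m (f n) := fun a b hab =>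
    rank_lt_rank (hrow b) (hrow a) (hm _ (hfm b).1 (hrow b)) (hf hab)
  exact (RelEmbedding.natGT _ fun n => this (Nat.lt_succ_self n)).not_wellFounded
    (wellFounded_lt (α := Ordinal.{0}))

theorem Descends.map {X Y : Type} [LinearOrder X] [LinearOrder Y] (e : X ≃o Y) {z w : X}
    (h : Descends z w) : Descends (e z) (e w) := by
  obtain ⟨f, hf, hfm⟩ := h
  exact ⟨e ∘ f, e.strictMono.comp_strictAnti hf,
    fun n => ⟨e.monotone (hfm n).1, e.monotone (hfm n).2⟩⟩

variable [WellFoundedLT I]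

/-- "Being in a later row" is expressible by descents, hence preserved by isomorphisms. A strictly
monotone map of a well-order into itself never decreases a point, and the induction is the usual one
for that fact. -/
theorem row_le_row_iso (e : RowSum D ≃o RowSum D') (z : RowSum D) : row z ≤ row (e z) := by
  suffices ∀ i, ∀ z : RowSum D, row z = i → i ≤ row (e z) from this _ z rfl
  intro i
  induction i using WellFoundedLT.induction with
  | ind i ih =>
    intro z hz
    by_contra hlt
    rw [not_le] at hlt
    have h1 := ih _ hlt (low D (row (e z)) 0) rfl
    have h2 := row_lt_of_descends ((descends_of_row_lt (z := low D (row (e z)) 0) (w := z)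
      (by simpa [hz] using hlt)).map e)
    exact absurd h1 (not_le.2 h2)

theorem row_iso (e : RowSum D ≃o RowSum D') (z : RowSum D) : row (e z) = row z :=
  le_antisymm (by simpa using row_le_row_iso e.symm (e z)) (row_le_row_iso e z)

/-- An isomorphism of row sums relates the order types of the rows up to finite prefixes. -/
theorem exists_type_le_of_iso (e : RowSum D ≃o RowSum D') (i : I) :
    ∃ n : ℕ, typeLT (D i) ≤ n + typeLT (D' i) := by
  rcases isEmpty_or_nonempty (D i) with hemp | hne
  · exact ⟨0, by rw [type_eq_zero_iff_isEmpty.2 hemp]; exact zero_le⟩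
  · obtain ⟨d₀, -, hmin⟩ := (wellFounded_lt (α := D i)).has_min Set.univ Set.univ_nonempty
    obtain ⟨m, hm⟩ := exists_bound (e (high i d₀))
    have hrow : ∀ d, row (e (high i d)) = i := fun d => row_iso e _
    rw [hrow] at hm
    -- The images of the main part lie above the image of its least point `d₀`, so they meet at most
    -- `m + 1` points of `ω*`, which are ranked first.
    refine ⟨m + 1, type_le_of_strictMono (fun d => rank m (e (high i d))) (fun c d hcd => ?_)
      fun d => ?_⟩
    · refine rank_lt_rank (hrow c) (hrow d) (hm _ (e.monotone ?_) (hrow c))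
        (e.strictMono (by simpa using hcd))
      rw [← not_lt, high_lt_high]
      exact hmin c trivial
    · have h := hrow d
      rcases cases (e (high i d)) with ⟨j, n, hj⟩ | ⟨j, d', hj⟩
      · rw [hj, rank_low]
        refine lt_of_lt_of_le ?_ le_self_add
        exact_mod_cast (by omega : m - n < m + 1)
      · rw [hj] at h ⊢
        obtain rfl : j = i := h
        rw [rank_high]
        push_cast
        exact (add_lt_add_iff_left _).2 (typein_lt_type _ _)

omit [WellFoundedLT I] in
theorem nonempty_iso_of_type_eq (h : ∀ i, typeLT (D i) = typeLT (D' i)) :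
    Nonempty (RowSum D ≃o RowSum D') := by
  have h' : ∀ i, Nonempty (D i ≃o D' i) := fun i =>
    (type_eq.1 (h i)).map OrderIso.ofRelIsoLT
  let f : ∀ i, (ℕᵒᵈ ⊕ₗ D i) ≃o (ℕᵒᵈ ⊕ₗ D' i) := fun i =>
    OrderIso.sumLexCongr (OrderIso.refl _) (h' i).some
  let e : RowSum D ≃ RowSum D' := Equiv.sigmaCongrRight fun i => (f i).toEquiv
  have he : StrictMono e := by
    rintro ⟨i, a⟩ ⟨j, b⟩ hlt
    rcases hlt with ⟨_, _, hij⟩ | ⟨_, _, hab⟩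
    · exact Sigma.Lex.left _ _ hij
    · exact Sigma.Lex.right _ _ ((f i).strictMono hab)
  exact ⟨he.orderIsoOfRightInverse e e.symm e.apply_symm_apply⟩

/-- An embedding of the rationals would, by well-foundedness of the index order, stay in one row on
some interval `(0, q₀]`. There it can map neither into `ω*`, where the numbers decrease along
increasing points, nor into the well-ordered main part, since the order is dense and has no least
point. -/
theorem isScattered : IsScattered (RowSum D) := by
  refine ⟨fun f => ?_⟩
  obtain ⟨i, ⟨q₀, hq₀, rfl⟩, hmin⟩ := (wellFounded_lt (α := I)).has_min
    ((fun q => row (f q)) '' Set.Ioi 0) ⟨_, 1, by simp, rfl⟩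
  have hrow : ∀ q, 0 < q → q ≤ q₀ → row (f q) = row (f q₀) := fun q h0 h =>
    le_antisymm (row_le_of_le (f.monotone h)) (not_lt.1 (hmin _ ⟨q, h0, rfl⟩))
  set i := row (f q₀)
  have hq₀' : (0 : ℚ) < q₀ := hq₀
  -- Below a point of `ω*`, a row has only points of `ω*`. Take `p < q` whose image has the least
  -- number; a point between `p` and `q` would have a smaller one.
  have hlow : ∀ q, 0 < q → q ≤ q₀ → ∀ n, f q ≠ low D i n := by
    intro q h0 hq
    by_contra! hn
    obtain ⟨n, hn⟩ := hn
    have hne : {k | ∃ p, 0 < p ∧ p < q ∧ f p = low D i k}.Nonempty := by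
      have hr := hrow (q / 2) (by linarith) (by linarith)
      have hlt := f.strictMono (by linarith : q / 2 < q)
      rcases cases (f (q / 2)) with ⟨j, m, hj⟩ | ⟨j, d, hj⟩
      · rw [hj, row_low] at hr
        subst hr
        exact ⟨m, q / 2, by linarith, by linarith, hj⟩
      · rw [hj, row_high] at hr
        subst hr
        rw [hj, hn] at hlt
        exact absurd hlt (not_lt.2 (low_lt_high _ _ _).le)
    obtain ⟨k, ⟨p, hp0, hpq, hpk⟩, hk⟩ := (wellFounded_lt (α := ℕ)).has_min
      {k | ∃ p, 0 < p ∧ p < q ∧ f p = low D i k} hne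
    obtain ⟨p', hp1, hp2⟩ := exists_between hpq
    have hlt := f.strictMono hp1
    have hlt' := f.strictMono hp2
    have hr := hrow p' (by linarith) (by linarith)
    rcases cases (f p') with ⟨j, m, hj⟩ | ⟨j, d, hj⟩
    · rw [hj, row_low] at hr
      subst hr
      rw [hj, hpk, low_lt_low] at hlt
      exact hk m ⟨p', by linarith, hp2, hj⟩ hlt
    · rw [hj, row_high] at hr
      subst hr
      rw [hj, hn] at hlt'
      exact absurd hlt' (not_lt.2 (low_lt_high _ _ _).le)
  have hhigh : ∀ q, 0 < q → q ≤ q₀ → ∃ d : D i, f q = high i d := by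
    intro q h0 hq
    have hr := hrow q h0 hq
    rcases cases (f q) with ⟨j, m, hj⟩ | ⟨j, d, hj⟩
    · rw [hj, row_low] at hr
      subst hr
      exact absurd hj (hlow q h0 hq m)
    · rw [hj, row_high] at hr
      subst hr
      exact ⟨d, hj⟩
  obtain ⟨d, ⟨q, h0, hq, hd⟩, hmin'⟩ := (wellFounded_lt (α := D i)).has_min
    {d | ∃ q, 0 < q ∧ q ≤ q₀ ∧ f q = high i d}
    (let ⟨d, hd⟩ := hhigh q₀ hq₀' le_rfl; ⟨d, q₀, hq₀', le_rfl, hd⟩)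
  obtain ⟨d', hd'⟩ := hhigh (q / 2) (by linarith) (by linarith)
  have hlt := f.strictMono (by linarith : q / 2 < q)
  rw [hd, hd', high_lt_high] at hlt
  exact hmin' d' ⟨q / 2, by linarith, by linarith, hd'⟩ hlt

end RowSum

/-! ### Decomposition of trees and asymmetry of the tree order -/

namespace LTree

variable {α : Type*}

theorem label_eq_none_of_nil {t : LTree α} (h : t.label [] = none) (u : List Bool) :
    t.label u = none := by
  by_contra hu
  exact t.prefix_closed [] u hu h

theorem eq_empty_iff {t : LTree α} : t = empty ↔ t.label [] = none :=
  ⟨fun h => h ▸ rfl, fun h => LTree.ext (funext fun u => label_eq_none_of_nil h u)⟩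

/-- The tree with root label `a` and subtrees `l` and `r`; `r` is dropped if `l` is empty. -/
def node (a : α) (l r : LTree α) : LTree α where
  label
    | [] => some a
    | false :: u => l.label u
    | true :: u => if (l.label []).isSome then r.label u else none
  finite_dom := by
    refine ((Set.finite_singleton []).union ((l.finite_dom.image (List.cons false)).union
      (r.finite_dom.image (List.cons true)))).subset ?_
    rintro (_ | ⟨_ | _, u⟩) h
    · exact .inl rfl
    · exact .inr (.inl ⟨u, h, rfl⟩)
    · refine .inr (.inr ⟨u, fun hu => h ?_, rfl⟩)
      simp [hu]
  prefix_closed := by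
    rintro (_ | ⟨_ | _, u⟩) v h
    · simp
    · exact l.prefix_closed u v h
    · simp only [List.cons_append, ne_eq, ite_eq_right_iff, not_forall] at h ⊢
      exact ⟨h.1, r.prefix_closed u v h.2⟩
  left_of_right := by
    rintro (_ | ⟨_ | _, u⟩) h
    · simp only [List.nil_append, ne_eq, ite_eq_right_iff, not_forall] at h ⊢
      exact Option.isSome_iff_ne_none.1 h.1
    · exact l.left_of_right u h
    · simp only [List.cons_append, ne_eq, ite_eq_right_iff, not_forall] at h ⊢
      exact ⟨h.1, r.left_of_right u h.2⟩

@[simp] theorem label_node_nil (a : α) (l r : LTree α) : (node a l r).label [] = some a := rfl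

theorem node_ne_empty (a : α) (l r : LTree α) : node a l r ≠ empty := by
  simp [eq_empty_iff]

theorem subtree_node_true (a : α) {l r : LTree α} (h : l = empty → r = empty) :
    (node a l r).subtree [true] = r := by
  refine LTree.ext (funext fun u => ?_)
  show (if (l.label []).isSome then r.label u else none) = r.label u
  by_cases hl : l = empty
  · rw [h hl]
    simp [empty]
  · rw [eq_empty_iff, ← ne_eq, ← Option.isSome_iff_ne_none] at hl
    simp [hl]

theorem subtree_true_eq_empty {t : LTree α} (h : t.subtree [false] = empty) :
    t.subtree [true] = empty := by
  rw [eq_empty_iff] at h ⊢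
  by_contra h'
  exact t.left_of_right [] h' h

theorem eq_node {t : LTree α} {a : α} (h : t.label [] = some a) :
    t = node a (t.subtree [false]) (t.subtree [true]) := by
  refine LTree.ext (funext fun u => ?_)
  rcases u with _ | ⟨_ | _, u⟩
  · exact h
  · rfl
  · show t.label (true :: u) = if (t.label [false]).isSome then t.label (true :: u) else none
    by_cases hl : t.label [false] = none
    · have := subtree_true_eq_empty (t := t) (eq_empty_iff.2 hl)
      have h' : t.label (true :: u) = none := congrArg (fun s : LTree α => s.label u) this
      simp [hl, h']
    · rw [← ne_eq, ← Option.isSome_iff_ne_none] at hl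
      simp [hl]

theorem ncard_subtree_lt {t : LTree α} (ht : t ≠ empty) (b : Bool) :
    (t.subtree [b]).dom.ncard < t.dom.ncard := by
  have h1 : (List.cons b '' (t.subtree [b]).dom) ⊆ t.dom := by
    rintro _ ⟨u, hu, rfl⟩
    exact hu
  have h2 : (List.cons b '' (t.subtree [b]).dom) ⊂ t.dom := by
    refine ⟨h1, fun h => ?_⟩
    obtain ⟨u, -, hu⟩ := h (show [] ∈ t.dom from fun h => ht (eq_empty_iff.2 h))
    simp at hu
  rw [← Set.ncard_image_of_injective _ (List.cons_injective (a := b))]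
  exact Set.ncard_lt_ncard h2 t.finite_dom

/-- The side condition on `l` and `r` reflects that a node has a right child only if it has a left
one; without it `node` would discard `r`. -/
theorem induction_node {P : LTree α → Prop} (he : P empty)
    (hn : ∀ a l r, (l = empty → r = empty) → P l → P r → P (node a l r)) (t : LTree α) : P t := by
  induction h : t.dom.ncard using Nat.strong_induction_on generalizing t with
  | _ n ih =>
    by_cases ht : t = empty
    · exact ht ▸ he
    · obtain ⟨a, ha⟩ := Option.ne_none_iff_exists'.1 (fun h => ht (eq_empty_iff.2 h))
      rw [eq_node ha]
      subst h
      exact hn _ _ _ subtree_true_eq_empty (ih _ (ncard_subtree_lt ht _) _ rfl)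
        (ih _ (ncard_subtree_lt ht _) _ rfl)

@[simp] theorem mainBranch_empty : (empty : LTree α).mainBranch = [] := by
  refine List.ext_getElem? fun i => ?_
  rw [mainBranch_getElem?]
  rfl

@[simp] theorem mainBranch_node (a : α) (l r : LTree α) :
    (node a l r).mainBranch = a :: l.mainBranch := by
  refine List.ext_getElem? fun i => ?_
  rw [mainBranch_getElem?]
  cases i with
  | zero => rfl
  | succ i =>
    rw [List.getElem?_cons_succ, mainBranch_getElem?]
    rfl

theorem mainBranch_eq_nil {t : LTree α} : t.mainBranch = [] ↔ t = empty := by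
  constructor
  · intro h
    rw [eq_empty_iff]
    simpa [h, mainNode] using (t.mainBranch_getElem? 0).symm
  · rintro rfl
    simp

theorem mem_dom_mainNode {t : LTree α} {i : ℕ} : mainNode i ∈ t.dom ↔ i < t.mainBranch.length := by
  rw [← not_iff_not, not_lt, ← List.getElem?_eq_none_iff, mainBranch_getElem?]
  exact not_not

theorem sideTree_node_zero (a : α) {l r : LTree α} (h : l = empty → r = empty) :
    (node a l r).sideTree 0 = r := subtree_node_true a h

theorem sideTree_node_succ (a : α) (l r : LTree α) (i : ℕ) :
    (node a l r).sideTree (i + 1) = l.sideTree i := by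
  refine LTree.ext (funext fun u => ?_)
  rfl

section Order

variable [LinearOrder α]

theorem shortlex_irrefl (w : List α) : ¬ List.Shortlex (· < ·) w w := fun h =>
  (Std.Asymm.asymm _ _ h : ¬ List.Shortlex (· < ·) w w) h

theorem TreesLT.ne {s t : LTree α} (h : TreesLT s t) : s ≠ t := by
  induction h with
  | empty_lt t ht => exact ht.symm
  | main s t h =>
    rintro rfl
    exact shortlex_irrefl _ h
  | side s t i _ _ _ _ ih =>
    rintro rfl
    exact ih rfl

theorem TreesLT.ne_empty {s t : LTree α} (h : TreesLT s t) : t ≠ empty := by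
  rintro rfl
  cases h with
  | empty_lt _ h => exact h rfl
  | main _ _ h => simp at h
  | side _ _ i hm hi =>
    rw [mem_dom_mainNode, hm] at hi
    simp at hi

theorem TreesLT.asymm {s t : LTree α} (h : TreesLT s t) : ¬ TreesLT t s := by
  induction h with
  | empty_lt t _ => exact fun h => h.ne_empty rfl
  | main s t hst =>
    intro h
    cases h with
    | empty_lt _ _ => simp at hst
    | main _ _ hts => exact Std.Asymm.asymm _ _ hst hts
    | side _ _ i hm => exact shortlex_irrefl _ (hm ▸ hst)
  | side s t i hm hi hj hlt ih =>
    intro h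
    cases h with
    | empty_lt _ h =>
      rw [mainBranch_empty, mainBranch_eq_nil] at hm
      exact h hm
    | main _ _ hts => exact shortlex_irrefl _ (hm ▸ hts)
    | side _ _ i' _ _ hj' hlt' =>
      rcases lt_trichotomy i i' with h | rfl | h
      · rw [hj' i h] at ih hlt
        exact ih hlt
      · exact ih hlt'
      · rw [hj i' h] at hlt'
        exact hlt'.ne rfl

end Order

end LTree

/-! ### Coding row sums by trees -/

/-- Words with the length-lexicographic order. -/
def ShortlexWord (α : Type*) : Type _ := List α

namespace ShortlexWord

variable {α : Type} [LinearOrder α]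

noncomputable instance : LinearOrder (ShortlexWord α) :=
  LinearOrder.lift' (fun w : List α => (toLex (w.length, w) : ℕ ×ₗ List α))
    fun _ _ h => congrArg (fun p => (ofLex p).2) h

theorem lt_iff {v w : ShortlexWord α} : v < w ↔ List.Shortlex (· < ·) (v : List α) w :=
  Prod.Lex.toLex_lt_toLex.trans List.shortlex_def.symm

instance [WellFoundedLT α] : WellFoundedLT (ShortlexWord α) :=
  ⟨Subrelation.wf (fun h => lt_iff.1 h) (List.Shortlex.wf (wellFounded_lt (α := α)))⟩

end ShortlexWord

theorem List.Shortlex.append_singleton {α : Type*} [LinearOrder α] {v w : List α} (a : α)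
    (h : List.Shortlex (· < ·) v w) : List.Shortlex (· < ·) (v ++ [a]) (w ++ [a]) := by
  rw [List.shortlex_def] at h ⊢
  rcases h with h | ⟨h, hl⟩
  · exact .inl (by simpa using h)
  · refine .inr ⟨by simpa using h, ?_⟩
    induction hl with
    | nil => simp at h
    | cons _ ih => exact List.Lex.cons (ih (by simpa using h))
    | rel hab => exact List.Lex.rel hab

namespace LTree

variable {α : Type} (a₀ a₁ : α)

/-- The tree whose main branch is a word of `n` letters, without side trees. -/
def chain : ℕ → LTree α
  | 0 => empty
  | n + 1 => node a₀ (chain n) empty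

/-- The tree whose main branch is `w` followed by `a₀`, and whose side trees are the chains of
the lengths given by `c`. -/
def spine : List α → Content → LTree α
  | [], _ => node a₀ empty empty
  | a :: w, c => node a (spine w c.tail) (chain a₀ (c 0))

/-- The tree with main branch `ab` and first side tree `s`. -/
def pair (a b : α) (s : LTree α) : LTree α := node a (node b empty empty) s

/-- A descending sequence of trees. -/
def descent : ℕ → LTree α
  | 0 => pair a₀ a₁ empty
  | n + 1 => pair a₀ a₀ (descent n)

/-- The tree with the main branch `a₀ w a₀`, first side tree `s`, and the further side trees
coded by `c`. -/
def coded (w : List α) (c : Content) (s : LTree α) : LTree α := node a₀ (spine a₀ w c) s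

theorem spine_ne_empty (w : List α) (c : Content) : spine a₀ w c ≠ empty := by
  cases w <;> exact node_ne_empty _ _ _

@[simp] theorem mainBranch_chain (n : ℕ) : (chain a₀ n).mainBranch = List.replicate n a₀ := by
  induction n with
  | zero => exact mainBranch_empty
  | succ n ih => rw [chain, mainBranch_node, ih, List.replicate_succ]

@[simp] theorem mainBranch_spine (w : List α) (c : Content) :
    (spine a₀ w c).mainBranch = w ++ [a₀] := by
  induction w generalizing c with
  | nil => rw [spine, mainBranch_node, mainBranch_empty, List.nil_append]
  | cons a w ih => rw [spine, mainBranch_node, ih, List.cons_append]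

theorem sideTree_spine (w : List α) (c : Content) {i : ℕ} (hi : i < w.length) :
    (spine a₀ w c).sideTree i = chain a₀ (c i) := by
  induction w generalizing c i with
  | nil => simp at hi
  | cons a w ih =>
    cases i with
    | zero => exact sideTree_node_zero a fun h => absurd h (spine_ne_empty _ _ _)
    | succ i =>
      rw [spine, sideTree_node_succ, ih _ (by simpa using hi)]
      rfl

@[simp] theorem mainBranch_pair (a b : α) (s : LTree α) : (pair a b s).mainBranch = [a, b] := by
  simp [pair]

theorem sideTree_pair_zero (a b : α) (s : LTree α) : (pair a b s).sideTree 0 = s :=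
  sideTree_node_zero a fun h => absurd h (node_ne_empty _ _ _)

@[simp] theorem mainBranch_coded (w : List α) (c : Content) (s : LTree α) :
    (coded a₀ w c s).mainBranch = a₀ :: (w ++ [a₀]) := by
  simp [coded]

theorem sideTree_coded_zero (w : List α) (c : Content) (s : LTree α) :
    (coded a₀ w c s).sideTree 0 = s :=
  sideTree_node_zero a₀ fun h => absurd h (spine_ne_empty _ _ _)

theorem sideTree_coded_succ (w : List α) (c : Content) (s : LTree α) {i : ℕ} (hi : i < w.length) :
    (coded a₀ w c s).sideTree (i + 1) = chain a₀ (c i) := by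
  rw [coded, sideTree_node_succ, sideTree_spine _ _ _ hi]

variable [LinearOrder α]

theorem chain_lt_chain {m n : ℕ} (h : m < n) : TreesLT (chain a₀ m) (chain a₀ n) :=
  .main _ _ (List.Shortlex.of_length_lt (by simpa using h))

theorem pair_lt_pair_of_lex {a b a' b' : α} (s s' : LTree α)
    (h : List.Lex (· < ·) [a, b] [a', b']) : TreesLT (pair a b s) (pair a' b' s') :=
  .main _ _ (by simpa using List.Shortlex.of_lex (s := [a, b]) (t := [a', b']) rfl h)

theorem pair_lt_pair (a b : α) {s s' : LTree α} (h : TreesLT s s') :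
    TreesLT (pair a b s) (pair a b s') := by
  refine .side _ _ 0 (by simp) (mem_dom_mainNode.2 (by simp)) (by simp) ?_
  rwa [sideTree_pair_zero, sideTree_pair_zero]

theorem descent_lt_descent {a₀ a₁ : α} (h01 : a₀ < a₁) {m n : ℕ} (h : m < n) :
    TreesLT (descent a₀ a₁ n) (descent a₀ a₁ m) := by
  induction m generalizing n with
  | zero =>
    obtain ⟨n, rfl⟩ := Nat.exists_eq_succ_of_ne_zero h.ne'
    exact pair_lt_pair_of_lex _ _ (.cons (.rel h01))
  | succ m ih =>
    obtain ⟨n, rfl⟩ := Nat.exists_eq_succ_of_ne_zero (by omega : n ≠ 0)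
    exact pair_lt_pair _ _ (ih (by omega))

theorem descent_lt_pair {a₀ a₁ : α} (h01 : a₀ < a₁) (n : ℕ) (b : α) (s : LTree α) :
    TreesLT (descent a₀ a₁ n) (pair a₁ b s) := by
  cases n <;> exact pair_lt_pair_of_lex _ _ (.rel h01)

theorem coded_lt_of_shortlex {v w : List α} (h : List.Shortlex (· < ·) v w) (c d : Content)
    (s t : LTree α) : TreesLT (coded a₀ v c s) (coded a₀ w d t) := by
  refine .main _ _ ?_
  rw [mainBranch_coded, mainBranch_coded, List.shortlex_cons_iff]
  exact h.append_singleton a₀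

/-- The tag is the first side tree, so it takes precedence over the content and splits the trees
over one word into `ω*`, `A` and `B`. -/
theorem coded_lt_of_tag (w : List α) (c d : Content) {s t : LTree α} (h : TreesLT s t) :
    TreesLT (coded a₀ w c s) (coded a₀ w d t) := by
  refine .side _ _ 0 (by simp) (mem_dom_mainNode.2 (by simp)) (by simp) ?_
  rwa [sideTree_coded_zero, sideTree_coded_zero]

theorem coded_lt_of_content (w : List α) {c d : Content} (hd : ∀ i ≥ w.length, d i = 0)
    (s : LTree α) (h : c < d) : TreesLT (coded a₀ w c s) (coded a₀ w d s) := by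
  obtain ⟨i, hj, hi⟩ := Content.lt_iff.1 h
  -- Entries of `d` beyond the word vanish, so the first difference is at a position that really
  -- carries a side tree.
  have hiw : i < w.length := by
    by_contra hle
    rw [hd i (not_lt.1 hle)] at hi
    exact absurd hi (Nat.not_lt_zero _)
  refine .side _ _ (i + 1) (by simp) (mem_dom_mainNode.2 (by simp; omega)) (fun j hji => ?_) ?_
  · cases j with
    | zero => rw [sideTree_coded_zero, sideTree_coded_zero]
    | succ j =>
      rw [sideTree_coded_succ _ _ _ _ (by omega), sideTree_coded_succ _ _ _ _ (by omega),
        hj j (by omega)]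
  · rw [sideTree_coded_succ _ _ _ _ hiw, sideTree_coded_succ _ _ _ _ hiw]
    exact chain_lt_chain a₀ hi

/-- The set of trees that code the row sum with the rows `A w + B w`. -/
def codedSet (A B : List α → Set Content) : Set (LTree α) :=
  {t | ∃ w, (∃ n, t = coded a₀ w (toLex 0) (descent a₀ a₁ n)) ∨
    (∃ c ∈ A w, t = coded a₀ w c (pair a₁ a₀ empty)) ∨
    ∃ c ∈ B w, t = coded a₀ w c (pair a₁ a₁ empty)}

end LTree

/-- As `X` is linear, monotonicity together with irreflexivity and asymmetry of `TreesLT` already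
gives an isomorphism onto the range; transitivity or totality of the tree order is not needed. -/
theorem treesIso_of_strictMono {α : Type} [LinearOrder α] {X : Type} [LinearOrder X]
    (f : X → LTree α) (hf : ∀ x y, x < y → LTree.TreesLT (f x) (f y)) :
    TreesIso (Set.range f) X := by
  have hinj : Function.Injective f := fun x y h => by
    rcases lt_trichotomy x y with hlt | rfl | hlt
    · exact absurd h (hf _ _ hlt).ne
    · rfl
    · exact absurd h.symm (hf _ _ hlt).ne
  refine ⟨RelIso.symm ⟨Equiv.ofInjective f hinj, fun {x y} => ?_⟩⟩
  show (f x = f y ∨ LTree.TreesLT (f x) (f y)) ↔ x ≤ y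
  rw [le_iff_eq_or_lt, hinj.eq_iff]
  refine or_congr_right ⟨fun h => ?_, hf x y⟩
  rcases lt_trichotomy x y with hlt | rfl | hlt
  · exact hlt
  · exact absurd rfl h.ne
  · exact absurd (hf _ _ hlt) h.asymm

theorem treesIso_codedSet {α : Type} [LinearOrder α] {a₀ a₁ : α} (h01 : a₀ < a₁)
    {A B : List α → Set Content} (hA : ∀ w, ∀ c ∈ A w, ∀ i ≥ w.length, c i = 0)
    (hB : ∀ w, ∀ c ∈ B w, ∀ i ≥ w.length, c i = 0) :
    TreesIso (LTree.codedSet a₀ a₁ A B)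
      (RowSum fun w : ShortlexWord α => A w ⊕ₗ B w) := by
  let f : RowSum (fun w : ShortlexWord α => A w ⊕ₗ B w) → LTree α := fun z =>
    match ofLex z with
    | ⟨w, y⟩ => match ofLex y with
      | .inl n => LTree.coded a₀ w (toLex 0) (LTree.descent a₀ a₁ (OrderDual.ofDual n))
      | .inr d => match ofLex d with
        | .inl c => LTree.coded a₀ w c (LTree.pair a₁ a₀ .empty)
        | .inr c => LTree.coded a₀ w c (LTree.pair a₁ a₁ .empty)
  have hrange : Set.range f = LTree.codedSet a₀ a₁ A B := by
    ext t
    constructor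
    · rintro ⟨⟨w, n | c | c⟩, rfl⟩
      · exact ⟨w, .inl ⟨_, rfl⟩⟩
      · exact ⟨w, .inr (.inl ⟨c, c.2, rfl⟩)⟩
      · exact ⟨w, .inr (.inr ⟨c, c.2, rfl⟩)⟩
    · rintro ⟨w, ⟨n, rfl⟩ | ⟨c, hc, rfl⟩ | ⟨c, hc, rfl⟩⟩
      · exact ⟨RowSum.low _ w n, rfl⟩
      · exact ⟨RowSum.high (D := fun w : ShortlexWord α => A w ⊕ₗ B w) w
          (toLex (.inl ⟨c, hc⟩)), rfl⟩
      · exact ⟨RowSum.high (D := fun w : ShortlexWord α => A w ⊕ₗ B w) w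
          (toLex (.inr ⟨c, hc⟩)), rfl⟩
  rw [← hrange]
  refine treesIso_of_strictMono f ?_
  rintro ⟨v, y⟩ ⟨w, z⟩ h
  rcases h with ⟨_, _, h⟩ | ⟨_, _, h⟩
  · rcases y with n | c | c <;> rcases z with m | d | d <;>
      exact LTree.coded_lt_of_shortlex a₀ (ShortlexWord.lt_iff.1 h) _ _ _ _
  · rcases h with h | h | h
    · exact LTree.coded_lt_of_tag _ _ _ _ (LTree.descent_lt_descent h01 h)
    · rcases h with h | h | h
      · exact LTree.coded_lt_of_content _ _ (hA _ _ (Subtype.prop _)) _ h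
      · exact LTree.coded_lt_of_content _ _ (hB _ _ (Subtype.prop _)) _ h
      · exact LTree.coded_lt_of_tag _ _ _ _ (LTree.pair_lt_pair_of_lex _ _ (.cons (.rel h01)))
    · rename_i n d
      rcases d with c | c <;>
        exact LTree.coded_lt_of_tag _ _ _ _ (LTree.descent_lt_pair h01 _ _ _)

/-! ### Tree automata for coded sets -/

namespace TreeAutomaton

variable {α Q : Type*} (A : TreeAutomaton α Q)

/-- The trees that admit a run of `A` with the value `q` at the root. -/
def langOf (q : Q) : Set (LTree α) := {t | ∃ ρ, A.IsRun t ρ ∧ ρ [] = q}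

theorem language_eq_langOf {q : Q} (h : A.final = {q}) : A.language = A.langOf q := by
  ext t
  simp [language, langOf, h]

theorem empty_mem_langOf {q : Q} : LTree.empty ∈ A.langOf q ↔ q = A.init := by
  constructor
  · rintro ⟨ρ, hρ, rfl⟩
    exact hρ.1 [] (by simp [LTree.dom, LTree.empty])
  · rintro rfl
    exact ⟨fun _ => A.init, ⟨fun _ _ => rfl, fun u a h => by simp [LTree.empty] at h⟩, rfl⟩

theorem node_mem_langOf {q : Q} {a : α} {l r : LTree α} (hlr : l = .empty → r = .empty) :
    LTree.node a l r ∈ A.langOf q ↔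
      ∃ p p', (q, a, p, p') ∈ A.trans ∧ l ∈ A.langOf p ∧ r ∈ A.langOf p' := by
  have hsub := LTree.subtree_node_true a hlr
  have hlabel : ∀ u, (LTree.node a l r).label (true :: u) = r.label u := fun u =>
    congrArg (fun s : LTree α => s.label u) hsub
  constructor
  · rintro ⟨ρ, hρ, rfl⟩
    refine ⟨ρ [false], ρ [true], hρ.2 [] a rfl, ⟨fun u => ρ (false :: u), ⟨fun u hu => ?_,
      fun u b hb => ?_⟩, rfl⟩, ⟨fun u => ρ (true :: u), ⟨fun u hu => ?_, fun u b hb => ?_⟩, rfl⟩⟩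
    · exact hρ.1 (false :: u) hu
    · exact hρ.2 (false :: u) b hb
    · exact hρ.1 (true :: u) fun h => hu (by simpa [LTree.dom, hlabel] using h)
    · exact hρ.2 (true :: u) b (by rw [hlabel, hb])
  · rintro ⟨p, p', ht, ⟨ρ, hρ, rfl⟩, ⟨ρ', hρ', rfl⟩⟩
    refine ⟨fun u => match u with
      | [] => q
      | false :: u => ρ u
      | true :: u => ρ' u, ⟨?_, ?_⟩, rfl⟩
    · rintro (_ | ⟨_ | _, u⟩) hu
      · exact absurd (show [] ∈ (LTree.node a l r).dom by simp [LTree.dom]) hu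
      · exact hρ.1 u hu
      · exact hρ'.1 u fun h => hu (by simpa [LTree.dom, hlabel] using h)
    · rintro (_ | ⟨_ | _, u⟩) b hb
      · obtain rfl : a = b := by simpa using hb
        exact ht
      · exact hρ.2 u b hb
      · exact hρ'.2 u b (by rwa [hlabel] at hb)

end TreeAutomaton

/-- A nondeterministic finite transducer that replaces every letter by a flag. -/
structure FlagTransducer (α Q : Type) where
  step : Q → α → Bool → Q → Prop
  final : Q → Prop

namespace FlagTransducer

variable {α Q Q' : Type}

/-- `T.Runs q w s` means that `T` can translate `w` into `s` starting from the state `q`. -/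
inductive Runs (T : FlagTransducer α Q) : Q → List α → List Bool → Prop
  | nil (q : Q) : T.final q → Runs T q [] []
  | cons {q q' : Q} {a : α} {b : Bool} {w : List α} {s : List Bool} :
      T.step q a b q' → Runs T q' w s → Runs T q (a :: w) (b :: s)

theorem Runs.length_eq {T : FlagTransducer α Q} {q : Q} {w : List α} {s : List Bool}
    (h : T.Runs q w s) : s.length = w.length := by
  induction h with
  | nil => rfl
  | cons _ _ ih => simp [ih]

/-- The nonzero entries of `c` are at flagged positions of `s`. -/
def Supported (c : Content) (s : List Bool) : Prop := ∀ i, c i ≠ 0 → s[i]? = some true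

theorem supported_cons {c : Content} {b : Bool} {s : List Bool} :
    Supported c (b :: s) ↔ (c 0 ≠ 0 → b = true) ∧ Supported c.tail s := by
  constructor
  · exact fun h => ⟨fun h0 => by simpa using h 0 h0, fun i hi => by simpa using h (i + 1) hi⟩
  · rintro ⟨h0, h⟩ (_ | i) hi
    · simpa using h0 hi
    · simpa using h i hi

theorem supported_nil {c : Content} : Supported c [] ↔ c = toLex 0 := by
  constructor
  · intro h
    funext i
    by_contra hi
    simpa using h i hi
  · rintro rfl i hi
    exact absurd rfl hi

/-- The contents supported by the translations of `w` starting from states in `I`. -/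
def contents (T : FlagTransducer α Q) (I : Set Q) (w : List α) : Set Content :=
  {c | ∃ q ∈ I, ∃ s, T.Runs q w s ∧ Supported c s}

theorem contents_bounded (T : FlagTransducer α Q) (I : Set Q) (w : List α) :
    ∀ c ∈ T.contents I w, ∀ i ≥ w.length, c i = 0 := by
  rintro c ⟨q, -, s, hs, hc⟩ i hi
  by_contra h
  have h' := hc i h
  rw [List.getElem?_eq_none (by rw [hs.length_eq]; exact hi)] at h'
  simp at h'

/-- The states of the tree automaton that reads a word together with contents. -/
inductive SpineState (Q : Type)
  | empty | chain | leaf₀ | leaf₁ | descent | tagA | tagB | root | plain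
  | run (q : Q)

open SpineState

/-- The transitions of the tree automaton that reads a word together with contents. -/
inductive SpineTrans (T : FlagTransducer α Q) (a₀ a₁ : α) (IA IB : Set Q) :
    SpineState Q → α → SpineState Q → SpineState Q → Prop
  | chain_last : SpineTrans T a₀ a₁ IA IB chain a₀ empty empty
  | chain_step : SpineTrans T a₀ a₁ IA IB chain a₀ chain empty
  | leaf₀ : SpineTrans T a₀ a₁ IA IB leaf₀ a₀ empty empty
  | leaf₁ : SpineTrans T a₀ a₁ IA IB leaf₁ a₁ empty empty
  | descent_zero : SpineTrans T a₀ a₁ IA IB descent a₀ leaf₁ empty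
  | descent_succ : SpineTrans T a₀ a₁ IA IB descent a₀ leaf₀ descent
  | tagA : SpineTrans T a₀ a₁ IA IB tagA a₁ leaf₀ empty
  | tagB : SpineTrans T a₀ a₁ IA IB tagB a₁ leaf₁ empty
  | plain_last : SpineTrans T a₀ a₁ IA IB plain a₀ empty empty
  | plain_step (a : α) : SpineTrans T a₀ a₁ IA IB plain a plain empty
  | run_last (q : Q) : T.final q → SpineTrans T a₀ a₁ IA IB (run q) a₀ empty empty
  | run_step (q : Q) (a : α) (b : Bool) (q' : Q) :
      T.step q a b q' → SpineTrans T a₀ a₁ IA IB (run q) a (run q') empty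
  | run_flag (q : Q) (a : α) (q' : Q) :
      T.step q a true q' → SpineTrans T a₀ a₁ IA IB (run q) a (run q') chain
  | root_plain : SpineTrans T a₀ a₁ IA IB root a₀ plain descent
  | root_A (q : Q) : q ∈ IA → SpineTrans T a₀ a₁ IA IB root a₀ (run q) tagA
  | root_B (q : Q) : q ∈ IB → SpineTrans T a₀ a₁ IA IB root a₀ (run q) tagB

/-- The tree automaton that reads a word together with contents. -/
def spineAutomaton (T : FlagTransducer α Q) (a₀ a₁ : α) (IA IB : Set Q) :
    TreeAutomaton α (SpineState Q) where
  init := empty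
  trans := {p | SpineTrans T a₀ a₁ IA IB p.1 p.2.1 p.2.2.1 p.2.2.2}
  final := {root}

section

variable (T : FlagTransducer α Q) (a₀ a₁ : α) (IA IB : Set Q)

local notation "𝓐" => spineAutomaton T a₀ a₁ IA IB

theorem empty_mem_spine {q : SpineState Q} : LTree.empty ∈ (𝓐).langOf q ↔ q = empty :=
  (𝓐).empty_mem_langOf

theorem node_mem_spine {q : SpineState Q} {a : α} {l r : LTree α}
    (hlr : l = .empty → r = .empty) : LTree.node a l r ∈ (𝓐).langOf q ↔
      ∃ p p', SpineTrans T a₀ a₁ IA IB q a p p' ∧ l ∈ (𝓐).langOf p ∧ r ∈ (𝓐).langOf p' :=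
  (𝓐).node_mem_langOf hlr

theorem mem_langOf_empty {t : LTree α} : t ∈ (𝓐).langOf empty ↔ t = .empty := by
  induction t using LTree.induction_node with
  | he => simp [empty_mem_spine]
  | hn a l r hlr =>
    simp only [node_mem_spine _ _ _ _ _ hlr, LTree.node_ne_empty, iff_false]
    rintro ⟨p, p', h, -⟩
    cases h

theorem mem_langOf_leaf₀ {t : LTree α} :
    t ∈ (𝓐).langOf leaf₀ ↔ t = .node a₀ .empty .empty := by
  constructor
  · induction t using LTree.induction_node with
    | he => simp [empty_mem_spine]
    | hn a l r hlr =>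
      rw [node_mem_spine _ _ _ _ _ hlr]
      rintro ⟨p, p', h, hl, hr⟩
      cases h
      rw [mem_langOf_empty] at hl hr
      rw [hl, hr]
  · rintro rfl
    rw [node_mem_spine _ _ _ _ _ fun _ => rfl]
    exact ⟨_, _, .leaf₀, by rw [mem_langOf_empty], by rw [mem_langOf_empty]⟩

theorem mem_langOf_leaf₁ {t : LTree α} :
    t ∈ (𝓐).langOf leaf₁ ↔ t = .node a₁ .empty .empty := by
  constructor
  · induction t using LTree.induction_node with
    | he => simp [empty_mem_spine]
    | hn a l r hlr =>
      rw [node_mem_spine _ _ _ _ _ hlr]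
      rintro ⟨p, p', h, hl, hr⟩
      cases h
      rw [mem_langOf_empty] at hl hr
      rw [hl, hr]
  · rintro rfl
    rw [node_mem_spine _ _ _ _ _ fun _ => rfl]
    exact ⟨_, _, .leaf₁, by rw [mem_langOf_empty], by rw [mem_langOf_empty]⟩

theorem mem_langOf_chain {t : LTree α} :
    t ∈ (𝓐).langOf chain ↔ ∃ n, t = LTree.chain a₀ (n + 1) := by
  constructor
  · induction t using LTree.induction_node with
    | he => simp [empty_mem_spine]
    | hn a l r hlr ihl ihr =>
      rw [node_mem_spine _ _ _ _ _ hlr]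
      rintro ⟨p, p', h, hl, hr⟩
      cases h with
      | chain_last =>
        rw [mem_langOf_empty] at hl hr
        exact ⟨0, by rw [hl, hr]; rfl⟩
      | chain_step =>
        obtain ⟨n, rfl⟩ := ihl hl
        rw [mem_langOf_empty] at hr
        exact ⟨n + 1, by rw [hr]; rfl⟩
  · rintro ⟨n, rfl⟩
    induction n with
    | zero =>
      rw [LTree.chain, node_mem_spine _ _ _ _ _ fun _ => rfl]
      exact ⟨_, _, .chain_last, by rw [mem_langOf_empty]; rfl, by rw [mem_langOf_empty]⟩
    | succ n ih =>
      rw [LTree.chain, node_mem_spine _ _ _ _ _ fun _ => rfl]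
      exact ⟨_, _, .chain_step, ih, by rw [mem_langOf_empty]⟩

theorem mem_langOf_descent {t : LTree α} :
    t ∈ (𝓐).langOf descent ↔ ∃ n, t = LTree.descent a₀ a₁ n := by
  constructor
  · induction t using LTree.induction_node with
    | he => simp [empty_mem_spine]
    | hn a l r hlr ihl ihr =>
      rw [node_mem_spine _ _ _ _ _ hlr]
      rintro ⟨p, p', h, hl, hr⟩
      cases h with
      | descent_zero =>
        rw [mem_langOf_leaf₁] at hl
        rw [mem_langOf_empty] at hr
        exact ⟨0, by rw [hl, hr]; rfl⟩
      | descent_succ =>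
        rw [mem_langOf_leaf₀] at hl
        obtain ⟨n, rfl⟩ := ihr hr
        exact ⟨n + 1, by rw [hl]; rfl⟩
  · rintro ⟨n, rfl⟩
    induction n with
    | zero =>
      rw [LTree.descent, LTree.pair, node_mem_spine _ _ _ _ _ fun _ => rfl]
      exact ⟨_, _, .descent_zero, by rw [mem_langOf_leaf₁], by rw [mem_langOf_empty]⟩
    | succ n ih =>
      rw [LTree.descent, LTree.pair, node_mem_spine _ _ _ _ _
        fun h => absurd h (LTree.node_ne_empty _ _ _)]
      exact ⟨_, _, .descent_succ, by rw [mem_langOf_leaf₀], ih⟩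

theorem mem_langOf_tagA {t : LTree α} :
    t ∈ (𝓐).langOf tagA ↔ t = LTree.pair a₁ a₀ .empty := by
  constructor
  · induction t using LTree.induction_node with
    | he => simp [empty_mem_spine]
    | hn a l r hlr =>
      rw [node_mem_spine _ _ _ _ _ hlr]
      rintro ⟨p, p', h, hl, hr⟩
      cases h
      rw [mem_langOf_leaf₀] at hl
      rw [mem_langOf_empty] at hr
      rw [hl, hr]
      rfl
  · rintro rfl
    rw [LTree.pair, node_mem_spine _ _ _ _ _ fun _ => rfl]
    exact ⟨_, _, .tagA, by rw [mem_langOf_leaf₀], by rw [mem_langOf_empty]⟩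

theorem mem_langOf_tagB {t : LTree α} :
    t ∈ (𝓐).langOf tagB ↔ t = LTree.pair a₁ a₁ .empty := by
  constructor
  · induction t using LTree.induction_node with
    | he => simp [empty_mem_spine]
    | hn a l r hlr =>
      rw [node_mem_spine _ _ _ _ _ hlr]
      rintro ⟨p, p', h, hl, hr⟩
      cases h
      rw [mem_langOf_leaf₁] at hl
      rw [mem_langOf_empty] at hr
      rw [hl, hr]
      rfl
  · rintro rfl
    rw [LTree.pair, node_mem_spine _ _ _ _ _ fun _ => rfl]
    exact ⟨_, _, .tagB, by rw [mem_langOf_leaf₁], by rw [mem_langOf_empty]⟩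

theorem mem_langOf_plain {t : LTree α} :
    t ∈ (𝓐).langOf plain ↔ ∃ w, t = LTree.spine a₀ w (toLex 0) := by
  constructor
  · induction t using LTree.induction_node with
    | he => simp [empty_mem_spine]
    | hn a l r hlr ihl ihr =>
      rw [node_mem_spine _ _ _ _ _ hlr]
      rintro ⟨p, p', h, hl, hr⟩
      cases h with
      | plain_last =>
        rw [mem_langOf_empty] at hl hr
        exact ⟨[], by rw [hl, hr]; rfl⟩
      | plain_step =>
        obtain ⟨w, rfl⟩ := ihl hl
        rw [mem_langOf_empty] at hr
        exact ⟨a :: w, by rw [hr]; rfl⟩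
  · rintro ⟨w, rfl⟩
    induction w with
    | nil =>
      rw [LTree.spine, node_mem_spine _ _ _ _ _ fun _ => rfl]
      exact ⟨_, _, .plain_last, by rw [mem_langOf_empty], by rw [mem_langOf_empty]⟩
    | cons a w ih =>
      rw [LTree.spine, node_mem_spine _ _ _ _ _ fun h => absurd h (LTree.spine_ne_empty _ _ _)]
      exact ⟨_, _, .plain_step a, ih, by rw [mem_langOf_empty]; rfl⟩

theorem mem_langOf_run {t : LTree α} {q : Q} :
    t ∈ (𝓐).langOf (run q) ↔ ∃ w s c, T.Runs q w s ∧ Supported c s ∧ t = LTree.spine a₀ w c := by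
  constructor
  · induction t using LTree.induction_node generalizing q with
    | he => simp [empty_mem_spine]
    | hn a l r hlr ihl ihr =>
      rw [node_mem_spine _ _ _ _ _ hlr]
      rintro ⟨p, p', h, hl, hr⟩
      have cons : ∀ (v : ℕ) (d : Content), ∃ c : Content, c 0 = v ∧ c.tail = d := fun v d =>
        ⟨toLex fun i => Nat.casesOn i v fun i => d i, rfl, rfl⟩
      cases h with
      | run_last _ hf =>
        rw [mem_langOf_empty] at hl hr
        exact ⟨[], [], toLex 0, .nil q hf, supported_nil.2 rfl, by rw [hl, hr]; rfl⟩
      | run_step _ _ b q' hs =>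
        obtain ⟨w, s, d, hrun, hsup, rfl⟩ := ihl hl
        rw [mem_langOf_empty] at hr
        obtain ⟨c, h0, rfl⟩ := cons 0 d
        refine ⟨a :: w, b :: s, c, .cons hs hrun, supported_cons.2 ⟨by simp [h0], hsup⟩, ?_⟩
        rw [hr, LTree.spine, h0]
        rfl
      | run_flag _ _ q' hs =>
        obtain ⟨w, s, d, hrun, hsup, rfl⟩ := ihl hl
        obtain ⟨n, rfl⟩ := (mem_langOf_chain T a₀ a₁ IA IB).1 hr
        obtain ⟨c, h0, rfl⟩ := cons (n + 1) d
        refine ⟨a :: w, true :: s, c, .cons hs hrun, supported_cons.2 ⟨by simp, hsup⟩, ?_⟩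
        rw [LTree.spine, h0]
  · rintro ⟨w, s, c, hrun, hsup, rfl⟩
    induction hrun generalizing c with
    | nil q hf =>
      rw [LTree.spine, node_mem_spine _ _ _ _ _ fun _ => rfl]
      exact ⟨_, _, .run_last q hf, by rw [mem_langOf_empty], by rw [mem_langOf_empty]⟩
    | @cons q q' a b w s hs hrun ih =>
      rw [supported_cons] at hsup
      rw [LTree.spine, node_mem_spine _ _ _ _ _ fun h => absurd h (LTree.spine_ne_empty _ _ _)]
      -- An entry `0` means an empty side tree, which is allowed whether or not the position is
      -- flagged; a positive entry forces the flag and hence the transition to `chain`.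
      rcases h0 : c 0 with _ | n
      · exact ⟨_, _, .run_step q a b q' hs, ih _ hsup.2, by rw [mem_langOf_empty]; rfl⟩
      · rw [hsup.1 (by simp [h0])] at hs
        exact ⟨_, _, .run_flag q a q' hs, ih _ hsup.2, (mem_langOf_chain _ _ _ _ _).2 ⟨n, rfl⟩⟩

/-- The root transition fixes the tag and, with it, whether the main branch is read freely with
empty side trees, by the transducer from `IA`, or from `IB`. The states used below are characterized
one by one in the preceding lemmas. -/
theorem language_spineAutomaton :
    (𝓐).language = LTree.codedSet a₀ a₁ (T.contents IA) (T.contents IB) := by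
  rw [(𝓐).language_eq_langOf (q := root) rfl]
  ext t
  constructor
  · induction t using LTree.induction_node with
    | he => simp [empty_mem_spine]
    | hn a l r hlr ihl ihr =>
      rw [node_mem_spine _ _ _ _ _ hlr]
      rintro ⟨p, p', h, hl, hr⟩
      cases h with
      | root_plain =>
        obtain ⟨w, rfl⟩ := (mem_langOf_plain T a₀ a₁ IA IB).1 hl
        obtain ⟨n, rfl⟩ := (mem_langOf_descent T a₀ a₁ IA IB).1 hr
        exact ⟨w, .inl ⟨n, rfl⟩⟩
      | root_A q hq =>
        obtain ⟨w, s, c, hrun, hsup, rfl⟩ := (mem_langOf_run T a₀ a₁ IA IB).1 hl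
        rw [(mem_langOf_tagA T a₀ a₁ IA IB).1 hr]
        exact ⟨w, .inr (.inl ⟨c, ⟨q, hq, s, hrun, hsup⟩, rfl⟩)⟩
      | root_B q hq =>
        obtain ⟨w, s, c, hrun, hsup, rfl⟩ := (mem_langOf_run T a₀ a₁ IA IB).1 hl
        rw [(mem_langOf_tagB T a₀ a₁ IA IB).1 hr]
        exact ⟨w, .inr (.inr ⟨c, ⟨q, hq, s, hrun, hsup⟩, rfl⟩)⟩
  · rintro ⟨w, ⟨n, rfl⟩ | ⟨c, ⟨q, hq, s, hrun, hsup⟩, rfl⟩ | ⟨c, ⟨q, hq, s, hrun, hsup⟩, rfl⟩⟩ <;>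
      rw [LTree.coded, node_mem_spine _ _ _ _ _ fun h => absurd h (LTree.spine_ne_empty _ _ _)]
    · exact ⟨_, _, .root_plain, (mem_langOf_plain _ _ _ _ _).2 ⟨w, rfl⟩,
        (mem_langOf_descent _ _ _ _ _).2 ⟨n, rfl⟩⟩
    · exact ⟨_, _, .root_A q hq, (mem_langOf_run _ _ _ _ _).2 ⟨w, s, c, hrun, hsup, rfl⟩,
        (mem_langOf_tagA _ _ _ _ _).2 rfl⟩
    · exact ⟨_, _, .root_B q hq, (mem_langOf_run _ _ _ _ _).2 ⟨w, s, c, hrun, hsup, rfl⟩,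
        (mem_langOf_tagB _ _ _ _ _).2 rfl⟩

end

end FlagTransducer

/-! ### Affine machines -/

/-- A machine with two registers, whose instructions are affine equations between the old and
the new value of each register. -/
structure AffineMachine (S Ρ : Type) where
  mul : Ρ → Bool → ℕ
  add : Ρ → Bool → ℕ
  mul' : Ρ → Bool → ℕ
  add' : Ρ → Bool → ℕ
  edge : S → Ρ → S → Prop
  start : S
  accept : S → Prop

namespace AffineMachine

variable {S Ρ : Type} (M : AffineMachine S Ρ)

/-- The instruction `ρ` relates the register values `v` and `v'`. -/
def Rel (ρ : Ρ) (v v' : Bool → ℕ) : Prop :=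
  ∀ r, M.mul ρ r * v r + M.add ρ r = M.mul' ρ r * v' r + M.add' ρ r

/-- One step of the machine. -/
def Step (c c' : S × (Bool → ℕ)) : Prop := ∃ ρ, M.edge c.1 ρ c'.1 ∧ M.Rel ρ c.2 c'.2

/-- The machine accepts the initial register values `v`. -/
def Accepts (v : Bool → ℕ) : Prop :=
  ∃ c, Relation.ReflTransGen M.Step (M.start, v) c ∧ M.accept c.1

/-- The restriction of a machine to a set of control states. -/
def restrict (p : S → Prop) (h : p M.start) : AffineMachine {s // p s} Ρ where
  mul := M.mul
  add := M.add
  mul' := M.mul'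
  add' := M.add'
  edge s ρ s' := M.edge s ρ s'
  start := ⟨M.start, h⟩
  accept s := M.accept s

/-- This cuts an infinite type of control states down to a finite closed part, as needed for a
finite automaton. -/
theorem restrict_accepts {p : S → Prop} (h : p M.start)
    (hp : ∀ s ρ s', M.edge s ρ s' → p s → p s') (v : Bool → ℕ) :
    (M.restrict p h).Accepts v ↔ M.Accepts v := by
  constructor
  · rintro ⟨c, hc, ha⟩
    refine ⟨(c.1, c.2), ?_, ha⟩
    exact hc.lift (fun c : {s // p s} × (Bool → ℕ) => ((c.1 : S), c.2))
      fun _ _ ⟨ρ, he, hr⟩ => ⟨ρ, he, hr⟩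
  · rintro ⟨c, hc, ha⟩
    have key : ∃ hs : p c.1, Relation.ReflTransGen (M.restrict p h).Step
        ((M.restrict p h).start, v) (⟨c.1, hs⟩, c.2) := by
      clear ha
      induction hc with
      | refl => exact ⟨h, .refl⟩
      | tail _ hbc ih =>
        obtain ⟨hs, ih⟩ := ih
        obtain ⟨ρ, he, hr⟩ := hbc
        exact ⟨hp _ _ _ he hs, ih.tail ⟨ρ, he, hr⟩⟩
    exact ⟨_, key.choose_spec, ha⟩

end AffineMachine

/-! ### Simulation of Turing machines by affine machines -/

namespace Turing

variable {Γ : Type} [Inhabited Γ] (code : Γ → ℕ) (b : ℕ)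

/-- The number with the digits `code a` in the base `b`, the least significant first. -/
def listValue (l : List Γ) : ℕ := l.foldr (fun a n => code a + b * n) 0

/-- The number that represents one half of a tape. -/
def ListBlank.value (h0 : code default = 0) (l : ListBlank Γ) : ℕ :=
  l.liftOn (listValue code b) <| by
    rintro l _ ⟨n, rfl⟩
    have : listValue code b (List.replicate n (default : Γ)) = 0 := by
      induction n with
      | zero => rfl
      | succ n ih =>
        rw [listValue] at ih
        rw [List.replicate_succ, listValue, List.foldr_cons, ih, h0, mul_zero, add_zero]
    rw [listValue] at this
    rw [listValue, listValue, List.foldr_append, this]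

variable {code b} (h0 : code default = 0)

theorem ListBlank.value_cons (a : Γ) (l : ListBlank Γ) :
    (l.cons a).value code b h0 = code a + b * l.value code b h0 := by
  induction l using Quotient.inductionOn' with
  | h l => rfl

theorem ListBlank.value_eq (l : ListBlank Γ) :
    l.value code b h0 = code l.head + b * l.tail.value code b h0 := by
  rw [← ListBlank.value_cons, ListBlank.cons_head_tail]

/-- The rules of the affine machine that simulates a Turing machine. -/
inductive TapeRule (Γ : Type)
  | stay
  | left (a a' : Γ)
  | right (a a' : Γ)

instance [Finite Γ] : Finite (TapeRule Γ) := by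
  have : Function.Surjective fun x : Option (Bool × Γ × Γ) => match x with
      | none => TapeRule.stay
      | some (false, a, a') => .left a a'
      | some (true, a, a') => .right a a' := by
    rintro (_ | ⟨a, a'⟩ | ⟨a, a'⟩)
    · exact ⟨none, rfl⟩
    · exact ⟨some (false, a, a'), rfl⟩
    · exact ⟨some (true, a, a'), rfl⟩
  exact Finite.of_surjective _ this

/-- The edges of the affine machine that simulates a Turing machine. -/
inductive TapeEdge {Λ : Type} [Inhabited Λ] (M : TM0.Machine Γ Λ) :
    Λ × Γ → TapeRule Γ → Λ × Γ → Prop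
  | write {q q' : Λ} {a a' : Γ} :
      M q a = some (q', .write a') → TapeEdge M (q, a) .stay (q', a')
  | left {q q' : Λ} {a a' : Γ} :
      M q a = some (q', .move .left) → TapeEdge M (q, a) (.left a a') (q', a')
  | right {q q' : Λ} {a a' : Γ} :
      M q a = some (q', .move .right) → TapeEdge M (q, a) (.right a a') (q', a')

variable {Λ : Type} [Inhabited Λ]

/-- The affine machine that simulates a Turing machine.  The registers `false` and `true`
represent the parts of the tape to the left and to the right of the head. -/
def affineMachine (code : Γ → ℕ) (b : ℕ) (M : TM0.Machine Γ Λ) (s : Λ × Γ) :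
    AffineMachine (Λ × Γ) (TapeRule Γ) where
  mul
    | .left _ _, true => b
    | .right _ _, false => b
    | _, _ => 1
  add
    | .left a _, true => code a
    | .right a _, false => code a
    | _, _ => 0
  mul'
    | .left _ _, false => b
    | .right _ _, true => b
    | _, _ => 1
  add'
    | .left _ a', false => code a'
    | .right _ a', true => code a'
    | _, _ => 0
  edge := TapeEdge M
  start := s
  accept s := M s.1 s.2 = none

/-- The configuration of the affine machine that represents a configuration of the Turing
machine. -/
def affineCfg (b : ℕ) (h0 : code default = 0) (c : TM0.Cfg Γ Λ) : (Λ × Γ) × (Bool → ℕ) :=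
  ((c.q, c.Tape.head), fun r =>
    match r with
    | false => c.Tape.left.value code b h0
    | true => c.Tape.right.value code b h0)

/-- A move multiplies one half of the tape by `b` and adds the old head symbol as a digit, and it
removes the lowest digit of the other half. The rule guesses that digit as the new head symbol;
uniqueness of division with remainder by `b` excludes wrong guesses, so the nondeterministic machine
follows the deterministic one. -/
theorem affineMachine_step (hinj : Function.Injective code) (hb : ∀ a, code a < b)
    (M : TM0.Machine Γ Λ) (s : Λ × Γ) (c : TM0.Cfg Γ Λ) (d : (Λ × Γ) × (Bool → ℕ)) :
    (affineMachine code b M s).Step (affineCfg b h0 c) d ↔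
      ∃ c', TM0.step M c = some c' ∧ affineCfg b h0 c' = d := by
  have digits : ∀ {a a' : Γ} {m n : ℕ}, code a + b * m = b * n + code a' → a = a' ∧ m = n := by
    intro a a' m n h
    have hpos : 0 < b := (Nat.zero_le _).trans_lt (hb a)
    have h1 := congrArg (· % b) h
    have h2 := congrArg (· / b) h
    simp only [Nat.add_mul_mod_self_left, Nat.mul_add_mod, Nat.mod_eq_of_lt (hb _)] at h1
    simp only [Nat.add_mul_div_left _ _ hpos, Nat.mul_add_div hpos, Nat.div_eq_of_lt (hb _)] at h2
    exact ⟨hinj h1, by omega⟩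
  obtain ⟨q, T⟩ := c
  obtain ⟨⟨q', a'⟩, v⟩ := d
  constructor
  · rintro ⟨ρ, he, hr⟩
    have hf := hr false
    have ht := hr true
    simp only [affineCfg] at he
    simp only [affineCfg] at hf ht
    generalize hTa : T.head = a at he
    cases he with
    | write h =>
      refine ⟨⟨q', T.write a'⟩, by simp [TM0.step, hTa, h], ?_⟩
      simp only [affineMachine, one_mul, add_zero] at hf ht
      simp only [affineCfg, Tape.write, Prod.mk.injEq, true_and]
      funext r
      cases r <;> simp [hf, ht]
    | left h =>
      refine ⟨⟨q', T.move .left⟩, by simp [TM0.step, hTa, h], ?_⟩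
      simp only [affineMachine, one_mul, add_zero] at hf ht
      rw [ListBlank.value_eq] at hf
      obtain ⟨h1, h2⟩ := digits hf
      simp only [affineCfg, Tape.move, h1, Prod.mk.injEq, true_and]
      funext r
      cases r
      · exact h2
      · simp only [ListBlank.value_cons, hTa]
        omega
    | right h =>
      refine ⟨⟨q', T.move .right⟩, by simp [TM0.step, hTa, h], ?_⟩
      simp only [affineMachine, one_mul, add_zero] at hf ht
      rw [ListBlank.value_eq] at ht
      obtain ⟨h1, h2⟩ := digits ht
      simp only [affineCfg, Tape.move, h1, Prod.mk.injEq, true_and]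
      funext r
      cases r
      · simp only [ListBlank.value_cons, hTa]
        omega
      · exact h2
  · rintro ⟨c', h, hd⟩
    rw [← hd]
    rcases hM : M q T.head with _ | ⟨q₂, (_ | _) | a₂⟩
    · simp [TM0.step, hM] at h
    · obtain rfl : (⟨q₂, T.move .left⟩ : TM0.Cfg Γ Λ) = c' := by simpa [TM0.step, hM] using h
      refine ⟨.left T.head T.left.head, .left hM, fun r => ?_⟩
      cases r
      · simp only [affineMachine, affineCfg, Tape.move, one_mul, add_zero]
        rw [ListBlank.value_eq, add_comm]
      · simp only [affineMachine, affineCfg, Tape.move, one_mul, add_zero, ListBlank.value_cons]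
        rw [add_comm]
    · obtain rfl : (⟨q₂, T.move .right⟩ : TM0.Cfg Γ Λ) = c' := by simpa [TM0.step, hM] using h
      refine ⟨.right T.head T.right.head, .right hM, fun r => ?_⟩
      cases r
      · simp only [affineMachine, affineCfg, Tape.move, one_mul, add_zero, ListBlank.value_cons]
        rw [add_comm]
      · simp only [affineMachine, affineCfg, Tape.move, one_mul, add_zero]
        rw [ListBlank.value_eq, add_comm]
    · obtain rfl : (⟨q₂, T.write a₂⟩ : TM0.Cfg Γ Λ) = c' := by simpa [TM0.step, hM] using h
      refine ⟨.stay, .write hM, fun r => ?_⟩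
      cases r <;> simp [affineMachine, affineCfg, Tape.write]

theorem affineMachine_accepts (hinj : Function.Injective code) (hb : ∀ a, code a < b)
    (M : TM0.Machine Γ Λ) (c : TM0.Cfg Γ Λ) :
    (affineMachine code b M (c.q, c.Tape.head)).Accepts (affineCfg b h0 c).2 ↔
      (StateTransition.eval (TM0.step M) c).Dom := by
  have hstep := affineMachine_step h0 hinj hb M (c.q, c.Tape.head)
  have hacc : ∀ c' : TM0.Cfg Γ Λ,
      M (affineCfg b h0 c').1.1 (affineCfg b h0 c').1.2 = none ↔ TM0.step M c' = none := by
    intro c'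
    simp [TM0.step, affineCfg]
  rw [Part.dom_iff_mem]
  constructor
  · rintro ⟨d, hd, ha⟩
    have key : ∃ c', StateTransition.Reaches (TM0.step M) c c' ∧ affineCfg b h0 c' = d := by
      clear ha
      induction hd with
      | refl => exact ⟨c, .refl, rfl⟩
      | tail _ hbc ih =>
        obtain ⟨c', hc', rfl⟩ := ih
        obtain ⟨c'', hs, rfl⟩ := (hstep c' _).1 hbc
        exact ⟨c'', hc'.tail hs, rfl⟩
    obtain ⟨c', hc', rfl⟩ := key
    exact ⟨c', StateTransition.mem_eval.2 ⟨hc', (hacc c').1 ha⟩⟩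
  · rintro ⟨c', hc'⟩
    obtain ⟨h1, h2⟩ := StateTransition.mem_eval.1 hc'
    refine ⟨affineCfg b h0 c', ?_, (hacc c').2 h2⟩
    unfold StateTransition.Reaches at h1
    exact h1.lift (affineCfg b h0) fun x y h => (hstep x _).2 ⟨y, h, rfl⟩

end Turing

/-! ### Domains of partial recursive functions -/

theorem primrec_natBits : Primrec Nat.bits := by
  -- Course-of-values recursion: `l` lists the earlier values, so its length is the current argument
  -- and its entry at half the length is the value to be extended by one bit.
  have hg : Primrec₂ fun (_ : Unit) (l : List (List Bool)) =>
      if l.length = 0 then some [] else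
        (l[l.length / 2]?).map fun r => decide (l.length % 2 = 1) :: r := by
    have hlen : Primrec fun p : Unit × List (List Bool) => p.2.length :=
      Primrec.list_length.comp Primrec.snd
    refine Primrec.ite (Primrec.eq.comp hlen (Primrec.const 0)) (Primrec.const _) ?_
    refine Primrec.option_map (Primrec.list_getElem?.comp Primrec.snd
      (Primrec.nat_div.comp hlen (Primrec.const 2))) ?_
    refine Primrec.list_cons.comp ?_ Primrec.snd
    exact (Primrec.eq.comp (Primrec.nat_mod.comp hlen (Primrec.const 2))
      (Primrec.const 1)).decide.comp Primrec.fst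
  have := Primrec.nat_strong_rec (fun (_ : Unit) n => Nat.bits n) hg fun _ n => by
    rcases Nat.eq_zero_or_pos n with rfl | hn
    · simp
    · have h2 : n / 2 < n := by omega
      simp only [List.length_map, List.length_range, hn.ne', if_false, List.getElem?_map,
        List.getElem?_range h2, Option.map_some]
      conv_rhs => rw [← Nat.bit_bodd_div2 n]
      rw [Nat.bits_append_bit]
      · rw [Nat.div2_val, Nat.mod_two_of_bodd]
        cases n.bodd <;> rfl
      · intro h
        by_contra hb
        have := Nat.bit_bodd_div2 n
        rw [h] at this
        simp at hb
        rw [hb] at this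
        simp at this
        omega
  exact this.comp (Primrec.const ()) Primrec.id

namespace Turing

open PartrecToTM2

theorem trNat_eq_map_bits (n : ℕ) :
    trNat n = n.bits.map fun b => if b then Γ'.bit1 else Γ'.bit0 := by
  have pos : ∀ m : PosNum, trPosNum m =
      (m : ℕ).bits.map fun b => if b then Γ'.bit1 else Γ'.bit0 := by
    intro m
    induction m with
    | one => simp [trPosNum]
    | bit0 m ih =>
      have h : ((m.bit0 : PosNum) : ℕ) = 2 * (m : ℕ) := by
        rw [PosNum.cast_bit0]; omega
      have h0 : (m : ℕ) ≠ 0 := (PosNum.cast_pos m).ne'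
      rw [h, Nat.bit0_bits _ h0, trPosNum, ih]
      rfl
    | bit1 m ih =>
      have h : ((m.bit1 : PosNum) : ℕ) = 2 * (m : ℕ) + 1 := by
        rw [PosNum.cast_bit1]; omega
      rw [h, Nat.bit1_bits, trPosNum, ih]
      rfl
  rw [trNat]
  have hn : (((n : Num) : ℕ)) = n := Num.to_of_nat n
  rcases h : (n : Num) with _ | m
  · rw [h] at hn
    rw [← hn]
    rfl
  · rw [h] at hn
    rw [← hn]
    exact pos m

/-- Every partial recursive function has the same domain as some Turing machine. -/
theorem exists_code_dom {f : ℕ →. ℕ} (hf : Partrec f) :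
    ∃ c : ToPartrec.Code, ∀ x, (f x).Dom ↔ (c.eval [x]).Dom := by
  obtain ⟨c, hc⟩ := ToPartrec.Code.exists_code (Nat.Partrec'.part_iff₁.2 hf)
  refine ⟨c, fun x => ?_⟩
  have := hc ⟨[x], rfl⟩
  rw [this]
  rfl

theorem exists_digits (Γ : Type) [Finite Γ] [Inhabited Γ] :
    ∃ (code : Γ → ℕ) (b : ℕ), code default = 0 ∧ Function.Injective code ∧ ∀ a, code a < b := by
  classical
  obtain ⟨n, ⟨e⟩⟩ := Finite.exists_equiv_fin Γ
  refine ⟨fun a => if a = default then 0 else e a + 1, n + 1, by simp, fun a a' h => ?_, fun a => ?_⟩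
  · by_cases h1 : a = default <;> by_cases h2 : a' = default
    · rw [h1, h2]
    · simp [h1, h2] at h
    · simp [h1, h2] at h
    · simp only [h1, h2, if_false, Nat.add_right_cancel_iff] at h
      exact e.injective (Fin.ext h)
  · dsimp only
    split_ifs <;> omega

instance : Finite K' := by
  have : Function.Surjective fun p : Bool × Bool => match p with
      | (false, false) => K'.main
      | (false, true) => K'.rev
      | (true, false) => K'.aux
      | (true, true) => K'.stack := by
    rintro (_ | _ | _ | _)
    · exact ⟨(false, false), rfl⟩
    · exact ⟨(false, true), rfl⟩
    · exact ⟨(true, false), rfl⟩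
    · exact ⟨(true, true), rfl⟩
  exact Finite.of_surjective _ this

/-- The domain of a partial recursive function is accepted by an affine machine. -/
theorem exists_affineMachine {f : ℕ →. ℕ} (hf : Partrec f) :
    ∃ (S Ρ : Type) (_ : Finite S) (_ : Finite Ρ) (_ : Nonempty Ρ) (M : AffineMachine S Ρ)
      (g : ℕ → ℕ), Computable g ∧ ∀ x, M.Accepts (fun r => bif r then g x else 0) ↔ (f x).Dom := by
  obtain ⟨c, hc⟩ := exists_code_dom hf
  let _ : Inhabited Λ' := ⟨trNormal c .halt⟩
  let M₁ := TM2to1.tr PartrecToTM2.tr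
  let M₀ := TM1to0.tr M₁
  have : Finite (TM2to1.Γ' K' fun _ => Γ') := inferInstanceAs (Finite (Bool × (K' → Option Γ')))
  obtain ⟨code, b, h0, hinj, hb⟩ := exists_digits (TM2to1.Γ' K' fun _ => Γ')
  let sym (bottom : Bool) (a : Γ') : TM2to1.Γ' K' fun _ => Γ' :=
    (bottom, Function.update (fun _ => none) .main (some a))
  let input (x : ℕ) : List (TM2to1.Γ' K' fun _ => Γ') := TM2to1.trInit .main (trList [x])
  let cfg (x : ℕ) : TM0.Cfg (TM2to1.Γ' K' fun _ => Γ') _ := TM0.init (Λ := TM1to0.Λ' M₁) (input x)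
  have hdom : ∀ x, (StateTransition.eval (TM0.step M₀) (cfg x)).Dom ↔ (f x).Dom := by
    intro x
    have h1 : (TM0.eval M₀ (input x)).Dom ↔ (TM2.eval PartrecToTM2.tr .main (trList [x])).Dom := by
      rw [TM1to0.tr_eval]
      exact TM2to1.tr_eval_dom _ _ _
    have h2 : (TM2.eval PartrecToTM2.tr .main (trList [x])).Dom ↔ (c.eval [x]).Dom := by
      have h3 : TM2.init (Γ := fun _ => Γ') K'.main (trList [x]) = PartrecToTM2.init c [x] := by
        rw [TM2.init, PartrecToTM2.init]
        congr 1
        funext k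
        cases k <;> rfl
      have h4 := PartrecToTM2.tr_eval c [x]
      rw [← h3] at h4
      change (StateTransition.eval _ (TM2.init (Γ := fun _ => Γ') K'.main (trList [x]))).Dom ↔ _
      rw [h4]
      rfl
    rw [hc, ← h2, ← h1]
    rfl
  -- The head starts on the marked bottom symbol with nothing to its left. So the left register is
  -- `0`, the initial control state does not depend on `x`, and only the right register carries the
  -- input.
  have hinput : ∀ x, input x = sym true .cons ::
      (trNat x).reverse.map (sym false) := by
    intro x
    have : (trList [x]).reverse = .cons :: (trNat x).reverse := by simp [trList]
    simp only [input, TM2to1.trInit, this]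
    rfl
  let s₀ : TM1to0.Λ' M₁ × TM2to1.Γ' K' fun _ => Γ' := (default, sym true .cons)
  let g (x : ℕ) : ℕ := listValue code b ((trNat x).reverse.map (sym false))
  let A := affineMachine code b M₀ s₀
  let supp : Set (TM1to0.Λ' M₁) := TM1to0.trStmts M₁ (TM2to1.trSupp PartrecToTM2.tr (codeSupp c .halt))
  have hsupp : TM0.Supports M₀ supp :=
    TM1to0.tr_supports _ (TM2to1.tr_supports _ (PartrecToTM2.tr_supports c .halt))
  have hfin : Finite {s : TM1to0.Λ' M₁ × TM2to1.Γ' K' fun _ => Γ' // s.1 ∈ supp} :=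
    have := (Finset.finite_toSet (TM1to0.trStmts M₁ (TM2to1.trSupp PartrecToTM2.tr (codeSupp c .halt)))).to_subtype
    Finite.of_injective (β := supp × TM2to1.Γ' K' fun _ => Γ')
      (fun s => (⟨s.1.1, s.2⟩, s.1.2)) fun s t h => by
        simp only [Prod.mk.injEq, Subtype.mk.injEq] at h
        exact Subtype.ext (Prod.ext h.1 h.2)
  refine ⟨_, _, hfin, inferInstance, ⟨.stay⟩, A.restrict (fun s => s.1 ∈ supp) hsupp.1, g, ?_, fun x => ?_⟩
  -- The input value is a fold over the binary digits, hence primitive recursive.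
  · have hg : g = fun x => x.bits.reverse.foldr
        (fun (a : Bool) n => code (sym false (if a then .bit1 else .bit0)) + b * n) 0 := by
      funext x
      change List.foldr _ 0 (List.map _ _) = _
      rw [List.foldr_map, trNat_eq_map_bits, ← List.map_reverse, List.foldr_map]
    rw [hg]
    refine Primrec.to_comp ?_
    refine Primrec.list_foldr (h := fun _ p =>
      code (sym false (if p.1 then .bit1 else .bit0)) + b * p.2)
      (Primrec.list_reverse.comp primrec_natBits) (Primrec.const 0) ?_
    refine Primrec.nat_add.comp ?_ (Primrec.nat_mul.comp (Primrec.const b)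
      (Primrec.snd.comp Primrec.snd))
    exact (Primrec.dom_finite fun a : Bool =>
      code (sym false (if a then .bit1 else .bit0))).comp (Primrec.fst.comp Primrec.snd)
  · have hclosed : ∀ s ρ s', A.edge s ρ s' → s.1 ∈ supp → s'.1 ∈ supp := by
      intro s ρ s' he hs
      cases he with
      | write h => exact hsupp.2 h hs
      | left h => exact hsupp.2 h hs
      | right h => exact hsupp.2 h hs
    refine (A.restrict_accepts _ hclosed _).trans ?_
    rw [← hdom, ← affineMachine_accepts h0 hinj hb]
    have hcfg : cfg x = ⟨default, Tape.mk₁ (sym true .cons :: (trNat x).reverse.map (sym false))⟩ :=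
      congrArg TM0.init (hinput x)
    have hv : (affineCfg b h0 (cfg x)).2 = fun r => bif r then g x else 0 := by
      rw [hcfg]
      funext r
      cases r <;> rfl
    rw [hcfg] at hv ⊢
    exact iff_of_eq (congrArg A.Accepts hv.symm)

end Turing

/-! ### Weights realized as numbers of flags in blocks -/

/-- A nondeterministic finite automaton that gives a weight to every letter. -/
structure WeightAutomaton (τ P : Type) where
  step : P → τ → ℕ → P → Prop
  final : P → Prop

namespace WeightAutomaton

variable {τ P : Type} (W : WeightAutomaton τ P)

/-- `W.Runs p us m` means that `W` has a run on `us` with the total weight `m`. -/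
inductive Runs : P → List τ → ℕ → Prop
  | nil (p : P) : W.final p → Runs p [] 0
  | cons {p p' : P} {u : τ} {m n : ℕ} {us : List τ} :
      W.step p u m p' → Runs p' us n → Runs p (u :: us) (m + n)

variable {W}

theorem runs_nil {p : P} {n : ℕ} : W.Runs p [] n ↔ n = 0 ∧ W.final p := by
  constructor
  · rintro ⟨⟩
    exact ⟨rfl, ‹_›⟩
  · rintro ⟨rfl, h⟩
    exact .nil p h

theorem runs_cons {p : P} {u : τ} {us : List τ} {n : ℕ} :
    W.Runs p (u :: us) n ↔ ∃ m n' p', W.step p u m p' ∧ W.Runs p' us n' ∧ n = m + n' := by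
  constructor
  · rintro ⟨⟩
    exact ⟨_, _, _, ‹_›, ‹_›, rfl⟩
  · rintro ⟨m, n', p', h1, h2, rfl⟩
    exact .cons h1 h2

/-- The behaviour on a word that keeps the automaton in one state. -/
theorem runs_append_of_loop {β : Type} {p : P} {f : β → τ} {wt : β → ℕ}
    (h : ∀ b m p', W.step p (f b) m p' ↔ m = wt b ∧ p' = p) (l : List β) (us : List τ) (n : ℕ) :
    W.Runs p (l.map f ++ us) n ↔ ∃ n', W.Runs p us n' ∧ n = (l.map wt).sum + n' := by
  induction l generalizing n with
  | nil => simp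
  | cons b l ih =>
    rw [List.map_cons, List.cons_append, runs_cons]
    constructor
    · rintro ⟨m, n', p', hs, hr, rfl⟩
      obtain ⟨rfl, rfl⟩ := (h _ _ _).1 hs
      obtain ⟨n'', hr', rfl⟩ := (ih _).1 hr
      exact ⟨n'', hr', by simp; omega⟩
    · rintro ⟨n', hr, rfl⟩
      exact ⟨_, _, _, (h _ _ _).2 ⟨rfl, rfl⟩, (ih _).2 ⟨n', hr, rfl⟩, by simp; omega⟩

variable {ℓ : ℕ} [NeZero ℓ]

/-- The states of the transducer that reads every letter of a weight automaton as a block of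
`ℓ` letters: in the middle of a block, the target state, the letter of the automaton, the
position in the block and the weight are stored. -/
abbrev BlockState (τ P : Type) (ℓ : ℕ) : Type := P × Option (τ × Fin ℓ × Fin (ℓ + 1))

/-- The state after position `j` of a block. -/
def blockNext (p : P) (u : τ) (j : Fin ℓ) (m : Fin (ℓ + 1)) : BlockState τ P ℓ :=
  if h : (j : ℕ) + 1 < ℓ then (p, some (u, ⟨j + 1, h⟩, m)) else (p, none)

variable (W) in
/-- The steps of the transducer that reads every letter as a block. -/
inductive BlockStep : BlockState τ P ℓ → τ × Fin ℓ → Bool → BlockState τ P ℓ → Prop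
  | start {p p' : P} {u : τ} {m : Fin (ℓ + 1)} : W.step p u m p' →
      BlockStep (p, none) (u, 0) (decide (0 < (m : ℕ))) (blockNext p' u 0 m)
  | middle (p : P) (u : τ) (j : Fin ℓ) (m : Fin (ℓ + 1)) :
      BlockStep (p, some (u, j, m)) (u, j) (decide ((j : ℕ) < m)) (blockNext p u j m)

variable (W ℓ) in
/-- The transducer that reads every letter of `W` as a block of `ℓ` letters, as many of which
as the weight says are flagged. -/
def toFlagTransducer : FlagTransducer (τ × Fin ℓ) (BlockState τ P ℓ) where
  step := W.BlockStep
  final q := q.2 = none ∧ W.final q.1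

/-- The end of a block from position `j` on. -/
def blockFrom (ℓ : ℕ) (u : τ) (j : ℕ) : List (τ × Fin ℓ) := ((List.finRange ℓ).drop j).map (u, ·)

variable (ℓ) in
/-- The word that has a block for every letter. -/
def blocks (us : List τ) : List (τ × Fin ℓ) := us.flatMap fun u => blockFrom ℓ u 0

theorem blockFrom_of_lt (u : τ) {j : ℕ} (h : j < ℓ) :
    blockFrom ℓ u j = (u, ⟨j, h⟩) :: blockFrom ℓ u (j + 1) := by
  rw [blockFrom, List.drop_eq_getElem_cons (by simpa using h)]
  simp [blockFrom]

theorem blockFrom_of_ge (u : τ) {j : ℕ} (h : ℓ ≤ j) : blockFrom ℓ u j = [] := by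
  rw [blockFrom, List.drop_eq_nil_of_le (by simpa using h), List.map_nil]

theorem blocks_cons (u : τ) (us : List τ) :
    blocks ℓ (u :: us) = blockFrom ℓ u 0 ++ blocks ℓ us := rfl

theorem length_blocks (us : List τ) : (blocks ℓ us).length = ℓ * us.length := by
  induction us with
  | nil => rfl
  | cons u us ih =>
    rw [blocks_cons, List.length_append, ih]
    simp [blockFrom]
    ring

theorem blocks_injective : Function.Injective (blocks ℓ : List τ → List (τ × Fin ℓ)) := by
  intro us
  induction us with
  | nil =>
    rintro (_ | ⟨v, vs⟩) h
    · rfl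
    · have := congrArg List.length h
      simp [length_blocks, NeZero.ne ℓ] at this
  | cons u us ih =>
    rintro (_ | ⟨v, vs⟩) h
    · have := congrArg List.length h
      simp [length_blocks, NeZero.ne ℓ] at this
    · rw [blocks_cons, blocks_cons] at h
      obtain ⟨h1, h2⟩ := List.append_inj h (by simp [blockFrom])
      rw [blockFrom_of_lt u (NeZero.pos ℓ), blockFrom_of_lt v (NeZero.pos ℓ)] at h1
      simp only [List.cons.injEq, Prod.mk.injEq, and_true] at h1
      rw [h1.1, ih h2]

variable (W) in
/-- The word `w` can be read from the state `q` with `n` flags. -/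
def BlockRuns : BlockState τ P ℓ → List (τ × Fin ℓ) → ℕ → Prop
  | (p, none), w, n => ∃ us, w = blocks ℓ us ∧ W.Runs p us n
  | (p, some (u, j, m)), w, n => ∃ us n', w = blockFrom ℓ u j ++ blocks ℓ us ∧ W.Runs p us n' ∧
      n = m - j + n'

/-- In a block of weight `m` the flags are at the positions below `m`, so from position `j` on, `m -
j` of them remain (truncated subtraction). This is the invariant of the induction over the run. -/
theorem blockRuns_of_runs {q : BlockState τ P ℓ} {w : List (τ × Fin ℓ)} {s : List Bool}
    (h : (W.toFlagTransducer ℓ).Runs q w s) : W.BlockRuns q w (s.count true) := by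
  have step : ∀ {p : P} {u : τ} {j : Fin ℓ} {m : Fin (ℓ + 1)} {w : List (τ × Fin ℓ)}
      {s : List Bool}, W.BlockRuns (blockNext p u j m) w (s.count true) →
      ∃ us n, (u, j) :: w = blockFrom ℓ u j ++ blocks ℓ us ∧ W.Runs p us n ∧
        (decide ((j : ℕ) < m) :: s).count true = m - j + n := by
    intro p u j m w s h
    have hm : (m : ℕ) < ℓ + 1 := m.2
    have hj : (j : ℕ) < ℓ := j.2
    have hc : (decide ((j : ℕ) < m) :: s).count true = s.count true + if (j : ℕ) < m then 1 else 0 := by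
      rw [List.count_cons]
      simp
    rw [blockFrom_of_lt u j.2, hc]
    unfold blockNext at h
    split_ifs at h with hlt
    · obtain ⟨us, n, rfl, hr, hn⟩ := h
      refine ⟨us, n, rfl, hr, ?_⟩
      rw [hn]
      dsimp only
      split_ifs <;> omega
    · obtain ⟨us, rfl, hr⟩ := h
      refine ⟨us, _, ?_, hr, ?_⟩
      · rw [blockFrom_of_ge u (by omega)]
        rfl
      · split_ifs <;> omega
  induction h with
  | nil q hq =>
    obtain ⟨p, o⟩ := q
    obtain ⟨rfl, hf⟩ : o = none ∧ W.final p := hq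
    exact ⟨[], rfl, .nil p hf⟩
  | cons hs hr ih =>
    rcases hs with ⟨hs⟩ | ⟨p, u, j, m⟩
    · obtain ⟨us, n, h1, h2, h3⟩ := step ih
      refine ⟨_ :: us, h1, ?_⟩
      convert Runs.cons hs h2 using 1
      simpa using h3
    · exact step ih

theorem runs_of_runs_toFlagTransducer {p : P} {w : List (τ × Fin ℓ)} {s : List Bool}
    (h : (W.toFlagTransducer ℓ).Runs (p, none) w s) :
    ∃ us, w = blocks ℓ us ∧ W.Runs p us (s.count true) := blockRuns_of_runs h

theorem exists_runs_toFlagTransducer (hW : ∀ p u m p', W.step p u m p' → m ≤ ℓ) {p : P}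
    {us : List τ} {n : ℕ} (h : W.Runs p us n) :
    ∃ s, (W.toFlagTransducer ℓ).Runs (p, none) (blocks ℓ us) s ∧ s.count true = n := by
  induction h with
  | nil p hp => exact ⟨[], .nil _ ⟨rfl, hp⟩, rfl⟩
  | @cons p p' u m n us hs _ ih =>
    obtain ⟨s, hr, hc⟩ := ih
    have hm := hW _ _ _ _ hs
    let m' : Fin (ℓ + 1) := ⟨m, by omega⟩
    -- Induction on the number `i` of letters of the block that follow position `j`; the run through
    -- a block is thus built from its end.
    have key : ∀ i (j : Fin ℓ), (j : ℕ) + 1 + i = ℓ → ∃ s',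
        (W.toFlagTransducer ℓ).Runs (blockNext p' u j m')
          (blockFrom ℓ u (j + 1) ++ blocks ℓ us) s' ∧ s'.count true = m - (j + 1) + n := by
      intro i
      induction i with
      | zero =>
        intro j hj
        rw [blockFrom_of_ge u (by omega), blockNext, dif_neg (by omega)]
        exact ⟨s, hr, by omega⟩
      | succ i ih =>
        intro j hj
        have hlt : (j : ℕ) + 1 < ℓ := by omega
        obtain ⟨s', h1, h2⟩ := ih ⟨j + 1, hlt⟩ (by simp; omega)
        rw [blockFrom_of_lt u hlt, blockNext, dif_pos hlt]
        refine ⟨_, .cons (BlockStep.middle p' u ⟨j + 1, hlt⟩ m') h1, ?_⟩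
        rw [List.count_cons, h2]
        simp only [beq_true, decide_eq_true_eq, m']
        split_ifs <;> omega
    have hpos := NeZero.pos ℓ
    obtain ⟨s', h1, h2⟩ := key (ℓ - 1) 0 (by simp; omega)
    rw [blocks_cons, blockFrom_of_lt u hpos]
    refine ⟨_, .cons (BlockStep.start (m := m') hs) h1, ?_⟩
    rw [List.count_cons, h2]
    simp only [beq_true, decide_eq_true_eq, m', Fin.val_zero]
    split_ifs <;> omega

end WeightAutomaton

/-! ### Histories and the detection of wrong steps -/

/-- The states, apart from those that count the initial value of a register, of the automaton
that reads histories of an affine machine. -/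
inductive HistoryState (S Ρ : Type)
  | before | after | halted
  | first (ρ : Ρ) (r sg : Bool)
  | second (ρ : Ρ) (r sg : Bool)
  | control (s : S)

instance {S Ρ : Type} [Finite S] [Finite Ρ] : Finite (HistoryState S Ρ) := by
  have : Function.Surjective fun x : Option (Option (Option
      ((Bool × Ρ × Bool × Bool) ⊕ S))) => match x with
      | none => HistoryState.before
      | some none => .after
      | some (some none) => .halted
      | some (some (some (.inl (false, ρ, r, sg)))) => .first ρ r sg
      | some (some (some (.inl (true, ρ, r, sg)))) => .second ρ r sg
      | some (some (some (.inr s))) => .control s := by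
    rintro (_ | _ | _ | ⟨ρ, r, sg⟩ | ⟨ρ, r, sg⟩ | s)
    · exact ⟨none, rfl⟩
    · exact ⟨some none, rfl⟩
    · exact ⟨some (some none), rfl⟩
    · exact ⟨some (some (some (.inl (false, ρ, r, sg)))), rfl⟩
    · exact ⟨some (some (some (.inl (true, ρ, r, sg)))), rfl⟩
    · exact ⟨some (some (some (.inr s))), rfl⟩
  exact Finite.of_surjective _ this

namespace AffineMachine

open HistoryState WeightAutomaton

variable {S Ρ : Type} (M : AffineMachine S Ρ) (B : ℕ)

/-- The weight `B + x` or `B - x`. -/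
def shiftWeight (sg : Bool) (x : ℕ) : ℕ := bif sg then B + x else B - x

/-- The integer `x` or `-x`. -/
def signed (sg : Bool) (x : ℤ) : ℤ := bif sg then x else -x

variable {B} in
theorem cast_shiftWeight (sg : Bool) {x : ℕ} (h : x ≤ B) :
    (shiftWeight B sg x : ℤ) = B + signed sg x := by
  cases sg <;> simp [shiftWeight, signed]
  omega

/-- The steps of the automaton that reads histories.  A history consists of register units
`inr r` and of separators `inl ρ`, which end the configurations. -/
inductive HistoryStep :
    HistoryState S Ρ ⊕ ℕ → Ρ ⊕ Bool → ℕ → HistoryState S Ρ ⊕ ℕ → Prop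
  | before_unit (r : Bool) : HistoryStep (.inl before) (.inr r) B (.inl before)
  | before_sep (ρ : Ρ) : HistoryStep (.inl before) (.inl ρ) B (.inl before)
  | before_first (ρ ρ' : Ρ) (r sg : Bool) :
      HistoryStep (.inl before) (.inl ρ) B (.inl (first ρ' r sg))
  | first_unit (ρ : Ρ) (r sg r' : Bool) : HistoryStep (.inl (first ρ r sg)) (.inr r')
      (if r' = r then shiftWeight B sg (M.mul ρ r) else B) (.inl (first ρ r sg))
  | first_sep (ρ : Ρ) (r sg : Bool) : HistoryStep (.inl (first ρ r sg)) (.inl ρ)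
      (shiftWeight B sg (M.add ρ r)) (.inl (second ρ r sg))
  | second_unit (ρ : Ρ) (r sg r' : Bool) : HistoryStep (.inl (second ρ r sg)) (.inr r')
      (if r' = r then shiftWeight B (!sg) (M.mul' ρ r) else B) (.inl (second ρ r sg))
  | second_sep (ρ ρ' : Ρ) (r sg : Bool) : HistoryStep (.inl (second ρ r sg)) (.inl ρ')
      (shiftWeight B (!sg) (M.add' ρ r)) (.inl after)
  | after_all (u : Ρ ⊕ Bool) : HistoryStep (.inl after) u B (.inl after)
  | control_unit (s : S) (r : Bool) :
      HistoryStep (.inl (control s)) (.inr r) B (.inl (control s))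
  | control_sep (s s' : S) (ρ : Ρ) : M.edge s ρ s' →
      HistoryStep (.inl (control s)) (.inl ρ) B (.inl (control s'))
  | control_halt (s : S) (ρ : Ρ) : M.accept s →
      HistoryStep (.inl (control s)) (.inl ρ) B (.inl halted)
  | count_succ (n : ℕ) : HistoryStep (.inr (n + 1)) (.inr true) B (.inr n)
  | count_sep (s : S) (ρ : Ρ) : M.edge M.start ρ s →
      HistoryStep (.inr 0) (.inl ρ) B (.inl (control s))
  | count_halt (ρ : Ρ) : M.accept M.start →
      HistoryStep (.inr 0) (.inl ρ) B (.inl halted)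

/-- The automaton that reads histories. -/
def historyAutomaton : WeightAutomaton (Ρ ⊕ Bool) (HistoryState S Ρ ⊕ ℕ) where
  step := M.HistoryStep B
  final p := p = .inl before ∨ p = .inl after ∨ p = .inl halted

/-- The initial states of the part of the automaton that looks for a wrong step. -/
def testStates (S Ρ : Type) : Set (HistoryState S Ρ ⊕ ℕ) :=
  {p | p = .inl before ∨ ∃ ρ r sg, p = .inl (first ρ r sg)}

/-- All coefficients of the machine are at most `B`. -/
def CoeffLE : Prop := ∀ ρ r, M.mul ρ r ≤ B ∧ M.add ρ r ≤ B ∧ M.mul' ρ r ≤ B ∧ M.add' ρ r ≤ B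

theorem exists_coeffLE [Finite Ρ] : ∃ B, 0 < B ∧ M.CoeffLE B := by
  cases nonempty_fintype Ρ
  -- The summand `1` makes the bound positive, so that blocks of length `2 * B` are nonempty.
  refine ⟨1 + ∑ x : Ρ × Bool, (M.mul x.1 x.2 + M.add x.1 x.2 + M.mul' x.1 x.2 + M.add' x.1 x.2),
    by omega, fun ρ r => ?_⟩
  have := Finset.single_le_sum (f := fun x : Ρ × Bool =>
    M.mul x.1 x.2 + M.add x.1 x.2 + M.mul' x.1 x.2 + M.add' x.1 x.2)
    (fun _ _ => Nat.zero_le _) (Finset.mem_univ (ρ, r))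
  dsimp only at this
  omega

variable {M B}

theorem step_le_two_mul (hB : M.CoeffLE B) (p : HistoryState S Ρ ⊕ ℕ) (u : Ρ ⊕ Bool) (m : ℕ)
    (p' : HistoryState S Ρ ⊕ ℕ) (h : (M.historyAutomaton B).step p u m p') : m ≤ 2 * B := by
  have key : ∀ sg {x : ℕ}, x ≤ B → shiftWeight B sg x ≤ 2 * B := by
    intro sg x hx
    cases sg <;> simp [shiftWeight] <;> omega
  cases h with
  | first_unit ρ r sg r' =>
    split_ifs
    · exact key _ (hB _ _).1
    · omega
  | first_sep => exact key _ (hB _ _).2.1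
  | second_unit ρ r sg r' =>
    split_ifs
    · exact key _ (hB _ _).2.2.1
    · omega
  | second_sep => exact key _ (hB _ _).2.2.2
  | _ => omega

/-- The word that represents a history: for each configuration, the register units followed by
a separator, which announces the next rule. -/
def historyWord (h : List (List Bool × Ρ)) : List (Ρ ⊕ Bool) :=
  h.flatMap fun x => x.1.map .inr ++ [.inl x.2]

theorem historyWord_cons (x : List Bool × Ρ) (h : List (List Bool × Ρ)) :
    historyWord (x :: h) = x.1.map .inr ++ .inl x.2 :: historyWord h := by
  simp [historyWord]

/-- The register values that a list of register units represents. -/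
def values (l : List Bool) (r : Bool) : ℕ := l.count r

theorem runs_after {us : List (Ρ ⊕ Bool)} {n : ℕ} :
    (M.historyAutomaton B).Runs (.inl after) us n ↔ n = B * us.length := by
  have h : ∀ (u : Ρ ⊕ Bool) (m : ℕ) p', (M.historyAutomaton B).step (.inl after) (id u) m p' ↔
      m = B ∧ p' = .inl after := by
    intro u m p'
    constructor
    · rintro ⟨⟩
      exact ⟨rfl, rfl⟩
    · rintro ⟨rfl, rfl⟩
      exact .after_all _
  have := runs_append_of_loop h us [] n
  rw [List.map_id, List.append_nil] at this
  rw [this]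
  simp only [runs_nil, List.map_const', List.sum_replicate, smul_eq_mul]
  constructor
  · rintro ⟨_, ⟨rfl, -⟩, rfl⟩
    ring
  · rintro rfl
    exact ⟨0, ⟨rfl, .inr (.inl rfl)⟩, by ring⟩

theorem sum_unit_weights {r : Bool} {a : ℕ} (d : ℤ) (ha : (a : ℤ) = B + d) (l : List Bool) :
    (((l.map fun r' => if r' = r then a else B).sum : ℕ) : ℤ) =
      B * l.length + d * values l r := by
  induction l with
  | nil => simp [values]
  | cons b l ih =>
    rw [List.map_cons, List.sum_cons, Nat.cast_add, ih]
    by_cases h : b = r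
    · simp [h, values, ha]
      ring
    · simp [h, values]
      ring

theorem signed_mul (sg : Bool) (x y : ℤ) : signed sg x * y = signed sg (x * y) := by
  cases sg <;> simp [signed]

theorem signed_add (sg : Bool) (x y : ℤ) : signed sg x + signed sg y = signed sg (x + y) := by
  cases sg <;> simp [signed]
  ring

theorem second_step_unit {ρ : Ρ} {r sg : Bool} (r' : Bool) (m : ℕ) (p' : HistoryState S Ρ ⊕ ℕ) :
    (M.historyAutomaton B).step (.inl (second ρ r sg)) (.inr r') m p' ↔
      m = (if r' = r then shiftWeight B (!sg) (M.mul' ρ r) else B) ∧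
        p' = .inl (second ρ r sg) := by
  constructor
  · rintro ⟨⟩
    exact ⟨rfl, rfl⟩
  · rintro ⟨rfl, rfl⟩
    exact .second_unit ..

theorem exists_runs_second (ρ : Ρ) (r sg : Bool) (x : List Bool × Ρ) (h : List (List Bool × Ρ)) :
    ∃ n, (M.historyAutomaton B).Runs (.inl (second ρ r sg)) (historyWord (x :: h)) n := by
  rw [historyWord_cons]
  simp only [runs_append_of_loop second_step_unit]
  exact ⟨_, _, .cons (.second_sep ..) (runs_after.2 rfl), rfl⟩

/-- Each letter contributes the neutral weight `B`, each unit of the register `r` in the first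
configuration deviates by `mul'`, and the separator deviates by `add'`. The sign is opposite to `sg`
because this is the right-hand side of the equation. -/
theorem runs_second (hB : M.CoeffLE B) {ρ : Ρ} {r sg : Bool} {h : List (List Bool × Ρ)} {n : ℕ} :
    (M.historyAutomaton B).Runs (.inl (second ρ r sg)) (historyWord h) n ↔
      ∃ x h', h = x :: h' ∧ (n : ℤ) = B * (historyWord h).length +
        signed (!sg) (M.mul' ρ r * values x.1 r + M.add' ρ r) := by
  cases h with
  | nil =>
    rw [historyWord, List.flatMap_nil, runs_nil]
    simp [historyAutomaton]
  | cons x h =>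
    rw [historyWord_cons, runs_append_of_loop second_step_unit]
    simp only [runs_cons]
    have hsum := sum_unit_weights (r := r) _ (cast_shiftWeight (!sg) (hB ρ r).2.2.1) x.1
    have hsep := cast_shiftWeight (!sg) (hB ρ r).2.2.2
    rw [signed_mul] at hsum
    have hlen : ((x.1.map Sum.inr ++ Sum.inl x.2 :: historyWord h : List (Ρ ⊕ Bool)).length : ℤ) =
        x.1.length + 1 + (historyWord h).length := by
      push_cast [List.length_append, List.length_map, List.length_cons]
      ring
    have hnat : ∀ k : ℕ, (k = (x.1.map fun r' => if r' = r then
        shiftWeight B (!sg) (M.mul' ρ r) else B).sum +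
          (shiftWeight B (!sg) (M.add' ρ r) + B * (historyWord h).length)) ↔
        (k : ℤ) = B * (x.1.length + 1 + (historyWord h).length) +
          signed (!sg) (M.mul' ρ r * values x.1 r + M.add' ρ r) := by
      intro k
      rw [← Nat.cast_inj (R := ℤ)]
      push_cast
      push_cast at hsum
      rw [hsum, hsep, ← signed_add]
      constructor <;> intro h <;> rw [h] <;> ring
    constructor
    · rintro ⟨n', ⟨m, n'', p', hs, hr, rfl⟩, hn⟩
      cases hs
      rw [runs_after] at hr
      subst hr
      exact ⟨x, h, rfl, by rw [hlen]; exact (hnat n).1 hn⟩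
    · rintro ⟨x', h', he, hn⟩
      obtain ⟨rfl, rfl⟩ := List.cons.inj he
      rw [hlen] at hn
      exact ⟨_, ⟨_, _, _, .second_sep .., runs_after.2 rfl, rfl⟩, (hnat n).2 hn⟩

/-- The deviations over two consecutive configurations add up to the difference of both sides of the
equation for `r`. The separator has to match the guessed rule, since the multiplier is used before
the rule has been read. -/
theorem runs_first (hB : M.CoeffLE B) {ρ : Ρ} {r sg : Bool} {h : List (List Bool × Ρ)} {n : ℕ} :
    (M.historyAutomaton B).Runs (.inl (first ρ r sg)) (historyWord h) n ↔
      ∃ l y h', h = (l, ρ) :: y :: h' ∧ (n : ℤ) = B * (historyWord h).length +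
        signed sg (M.mul ρ r * values l r + M.add ρ r -
          (M.mul' ρ r * values y.1 r + M.add' ρ r)) := by
  cases h with
  | nil =>
    rw [historyWord, List.flatMap_nil, runs_nil]
    simp [historyAutomaton]
  | cons x h =>
    have hloop : ∀ (r' : Bool) (m : ℕ) p',
        (M.historyAutomaton B).step (.inl (first ρ r sg)) (.inr r') m p' ↔
          m = (if r' = r then shiftWeight B sg (M.mul ρ r) else B) ∧
            p' = .inl (first ρ r sg) := by
      intro r' m p'
      constructor
      · rintro ⟨⟩
        exact ⟨rfl, rfl⟩
      · rintro ⟨rfl, rfl⟩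
        exact .first_unit ..
    rw [historyWord_cons, runs_append_of_loop hloop]
    simp only [runs_cons]
    have hsum := sum_unit_weights (r := r) _ (cast_shiftWeight sg (hB ρ r).1) x.1
    have hsep := cast_shiftWeight sg (hB ρ r).2.1
    rw [signed_mul] at hsum
    have hlen : ((x.1.map Sum.inr ++ Sum.inl x.2 :: historyWord h : List (Ρ ⊕ Bool)).length : ℤ) =
        x.1.length + 1 + (historyWord h).length := by
      push_cast [List.length_append, List.length_map, List.length_cons]
      ring
    have hsub : ∀ a b : ℤ, signed sg (a - b) = signed sg a + signed (!sg) b := by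
      intro a b
      cases sg <;> simp [signed] <;> ring
    have hnat : ∀ (k k' : ℕ) (y : List Bool × Ρ), (k' : ℤ) = B * (historyWord h).length +
          signed (!sg) (M.mul' ρ r * values y.1 r + M.add' ρ r) →
        ((k = (x.1.map fun r' => if r' = r then
          shiftWeight B sg (M.mul ρ r) else B).sum + (shiftWeight B sg (M.add ρ r) + k')) ↔
        (k : ℤ) = B * (x.1.length + 1 + (historyWord h).length) +
          signed sg (M.mul ρ r * values x.1 r + M.add ρ r -
            (M.mul' ρ r * values y.1 r + M.add' ρ r))) := by
      intro k k' y hk'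
      rw [← Nat.cast_inj (R := ℤ)]
      push_cast
      push_cast at hsum
      rw [hsum, hsep, hsub, ← signed_add, hk']
      constructor <;> intro h <;> rw [h] <;> ring
    constructor
    · rintro ⟨n', ⟨m, n'', p', hs, hr, rfl⟩, hn⟩
      generalize hx : x.2 = ρ' at hs
      cases hs
      obtain ⟨y, h', rfl, hy⟩ := (runs_second hB).1 hr
      exact ⟨x.1, y, h', by rw [← hx], by rw [← hx, hlen]; subst hx; exact (hnat n n'' y hy).1 hn⟩
    · rintro ⟨l, y, h', he, hn⟩
      obtain ⟨rfl, rfl⟩ := List.cons.inj he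
      rw [hlen] at hn
      obtain ⟨k, hk⟩ := exists_runs_second (M := M) (B := B) ρ r sg y h'
      obtain ⟨y', h'', he, hk'⟩ := (runs_second hB).1 hk
      obtain ⟨rfl, rfl⟩ := List.cons.inj he
      exact ⟨_, ⟨_, k, _, .first_sep .., hk, rfl⟩, (hnat n k y hk').2 hn⟩

theorem exists_runs_first (ρ : Ρ) (r sg : Bool) (l : List Bool) (y : List Bool × Ρ)
    (h : List (List Bool × Ρ)) :
    ∃ n, (M.historyAutomaton B).Runs (.inl (first ρ r sg)) (historyWord ((l, ρ) :: y :: h)) n := by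
  obtain ⟨k, hk⟩ := exists_runs_second (M := M) (B := B) ρ r sg y h
  rw [historyWord_cons]
  induction l with
  | nil => exact ⟨_, .cons (.first_sep ..) hk⟩
  | cons r' l ih =>
    obtain ⟨n, hn⟩ := ih
    exact ⟨_, .cons (.first_unit ..) hn⟩

theorem runs_before_cons {x : List Bool × Ρ} {h : List (List Bool × Ρ)} {n : ℕ} :
    (M.historyAutomaton B).Runs (.inl before) (historyWord (x :: h)) n ↔
      ∃ p ∈ testStates S Ρ, ∃ n', (M.historyAutomaton B).Runs p (historyWord h) n' ∧
        n = B * (x.1.length + 1) + n' := by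
  have hloop : ∀ (r' : Bool) (m : ℕ) p',
      (M.historyAutomaton B).step (.inl before) (.inr r') m p' ↔ m = B ∧ p' = .inl before := by
    intro r' m p'
    constructor
    · rintro ⟨⟩
      exact ⟨rfl, rfl⟩
    · rintro ⟨rfl, rfl⟩
      exact .before_unit ..
  rw [historyWord_cons, runs_append_of_loop hloop]
  simp only [runs_cons, List.map_const', List.sum_replicate, smul_eq_mul]
  constructor
  · rintro ⟨_, ⟨m, n', p', hs, hr, rfl⟩, rfl⟩
    cases hs with
    | before_sep => exact ⟨_, .inl rfl, n', hr, by ring⟩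
    | before_first => exact ⟨_, .inr ⟨_, _, _, rfl⟩, n', hr, by ring⟩
  · rintro ⟨p, rfl | ⟨ρ, r, sg, rfl⟩, n', hr, rfl⟩
    · exact ⟨_, ⟨_, _, _, .before_sep _, hr, rfl⟩, by ring⟩
    · exact ⟨_, ⟨_, _, _, .before_first .., hr, rfl⟩, by ring⟩

/-- The register values of consecutive configurations are related by the announced rules. -/
def ValidHistory (M : AffineMachine S Ρ) (h : List (List Bool × Ρ)) : Prop :=
  h.IsChain fun x y => M.Rel x.2 (values x.1) (values y.1)

theorem validHistory_cons_cons {x y : List Bool × Ρ} {h : List (List Bool × Ρ)} :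
    M.ValidHistory (x :: y :: h) ↔
      M.Rel x.2 (values x.1) (values y.1) ∧ M.ValidHistory (y :: h) :=
  List.isChain_cons_cons

/-- If every equation holds, all tests have deviation zero, so no run from a test state exceeds the
neutral weight. -/
theorem le_of_validHistory (hB : M.CoeffLE B) {h : List (List Bool × Ρ)} (hv : M.ValidHistory h)
    {p : HistoryState S Ρ ⊕ ℕ} (hp : p ∈ testStates S Ρ) {n : ℕ}
    (hr : (M.historyAutomaton B).Runs p (historyWord h) n) : n ≤ B * (historyWord h).length := by
  induction h generalizing p n with
  | nil =>
    rw [historyWord, List.flatMap_nil, runs_nil] at hr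
    omega
  | cons x h ih =>
    rcases hp with rfl | ⟨ρ, r, sg, rfl⟩
    · obtain ⟨p, hp, n', hr', rfl⟩ := runs_before_cons.1 hr
      have := ih (List.IsChain.tail hv) hp hr'
      rw [historyWord_cons]
      simp only [List.length_append, List.length_map, List.length_cons]
      calc _ ≤ B * (x.1.length + 1) + B * (historyWord h).length := by omega
        _ = _ := by ring
    · obtain ⟨l, y, h', he, hn⟩ := (runs_first hB).1 hr
      rw [he, validHistory_cons_cons] at hv
      have := hv.1 r
      dsimp only at this
      have h0 : (M.mul ρ r * values l r + M.add ρ r : ℤ) -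
          (M.mul' ρ r * values y.1 r + M.add' ρ r) = 0 := by
        rw [sub_eq_zero]
        exact_mod_cast this
      rw [h0] at hn
      have h00 : signed sg 0 = 0 := by cases sg <;> rfl
      rw [h00, add_zero] at hn
      exact_mod_cast hn.le

/-- Wait in `before` until the wrong step, then test the violated equation with the sign that makes
its nonzero deviation positive. -/
theorem exists_runs_of_not_validHistory (hB : M.CoeffLE B) {h : List (List Bool × Ρ)}
    (hv : ¬ M.ValidHistory h) : ∃ p ∈ testStates S Ρ, ∃ n,
      (M.historyAutomaton B).Runs p (historyWord h) n ∧ B * (historyWord h).length < n := by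
  induction h with
  | nil => exact absurd List.isChain_nil hv
  | cons x h ih =>
    cases h with
    | nil => exact absurd (List.isChain_singleton _) hv
    | cons y h =>
      rw [validHistory_cons_cons, not_and_or] at hv
      rcases hv with hv | hv
      · rw [Rel, not_forall] at hv
        obtain ⟨r, hr⟩ := hv
        obtain ⟨l, ρ⟩ := x
        dsimp only at hr
        have hne : (M.mul ρ r * values l r + M.add ρ r : ℤ) -
            (M.mul' ρ r * values y.1 r + M.add' ρ r) ≠ 0 := by
          rw [sub_ne_zero]
          exact_mod_cast hr
        obtain ⟨sg, hsg⟩ : ∃ sg, 0 < signed sg ((M.mul ρ r * values l r + M.add ρ r : ℤ) -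
            (M.mul' ρ r * values y.1 r + M.add' ρ r)) := by
          rcases lt_or_gt_of_ne hne with h | h
          · exact ⟨false, by simpa [signed] using h⟩
          · exact ⟨true, by simpa [signed] using h⟩
        obtain ⟨n, hn⟩ := exists_runs_first (M := M) (B := B) ρ r sg l y h
        refine ⟨_, .inr ⟨ρ, r, sg, rfl⟩, n, hn, ?_⟩
        obtain ⟨l', y', h', he, hn'⟩ := (runs_first hB).1 hn
        simp only [List.cons.injEq, Prod.mk.injEq, and_true] at he
        obtain ⟨rfl, rfl, rfl⟩ := he
        zify
        rw [hn']
        omega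
      · obtain ⟨p, hp, n, hr, hn⟩ := ih hv
        refine ⟨_, .inl rfl, _, runs_before_cons.2 ⟨p, hp, n, hr, rfl⟩, ?_⟩
        rw [historyWord_cons x]
        simp only [List.length_append, List.length_map, List.length_cons]
        calc _ = B * (x.1.length + 1) + B * (historyWord (y :: h)).length := by ring
          _ < _ := by omega

/-- The rules lead from the state `s` to an accepting state; one more rule follows. -/
inductive RulePath (M : AffineMachine S Ρ) : S → List Ρ → Prop
  | halt (s : S) (ρ : Ρ) : M.accept s → RulePath M s [ρ]
  | step {s s' : S} {ρ : Ρ} {l : List Ρ} : M.edge s ρ s' → RulePath M s' l →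
      RulePath M s (ρ :: l)

theorem runs_halted {us : List (Ρ ⊕ Bool)} {n : ℕ} :
    (M.historyAutomaton B).Runs (.inl halted) us n ↔ n = 0 ∧ us = [] := by
  cases us with
  | nil => simp [runs_nil, historyAutomaton]
  | cons u us =>
    rw [runs_cons]
    constructor
    · rintro ⟨_, _, _, h, -⟩
      cases h
    · simp

/-- These states check only the sequence of rules and ignore the register values, so every run has
the neutral weight. -/
theorem runs_control {s : S} {us : List (Ρ ⊕ Bool)} {n : ℕ} :
    (M.historyAutomaton B).Runs (.inl (control s)) us n ↔
      ∃ h, us = historyWord h ∧ RulePath M s (h.map Prod.snd) ∧ n = B * us.length := by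
  constructor
  · intro hr
    induction us generalizing s n with
    | nil =>
      rw [runs_nil] at hr
      simp [historyAutomaton] at hr
    | cons u us ih =>
      obtain ⟨m, n', p', hs, hr, rfl⟩ := runs_cons.1 hr
      cases hs with
      | control_unit _ r =>
        obtain ⟨h, rfl, hp, rfl⟩ := ih hr
        rcases h with _ | ⟨x, h⟩
        · cases hp
        · refine ⟨(r :: x.1, x.2) :: h, ?_, hp, by simp; ring⟩
          rw [historyWord_cons, historyWord_cons]
          rfl
      | control_sep _ s' ρ he =>
        obtain ⟨h, rfl, hp, rfl⟩ := ih hr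
        exact ⟨([], ρ) :: h, by rw [historyWord_cons]; rfl, .step he hp, by simp; ring⟩
      | control_halt _ ρ ha =>
        obtain ⟨rfl, rfl⟩ := runs_halted.1 hr
        exact ⟨[([], ρ)], rfl, .halt s ρ ha, by simp⟩
  · rintro ⟨h, rfl, hp, rfl⟩
    have hloop : ∀ (s : S) (r' : Bool) (m : ℕ) p', (M.historyAutomaton B).step (.inl (control s))
        (.inr r') m p' ↔ m = B ∧ p' = .inl (control s) := by
      intro s r' m p'
      constructor
      · rintro ⟨⟩
        exact ⟨rfl, rfl⟩
      · rintro ⟨rfl, rfl⟩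
        exact .control_unit ..
    induction h generalizing s with
    | nil => cases hp
    | cons x h ih =>
      rw [historyWord_cons, runs_append_of_loop (hloop s)]
      obtain ⟨l, ρ⟩ := x
      generalize hρ : h.map Prod.snd = ρs at hp ih
      rw [List.map_cons, hρ] at hp
      cases hp with
      | halt _ _ ha =>
        obtain rfl := List.map_eq_nil_iff.1 hρ
        exact ⟨_, .cons (.control_halt s ρ ha) (runs_halted.2 ⟨rfl, rfl⟩), by
          simp [historyWord]; ring⟩
      | step he hp =>
        exact ⟨_, .cons (.control_sep s _ ρ he) (ih hp), by simp; ring⟩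

/-- The counter forces the first configuration to be exactly `g` units of the register `true`;
afterwards only the control flow is checked. Validity of the steps is left to the tests. -/
theorem runs_count {g : ℕ} {us : List (Ρ ⊕ Bool)} {n : ℕ} :
    (M.historyAutomaton B).Runs (.inr g) us n ↔
      ∃ ρ h, us = historyWord ((List.replicate g true, ρ) :: h) ∧
        RulePath M M.start (ρ :: h.map Prod.snd) ∧ n = B * us.length := by
  induction g generalizing us n with
  | zero =>
    cases us with
    | nil => simp [runs_nil, historyAutomaton, historyWord_cons]
    | cons u us =>
      rw [runs_cons]
      constructor
      · rintro ⟨m, n', p', hs, hr, rfl⟩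
        cases hs with
        | count_sep s ρ he =>
          obtain ⟨h, rfl, hp, rfl⟩ := runs_control.1 hr
          exact ⟨ρ, h, by rw [historyWord_cons]; rfl, .step he hp, by simp; ring⟩
        | count_halt ρ ha =>
          obtain ⟨rfl, rfl⟩ := runs_halted.1 hr
          exact ⟨ρ, [], rfl, .halt _ ρ ha, by simp⟩
      · rintro ⟨ρ, h, he, hp, rfl⟩
        rw [historyWord_cons] at he
        obtain ⟨rfl, rfl⟩ := List.cons.inj he
        generalize hρ : h.map Prod.snd = ρs at hp
        cases hp with
        | halt _ _ ha =>
          obtain rfl := List.map_eq_nil_iff.1 hρ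
          exact ⟨_, _, _, .count_halt ρ ha, runs_halted.2 ⟨rfl, rfl⟩, by simp [historyWord]⟩
        | step he hp =>
          subst hρ
          exact ⟨_, _, _, .count_sep _ ρ he, runs_control.2 ⟨h, rfl, hp, rfl⟩, by simp; ring⟩
  | succ g ih =>
    cases us with
    | nil => simp [runs_nil, historyAutomaton, historyWord_cons]
    | cons u us =>
      rw [runs_cons]
      constructor
      · rintro ⟨m, n', p', hs, hr, rfl⟩
        cases hs
        obtain ⟨ρ, h, rfl, hp, rfl⟩ := ih.1 hr
        exact ⟨ρ, h, by rw [historyWord_cons, historyWord_cons]; rfl, hp, by simp; ring⟩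
      · rintro ⟨ρ, h, he, hp, rfl⟩
        rw [historyWord_cons, List.replicate_succ, List.map_cons, List.cons_append] at he
        obtain ⟨rfl, rfl⟩ := List.cons.inj he
        exact ⟨_, _, _, .count_succ g, ih.2 ⟨ρ, h, by rw [historyWord_cons], hp, rfl⟩,
          by simp; ring⟩

/-- Acceptance is witnessed by a valid history. -/
theorem accepts_iff [Nonempty Ρ] {g : ℕ} : M.Accepts (fun r => bif r then g else 0) ↔
    ∃ ρ h, RulePath M M.start (ρ :: h.map Prod.snd) ∧
      M.ValidHistory ((List.replicate g true, ρ) :: h) := by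
  have hval : values (List.replicate g true) = fun r => bif r then g else 0 := by
    funext r
    cases r <;> simp [values, List.count_replicate]
  have exists_values : ∀ v : Bool → ℕ, ∃ l, values l = v := by
    intro v
    refine ⟨List.replicate (v true) true ++ List.replicate (v false) false, ?_⟩
    funext r
    cases r <;> simp [values, List.count_replicate]
  rw [← hval]
  constructor
  · rintro ⟨c, hc, ha⟩
    have key : ∀ d, Relation.ReflTransGen M.Step d c → ∀ l, values l = d.2 →
        ∃ ρ h, RulePath M d.1 (ρ :: h.map Prod.snd) ∧ M.ValidHistory ((l, ρ) :: h) := by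
      intro d hd
      induction hd using Relation.ReflTransGen.head_induction_on with
      | refl =>
        intro l _
        -- The last separator still needs a label; any rule will do, since no configuration follows.
        obtain ⟨ρ⟩ := ‹Nonempty Ρ›
        exact ⟨ρ, [], .halt _ _ ha, List.isChain_singleton _⟩
      | @head d e hde _ ih =>
        intro l hl
        obtain ⟨ρ, he, hrel⟩ := hde
        obtain ⟨l', hl'⟩ := exists_values e.2
        obtain ⟨ρ', h, hp, hv⟩ := ih l' hl'
        refine ⟨ρ, (l', ρ') :: h, .step he hp, validHistory_cons_cons.2 ⟨?_, hv⟩⟩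
        rw [hl, hl']
        exact hrel
    exact key _ hc _ rfl
  · rintro ⟨ρ, h, hp, hv⟩
    have key : ∀ (s : S) (l : List Bool), RulePath M s (ρ :: h.map Prod.snd) →
        M.ValidHistory ((l, ρ) :: h) →
        ∃ c, Relation.ReflTransGen M.Step (s, values l) c ∧ M.accept c.1 := by
      clear hp hv
      induction h generalizing ρ with
      | nil =>
        intro s l hp _
        cases hp with
        | halt _ _ ha => exact ⟨_, .refl, ha⟩
        | step _ h => cases h
      | cons y h ih =>
        intro s l hp hv
        obtain ⟨hrel, hv⟩ := validHistory_cons_cons.1 hv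
        cases hp with
        | step he hp =>
          obtain ⟨c, hc, ha⟩ := ih y.2 _ y.1 hp hv
          exact ⟨c, .head ⟨ρ, he, hrel⟩ hc, ha⟩
    exact key _ _ hp hv

end AffineMachine

/-! ### Absorption in row sums -/

instance Sum.Lex.wellFoundedLT {X Y : Type} [LinearOrder X] [LinearOrder Y] [WellFoundedLT X]
    [WellFoundedLT Y] : WellFoundedLT (X ⊕ₗ Y) :=
  inferInstanceAs (IsWellFounded (X ⊕ Y) (Sum.Lex (· < ·) (· < ·)))

namespace RowSum

open Ordinal

theorem type_sumLex {X Y : Type} [LinearOrder X] [LinearOrder Y] [WellFoundedLT X]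
    [WellFoundedLT Y] : typeLT (X ⊕ₗ Y) = typeLT X + typeLT Y := rfl

variable {I : Type} [LinearOrder I] [WellFoundedLT I] {D E : I → Type} [∀ i, LinearOrder (D i)]
  [∀ i, LinearOrder (E i)] [∀ i, WellFoundedLT (D i)] [∀ i, WellFoundedLT (E i)]

-- An ordinal below `ω ^ (N + 1)` is absorbed from the left by any ordinal that is at least this
-- power.
omit [WellFoundedLT I] in
theorem nonempty_iso_of_absorbed (N : I → ℕ) (hD : ∀ i, typeLT (D i) < ω ^ (N i + 1))
    (hE : ∀ i, Nonempty (D i) → ω ^ (N i + 1) ≤ typeLT (E i)) :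
    Nonempty (RowSum (fun i => D i ⊕ₗ E i) ≃o RowSum E) := by
  refine nonempty_iso_of_type_eq fun i => ?_
  rw [type_sumLex]
  rcases isEmpty_or_nonempty (D i) with h | h
  · rw [type_eq_zero_iff_isEmpty.2 h, zero_add]
  · have h1 := hD i
    have h2 := hE i h
    rw [← opow_natCast] at h1 h2
    exact add_of_omega0_opow_le h1 h2

/-- An isomorphism would give `ω ^ N + β ≤ n + β` for the type `β` of `E i` and a finite `n`. For
infinite `β` the `n` is absorbed, which forces `ω ^ (N + 1) ≤ β`. For finite `β` the right side is
finite while the left is not, because `N ≠ 0`. -/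
theorem isEmpty_iso_of_not_absorbed {N : ℕ} (hN : N ≠ 0) {i : I} (hD : ω ^ N ≤ typeLT (D i))
    (hE : typeLT (E i) < ω ^ (N + 1)) : IsEmpty (RowSum (fun i => D i ⊕ₗ E i) ≃o RowSum E) := by
  refine ⟨fun e => ?_⟩
  obtain ⟨n, hn⟩ := exists_type_le_of_iso e i
  rw [type_sumLex] at hn
  have h1 : ω ^ N + typeLT (E i) ≤ n + typeLT (E i) := (add_le_add_left hD _).trans hn
  rcases lt_or_ge (typeLT (E i)) ω with hlt | hge
  · obtain ⟨m, hm⟩ := lt_omega0.1 hlt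
    have h2 : ω ^ N ≤ ((n + m : ℕ) : Ordinal.{0}) := by
      rw [hm] at h1
      refine le_self_add.trans (h1.trans ?_)
      push_cast
      exact le_rfl
    have h3 : (ω : Ordinal.{0}) ≤ ω ^ N := by
      obtain ⟨N, rfl⟩ := Nat.exists_eq_succ_of_ne_zero hN
      rw [Nat.succ_eq_add_one, pow_succ]
      exact le_mul_right _ (pow_pos omega0_pos _)
    exact absurd (natCast_lt_omega0 _) (not_lt.2 (h3.trans h2))
  · have h2 : (n : Ordinal.{0}) + typeLT (E i) = typeLT (E i) := by
      refine add_of_omega0_opow_le (b := 1) ?_ ?_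
      · rw [opow_one]
        exact natCast_lt_omega0 n
      · rwa [opow_one]
    have h3 : ω ^ N + typeLT (E i) = typeLT (E i) := le_antisymm (h1.trans_eq h2) le_add_self
    rw [add_eq_right_iff_mul_omega0_le, ← pow_succ] at h3
    exact absurd hE (not_lt.2 h3)

end RowSum

/-! ### From flags to order types, and acceptance versus isomorphism -/

namespace FlagTransducer

open Content Ordinal

/-- The positions of the flags. -/
def flagged (s : List Bool) : Finset ℕ := (Finset.range s.length).filter fun i => s[i]? = some true

theorem mem_flagged {s : List Bool} {i : ℕ} : i ∈ flagged s ↔ s[i]? = some true := by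
  rw [flagged, Finset.mem_filter, Finset.mem_range, and_iff_right_iff_imp]
  intro h
  exact (List.getElem?_eq_some_iff.1 h).1

theorem card_flagged (s : List Bool) : (flagged s).card = s.count true := by
  induction s with
  | nil => rfl
  | cons b s ih =>
    have h : flagged (b :: s) = (if b then {0} else ∅) ∪ (flagged s).map (addRightEmbedding 1) := by
      ext i
      rw [Finset.mem_union, mem_flagged, Finset.mem_map]
      rcases i with _ | i
      · cases b <;> simp
      · cases b <;> simp [mem_flagged]
    rw [h, Finset.card_union_of_disjoint, Finset.card_map, ih, List.count_cons]
    · cases b <;> simp [add_comm]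
    · rw [Finset.disjoint_left]
      rintro i hi h
      obtain ⟨j, -, rfl⟩ := Finset.mem_map.1 h
      cases b <;> simp at hi

theorem supported_iff_mem_box {c : Content} {s : List Bool} :
    Supported c s ↔ c ∈ box (flagged s) :=
  forall_congr' fun _ => imp_congr_right fun _ => mem_flagged.symm

theorem weight_le_of_supported {c : Content} {s : List Bool} (h : Supported c s) (n : ℕ) :
    weight n c ≤ s.count true := by
  classical
  have hw : weight n c = ((Finset.range n).filter fun i => c i ≠ 0).card := by
    rw [weight, Finset.card_filter]
    refine Finset.sum_congr rfl fun i _ => ?_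
    by_cases h0 : c i = 0 <;> simp [h0]
  rw [hw, ← card_flagged]
  refine Finset.card_le_card fun i hi => ?_
  rw [mem_flagged]
  exact h i (Finset.mem_filter.1 hi).2

variable {α β Q : Type}

/-- The transducer that reads letters through the translation `e`. -/
def comap (T : FlagTransducer β Q) (e : α → β) : FlagTransducer α Q where
  step q a b q' := T.step q (e a) b q'
  final := T.final

theorem runs_comap {T : FlagTransducer β Q} {e : α → β} {q : Q} {w : List α} {s : List Bool} :
    (T.comap e).Runs q w s ↔ T.Runs q (w.map e) s := by
  constructor
  · intro h
    induction h with
    | nil q h => exact .nil q h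
    | cons h _ ih => exact .cons h ih
  · intro h
    generalize hw : w.map e = w' at h
    induction h generalizing w with
    | nil q h =>
      obtain rfl := List.map_eq_nil_iff.1 hw
      exact .nil q h
    | cons h _ ih =>
      obtain ⟨a, w, rfl, rfl, rfl⟩ := List.map_eq_cons_iff.1 hw
      exact .cons h (ih rfl)

instance (T : FlagTransducer α Q) (I : Set Q) (w : List α) : WellFoundedLT (T.contents I w) :=
  wellFoundedLT_of_bounded w.length (T.contents_bounded I w)

instance (T : FlagTransducer α Q) (I : Set Q) (w : ShortlexWord α) :
    WellFoundedLT (T.contents I w) :=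
  wellFoundedLT_of_bounded (List.length w) (T.contents_bounded I w)

theorem type_contents_lt {T : FlagTransducer α Q} {I : Set Q} {w : List α} {N : ℕ}
    (h : ∀ q ∈ I, ∀ s, T.Runs q w s → s.count true ≤ N) :
    typeLT (T.contents I w) < ω ^ (N + 1) := by
  refine type_lt_pow (T.contents_bounded I w) ?_
  rintro c ⟨q, hq, s, hs, hc⟩
  exact (weight_le_of_supported hc _).trans (h q hq s hs)

theorem pow_le_type_contents {T : FlagTransducer α Q} {I : Set Q} {w : List α} {q : Q}
    (hq : q ∈ I) {s : List Bool} (h : T.Runs q w s) :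
    ω ^ (s.count true) ≤ typeLT (T.contents I w) := by
  rw [← card_flagged]
  refine (pow_le_type_box _).trans ?_
  have hsub : box (flagged s) ⊆ T.contents I w := fun c hc =>
    ⟨q, hq, s, h, supported_iff_mem_box.2 hc⟩
  exact type_le_iff'.2 ⟨⟨⟨Set.inclusion hsub, Set.inclusion_injective hsub⟩, Iff.rfl⟩⟩

end FlagTransducer

namespace AffineMachine

open FlagTransducer WeightAutomaton HistoryState

variable {S Ρ : Type} (M : AffineMachine S Ρ) (B : ℕ) [NeZero (2 * B)] {α : Type}

/-- The transducer whose flags compare the order types of the parts of a row. -/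
def historyTransducer (e : α → (Ρ ⊕ Bool) × Fin (2 * B)) :
    FlagTransducer α (BlockState (Ρ ⊕ Bool) (HistoryState S Ρ ⊕ ℕ) (2 * B)) :=
  ((M.historyAutomaton B).toFlagTransducer (2 * B)).comap e

/-- The initial state of the part that accepts histories with the initial register value `g`. -/
def countState (S Ρ : Type) (B g : ℕ) :
    BlockState (Ρ ⊕ Bool) (HistoryState S Ρ ⊕ ℕ) (2 * B) := (.inr g, none)

/-- The initial states of the part that looks for wrong steps. -/
def testBlockStates (S Ρ : Type) (B : ℕ) :
    Set (BlockState (Ρ ⊕ Bool) (HistoryState S Ρ ⊕ ℕ) (2 * B)) :=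
  {q | q.1 ∈ testStates S Ρ ∧ q.2 = none}

variable {M B}

/-- The rows for the machine with the initial register value `g` are isomorphic to the rows
that do not depend on `g` if and only if the machine does not accept. -/
theorem nonempty_iso_iff [Nonempty Ρ] [LinearOrder α] [WellFoundedLT α] (hB : M.CoeffLE B)
    (e : α ≃ (Ρ ⊕ Bool) × Fin (2 * B)) (g : ℕ) :
    Nonempty (RowSum (fun w : ShortlexWord α =>
        (M.historyTransducer B e).contents {countState S Ρ B g} w ⊕ₗ
          (M.historyTransducer B e).contents (testBlockStates S Ρ B) w) ≃o
      RowSum (fun w : ShortlexWord α =>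
        (M.historyTransducer B e).contents (testBlockStates S Ρ B) w)) ↔
    ¬ M.Accepts (fun r => bif r then g else 0) := by
  have hpos : 0 < B := by
    have := NeZero.ne (2 * B)
    omega
  -- Blocks have length `2 * B`, so half the length of a word is the neutral weight of the history
  -- that it codes. This gives an exponent for every word, including those that code nothing.
  have hlen : ∀ {w : List α} {us : List (Ρ ⊕ Bool)}, w.map e = blocks (2 * B) us →
      w.length / 2 = B * us.length := by
    intro w us h
    have := congrArg List.length h
    rw [List.length_map, length_blocks] at this
    rw [this, mul_assoc]
    omega
  have hsurj : ∀ us : List (Ρ ⊕ Bool), ∃ w : List α, w.map e = blocks (2 * B) us := fun us =>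
    ⟨(blocks (2 * B) us).map e.symm, by simp⟩
  have hlift : ∀ {p : HistoryState S Ρ ⊕ ℕ} {w : List α} {us : List (Ρ ⊕ Bool)} {n : ℕ},
      w.map e = blocks (2 * B) us → (M.historyAutomaton B).Runs p us n →
      ∃ s, (M.historyTransducer B e).Runs (p, none) w s ∧ s.count true = n := by
    intro p w us n hw hr
    obtain ⟨s, hs, hn⟩ := exists_runs_toFlagTransducer (step_le_two_mul hB) hr
    exact ⟨s, runs_comap.2 (by rwa [hw]), hn⟩
  rw [accepts_iff]
  constructor
  · rintro ⟨iso⟩ ⟨ρ, h, hp, hv⟩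
    obtain ⟨w, hw⟩ := hsurj (historyWord ((List.replicate g true, ρ) :: h))
    have hr := (runs_count (M := M) (B := B) (g := g)).2 ⟨ρ, h, rfl, hp, rfl⟩
    obtain ⟨s, hs, hn⟩ := hlift hw hr
    -- The row of a valid accepting history obstructs: its count run has the neutral weight `N`, and
    -- no test exceeds it.
    refine (RowSum.isEmpty_iso_of_not_absorbed (I := ShortlexWord α)
      (N := B * (historyWord ((List.replicate g true, ρ) :: h)).length) ?_ (i := w) ?_ ?_).false iso
    · rw [historyWord_cons]
      simp [hpos.ne']
    · rw [← hn]
      exact pow_le_type_contents (Set.mem_singleton (countState S Ρ B g)) hs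
    · refine type_contents_lt ?_
      rintro ⟨p, o⟩ ⟨hp, rfl⟩ s' hs'
      obtain ⟨us, h1, h2⟩ := runs_of_runs_toFlagTransducer (runs_comap.1 hs')
      rw [hw] at h1
      rw [← blocks_injective h1] at h2
      exact le_of_validHistory hB hv hp h2
  · intro hna
    refine RowSum.nonempty_iso_of_absorbed (fun w : ShortlexWord α => List.length w / 2)
      (fun w => ?_) (fun w hw => ?_)
    · refine type_contents_lt ?_
      rintro _ rfl s hs
      obtain ⟨us, h1, h2⟩ := runs_of_runs_toFlagTransducer (runs_comap.1 hs)
      obtain ⟨ρ, h, rfl, -, hn⟩ := runs_count.1 h2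
      rw [hlen h1, hn]
    -- A nonempty first part means that `w` codes a history with an accepting sequence of rules. As
    -- the machine does not accept, some step is wrong, and a test gains at least one flag over the
    -- neutral weight.
    · obtain ⟨c, _, rfl, s, hs, -⟩ := hw
      obtain ⟨us, h1, h2⟩ := runs_of_runs_toFlagTransducer (runs_comap.1 hs)
      obtain ⟨ρ, h, rfl, hp, hn⟩ := runs_count.1 h2
      obtain ⟨p, hp', n, hr, hlt⟩ := exists_runs_of_not_validHistory hB
        fun hv => hna ⟨ρ, h, hp, hv⟩
      obtain ⟨s', hs', hn'⟩ := hlift h1 hr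
      refine le_trans ?_ (pow_le_type_contents
        (show (p, none) ∈ testBlockStates S Ρ B from ⟨hp', rfl⟩) hs')
      rw [hlen h1]
      exact pow_le_pow_right₀ (Order.one_le_iff_pos.2 Ordinal.omega0_pos) (by omega)

end AffineMachine

/-! ### Computable descriptions of the automata -/

/-- The state type `Z` may be infinite: acceptance, read from the root downwards, only involves the
states in `V`, which is closed under transitions. Numbers that encode no state of `V` are never
reached. -/
theorem TreeAutomatonCode.language_eq_of_encoding {k : ℕ} {Z : Type}
    (A : TreeAutomaton (Fin k) Z) {V : Set Z} {enc : Z → ℕ} {c : TreeAutomatonCode k}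
    (hinj : Function.Injective enc) (hle : ∀ z ∈ V, enc z ≤ c.1) (hinitV : A.init ∈ V)
    (hinit : c.2.1 = enc A.init)
    (hclosed : ∀ q ∈ V, ∀ a p p', (q, a, p, p') ∈ A.trans → p ∈ V ∧ p' ∈ V)
    (htrans : ∀ q ∈ V, ∀ a x y, (enc q, a, x, y) ∈ c.2.2.1 ↔
      ∃ p p', x = enc p ∧ y = enc p' ∧ (q, a, p, p') ∈ A.trans)
    {q₀ : Z} (hq₀ : q₀ ∈ V) (hA : A.final = {q₀}) (hc : c.2.2.2 = [enc q₀]) :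
    c.language = A.language := by
  have hval : ∀ {q}, q ∈ V → enc q < c.1 + 1 := fun hq => Nat.lt_succ_of_le (hle _ hq)
  have key : ∀ (t : LTree (Fin k)) (q : Z) (hq : q ∈ V),
      t ∈ c.toAutomaton.langOf ⟨enc q, hval hq⟩ ↔ t ∈ A.langOf q := by
    intro t
    induction t using LTree.induction_node with
    | he =>
      intro q hq
      rw [TreeAutomaton.empty_mem_langOf, TreeAutomaton.empty_mem_langOf, Fin.ext_iff]
      have : ((c.toAutomaton.init : Fin (c.1 + 1)) : ℕ) = enc A.init := by
        rw [toAutomaton, Fin.val_ofNat, hinit, Nat.mod_eq_of_lt (hval hinitV)]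
      rw [this]
      exact hinj.eq_iff
    | hn a l r hlr ihl ihr =>
      intro q hq
      rw [TreeAutomaton.node_mem_langOf _ hlr, TreeAutomaton.node_mem_langOf _ hlr]
      constructor
      · rintro ⟨x, y, hxy, hl, hr⟩
        obtain ⟨p, p', hx, hy, ht⟩ := (htrans q hq a x y).1 hxy
        obtain ⟨hp, hp'⟩ := hclosed q hq a p p' ht
        obtain rfl : x = ⟨enc p, hval hp⟩ := Fin.ext hx
        obtain rfl : y = ⟨enc p', hval hp'⟩ := Fin.ext hy
        exact ⟨p, p', ht, (ihl p hp).1 hl, (ihr p' hp').1 hr⟩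
      · rintro ⟨p, p', ht, hl, hr⟩
        have hmem := hclosed q hq a p p' ht
        exact ⟨⟨_, hval hmem.1⟩, ⟨_, hval hmem.2⟩,
          (htrans q hq a _ _).2 ⟨p, p', rfl, rfl, ht⟩,
          (ihl p hmem.1).2 hl, (ihr p' hmem.2).2 hr⟩
  have hfin : c.toAutomaton.final = {⟨enc q₀, hval hq₀⟩} := by
    ext x
    simp [toAutomaton, hc, Fin.ext_iff]
  rw [TreeAutomatonCode.language, TreeAutomaton.language_eq_langOf _ hfin,
    TreeAutomaton.language_eq_langOf _ hA]
  ext t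
  exact key t q₀ hq₀

theorem mul_add_cancel {C m m' c c' : ℕ} (hc : c < C) (hc' : c' < C)
    (h : m * C + c = m' * C + c') : m = m' ∧ c = c' := by
  have hC : 0 < C := (Nat.zero_le _).trans_lt hc
  have hmod := congrArg (· % C) h
  have hdiv := congrArg (· / C) h
  simp only [Nat.mul_add_mod', Nat.mod_eq_of_lt hc, Nat.mod_eq_of_lt hc'] at hmod
  simp only [mul_comm _ C, Nat.mul_add_div hC, Nat.div_eq_of_lt hc, Nat.div_eq_of_lt hc',
    add_zero] at hdiv
  exact ⟨hdiv, hmod⟩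

namespace FlagTransducer

/-- The transitions of the spine automaton for `IA = {q₀}`. -/
theorem spineTrans_singleton_iff {α Q : Type} {T : FlagTransducer α Q} {a₀ a₁ : α} {q₀ : Q}
    {IB : Set Q} {q p p' : SpineState Q} {a : α} :
    SpineTrans T a₀ a₁ {q₀} IB q a p p' ↔ SpineTrans T a₀ a₁ ∅ IB q a p p' ∨
      q = .root ∧ a = a₀ ∧ p = .run q₀ ∧ p' = .tagA := by
  constructor
  · intro h
    cases h with
    | root_A q hq => exact .inr ⟨rfl, rfl, by rw [hq], rfl⟩
    | chain_last => exact .inl .chain_last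
    | chain_step => exact .inl .chain_step
    | leaf₀ => exact .inl .leaf₀
    | leaf₁ => exact .inl .leaf₁
    | descent_zero => exact .inl .descent_zero
    | descent_succ => exact .inl .descent_succ
    | tagA => exact .inl .tagA
    | tagB => exact .inl .tagB
    | plain_last => exact .inl .plain_last
    | plain_step => exact .inl (.plain_step _)
    | run_last _ h => exact .inl (.run_last _ h)
    | run_step _ _ b _ h => exact .inl (.run_step _ _ b _ h)
    | run_flag _ _ _ h => exact .inl (.run_flag _ _ _ h)
    | root_plain => exact .inl .root_plain
    | root_B _ h => exact .inl (.root_B _ h)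
  · rintro (h | ⟨rfl, rfl, rfl, rfl⟩)
    · cases h with
      | root_A q hq => exact absurd hq (Set.notMem_empty q)
      | chain_last => exact .chain_last
      | chain_step => exact .chain_step
      | leaf₀ => exact .leaf₀
      | leaf₁ => exact .leaf₁
      | descent_zero => exact .descent_zero
      | descent_succ => exact .descent_succ
      | tagA => exact .tagA
      | tagB => exact .tagB
      | plain_last => exact .plain_last
      | plain_step => exact .plain_step _
      | run_last _ h => exact .run_last _ h
      | run_step _ _ b _ h => exact .run_step _ _ b _ h
      | run_flag _ _ _ h => exact .run_flag _ _ _ h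
      | root_plain => exact .root_plain
      | root_B _ h => exact .root_B _ h
    · exact .root_A q₀ rfl

/-- A transducer whose states of the form `(inr m, o)` count down uniformly, the steps from
`m = 0` leading to finitely many states. -/
structure IsCounting {α P O : Type} (T : FlagTransducer α ((P ⊕ ℕ) × O)) :
    Prop where
  succ : ∀ m o a b q, T.step (.inr (m + 1), o) a b q ↔
    ∃ d ≤ 1, ∃ o', q = (.inr (m + d), o') ∧ T.step (.inr 1, o) a b (.inr d, o')
  zero : ∀ o a b m o', T.step (.inr 0, o) a b (.inr m, o') → m = 0
  inl : ∀ p o a b m o', ¬ T.step (.inl p, o) a b (.inr m, o')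
  final : ∀ m o, ¬ T.final (.inr m, o)

namespace SpineState

variable {α P O : Type}

/-- The number of units a state has still to count, plus one. -/
def rank : SpineState ((P ⊕ ℕ) × O) → ℕ
  | run (.inr m, _) => m + 1
  | _ => 0

theorem rank_eq_zero_or (z : SpineState ((P ⊕ ℕ) × O)) :
    rank z = 0 ∨ ∃ m o, z = run (.inr m, o) := by
  cases z with
  | run q =>
    obtain ⟨p | m, o⟩ := q
    · exact .inl rfl
    · exact .inr ⟨m, o, rfl⟩
  | _ => exact .inl rfl

theorem finite_rank_zero [Finite P] [Finite O] :
    {z : SpineState ((P ⊕ ℕ) × O) | rank z = 0}.Finite := by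
  refine ((Set.toFinite {empty, chain, leaf₀, leaf₁, descent, tagA, tagB, root, plain}).union
    (Set.finite_range fun x : P × O => run (.inl x.1, x.2))).subset fun z hz => ?_
  cases z with
  | run q =>
    obtain ⟨p | m, o⟩ := q
    · exact .inr ⟨(p, o), rfl⟩
    · simp [rank] at hz
  | _ => exact .inl (by simp)

/-- An encoding of the states by natural numbers that is affine in the counter. -/
theorem exists_encoding (P O : Type) [Finite P] [Finite O] :
    ∃ (enc : SpineState ((P ⊕ ℕ) × O) → ℕ) (K C : ℕ) (e : O → ℕ), Function.Injective enc ∧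
      Function.Injective e ∧ (∀ o, e o < C) ∧ (∀ z, rank z = 0 → enc z < K) ∧
      ∀ m o, enc (run (.inr m, o)) = K + m * C + e o := by
  classical
  have := (finite_rank_zero (P := P) (O := O)).to_subtype
  obtain ⟨K, ⟨f⟩⟩ := Finite.exists_equiv_fin {z : SpineState ((P ⊕ ℕ) × O) | rank z = 0}
  obtain ⟨C, ⟨e⟩⟩ := Finite.exists_equiv_fin O
  let enc : SpineState ((P ⊕ ℕ) × O) → ℕ := fun z =>
    if h : rank z = 0 then f ⟨z, h⟩ else
      match z with
      | run (.inr m, o) => K + m * C + e o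
      | _ => 0
  have h0 : ∀ z (h : rank z = 0), enc z = f ⟨z, h⟩ := fun z h => dif_pos h
  have h1 : ∀ m o, enc (run (.inr m, o)) = K + m * C + e o := fun m o =>
    dif_neg (by simp [rank])
  have hlt : ∀ z, rank z = 0 → enc z < K := fun z h => by rw [h0 z h]; exact (f _).2
  refine ⟨enc, K, C, fun o => e o, fun z z' h => ?_, fun o o' h => e.injective (Fin.ext h),
    fun o => (e o).2, hlt, h1⟩
  rcases rank_eq_zero_or z with hz | ⟨m, o, rfl⟩ <;> rcases rank_eq_zero_or z' with hz' | ⟨m', o', rfl⟩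
  · rw [h0 z hz, h0 z' hz'] at h
    exact congrArg Subtype.val (f.injective (Fin.ext h))
  · have := hlt z hz
    rw [h, h1] at this
    omega
  · have := hlt z' hz'
    rw [← h, h1] at this
    omega
  · rw [h1, h1, add_assoc, add_assoc, Nat.add_left_cancel_iff] at h
    obtain ⟨rfl, ho⟩ := mul_add_cancel (e o).2 (e o').2 h
    rw [e.injective (Fin.ext ho)]

variable {T : FlagTransducer α ((P ⊕ ℕ) × O)} {a₀ a₁ : α} {IA IB : Set ((P ⊕ ℕ) × O)}

theorem rank_right {q p p' : SpineState ((P ⊕ ℕ) × O)} {a : α}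
    (h : SpineTrans T a₀ a₁ IA IB q a p p') : rank p' = 0 := by
  cases h <;> rfl

/-- Counters never increase. Hence the states needed for the input `n` are those of rank at most `n
+ 1`; the only transition that raises the rank is the one from the root into the counter, excluded
here by the empty set `∅` for `IA`. -/
theorem rank_left (hT : T.IsCounting) (hB : ∀ m o, (.inr m, o) ∉ IB)
    {q p p' : SpineState ((P ⊕ ℕ) × O)} {a : α}
    (h : SpineTrans T a₀ a₁ ∅ IB q a p p') : rank p ≤ rank q := by
  have hstep : ∀ {q a b q'}, T.step q a b q' → rank (run q') ≤ rank (run q) := by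
    rintro ⟨p | m, o⟩ a b ⟨p' | m', o'⟩ h
    · exact le_rfl
    · exact absurd h (hT.inl _ _ _ _ _ _)
    · exact Nat.zero_le _
    · rcases m with _ | m
      · rw [hT.zero _ _ _ _ _ h]
        exact le_rfl
      · obtain ⟨d, hd, o'', h, -⟩ := (hT.succ _ _ _ _ _).1 h
        simp only [Prod.mk.injEq, Sum.inr.injEq] at h
        simp only [rank]
        omega
  cases h with
  | run_step _ _ _ _ h => exact hstep h
  | run_flag _ _ _ h => exact hstep h
  | root_A _ h => exact absurd h (Set.notMem_empty _)
  | root_B q h =>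
    obtain ⟨p | m, o⟩ := q
    · exact le_rfl
    · exact absurd h (hB m o)
  | _ => exact Nat.zero_le _

theorem spineTrans_count_iff (hT : T.IsCounting) {m : ℕ} {o : O} {a : α}
    {p p' : SpineState ((P ⊕ ℕ) × O)} :
    SpineTrans T a₀ a₁ IA IB (run (.inr (m + 1), o)) a p p' ↔ ∃ d ≤ 1, ∃ o',
      p = run (.inr (m + d), o') ∧
        SpineTrans T a₀ a₁ IA IB (run (.inr 1, o)) a (run (.inr d, o')) p' := by
  constructor
  · intro h
    cases h with
    | run_last _ h => exact absurd h (hT.final _ _)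
    | run_step _ _ b _ h =>
      obtain ⟨d, hd, o', rfl, h'⟩ := (hT.succ _ _ _ _ _).1 h
      exact ⟨d, hd, o', rfl, .run_step _ _ b _ h'⟩
    | run_flag _ _ _ h =>
      obtain ⟨d, hd, o', rfl, h'⟩ := (hT.succ _ _ _ _ _).1 h
      exact ⟨d, hd, o', rfl, .run_flag _ _ _ h'⟩
  · rintro ⟨d, hd, o', rfl, h⟩
    cases h with
    | run_step _ _ b _ h => exact .run_step _ _ b _ ((hT.succ _ _ _ _ _).2 ⟨d, hd, o', rfl, h⟩)
    | run_flag _ _ _ h => exact .run_flag _ _ _ ((hT.succ _ _ _ _ _).2 ⟨d, hd, o', rfl, h⟩)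

end SpineState

end FlagTransducer

theorem exists_list_of_finite {α : Type} {s : Set α} (h : s.Finite) :
    ∃ l : List α, ∀ x, x ∈ l ↔ x ∈ s :=
  ⟨h.toFinset.toList, by simp⟩

/-- The transitions of a family of automata: a fixed part, one transition that depends on `n`,
and `n` shifted copies of a pattern. -/
def shiftedTransitions {β : Type} (K C r c t : ℕ) (b : β) (fixed : List (ℕ × β × ℕ × ℕ))
    (pat : List (ℕ × β × ℕ × ℕ × ℕ)) (n : ℕ) : List (ℕ × β × ℕ × ℕ) :=
  fixed ++ (r, b, K + n * C + c, t) :: (List.range n).flatMap fun m => pat.map fun x =>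
    (K + (m + 1) * C + x.1, x.2.1, K + (m + x.2.2.1) * C + x.2.2.2.1, x.2.2.2.2)

theorem primrec_shiftedTransitions {β : Type} [Primcodable β] (K C r c t : ℕ) (b : β)
    (fixed : List (ℕ × β × ℕ × ℕ)) (pat : List (ℕ × β × ℕ × ℕ × ℕ)) :
    Primrec (shiftedTransitions K C r c t b fixed pat) := by
  have affine : ∀ {γ : Type} [Primcodable γ] {f g : γ → ℕ}, Primrec f → Primrec g →
      Primrec fun x => K + f x * C + g x := fun hf hg =>
    Primrec.nat_add.comp (Primrec.nat_add.comp (Primrec.const K)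
      (Primrec.nat_mul.comp hf (Primrec.const C))) hg
  refine Primrec.list_append.comp (Primrec.const fixed) (Primrec.list_cons.comp
    ((Primrec.const r).pair ((Primrec.const b).pair
      ((affine Primrec.id (Primrec.const c)).pair (Primrec.const t)))) ?_)
  refine Primrec.list_flatMap Primrec.list_range ?_
  refine Primrec.list_map (Primrec.const pat) ?_
  have hm : Primrec fun p : (ℕ × ℕ) × (ℕ × β × ℕ × ℕ × ℕ) => p.1.2 :=
    Primrec.snd.comp Primrec.fst
  have h1 : Primrec fun p : (ℕ × ℕ) × (ℕ × β × ℕ × ℕ × ℕ) => p.2.2 :=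
    Primrec.snd.comp Primrec.snd
  have h2 : Primrec fun p : (ℕ × ℕ) × (ℕ × β × ℕ × ℕ × ℕ) => p.2.2.2 :=
    Primrec.snd.comp h1
  have h3 : Primrec fun p : (ℕ × ℕ) × (ℕ × β × ℕ × ℕ × ℕ) => p.2.2.2.2 :=
    Primrec.snd.comp h2
  exact (affine (Primrec.succ.comp hm) (Primrec.fst.comp Primrec.snd)).pair
    ((Primrec.fst.comp h1).pair ((affine (Primrec.nat_add.comp hm (Primrec.fst.comp h2))
      (Primrec.fst.comp h3)).pair (Primrec.snd.comp h3)))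

namespace FlagTransducer

open SpineState

/-- The spine automata for the initial states `(inr n, o₀)` have computable descriptions. -/
theorem exists_primrec_code {k : ℕ} {P O : Type} [Finite P] [Finite O]
    {T : FlagTransducer (Fin k) ((P ⊕ ℕ) × O)} (hT : T.IsCounting) (a₀ a₁ : Fin k) (o₀ : O)
    {IB : Set ((P ⊕ ℕ) × O)} (hB : ∀ m o, (.inr m, o) ∉ IB) :
    ∃ f : ℕ → TreeAutomatonCode k, Primrec f ∧
      ∀ n, (f n).language = (spineAutomaton T a₀ a₁ {(.inr n, o₀)} IB).language := by
  obtain ⟨enc, K, C, e, henc, he, heC, hK, hrun⟩ := exists_encoding P O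
  have hlt : ∀ n z, rank z ≤ n + 1 → enc z < K + (n + 1) * C := by
    intro n z hz
    rcases rank_eq_zero_or z with h | ⟨m, o, rfl⟩
    · exact (hK z h).trans_le (Nat.le_add_right _ _)
    · have h1 : m ≤ n := by simpa [rank] using hz
      have h2 := heC o
      have h3 : m * C ≤ n * C := Nat.mul_le_mul_right C h1
      rw [hrun, Nat.succ_mul]
      omega
  -- Rank at most `1` covers the states without a counter and those with counter `0`; their
  -- transitions do not depend on `n`, apart from the one from the root into the counter.
  have hfixed : {x : ℕ × Fin k × ℕ × ℕ | ∃ q p p', rank q ≤ 1 ∧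
      SpineTrans T a₀ a₁ ∅ IB q x.2.1 p p' ∧ x = (enc q, x.2.1, enc p, enc p')}.Finite := by
    refine ((Set.finite_Iio (K + 1 * C)).prod (Set.finite_univ.prod
      ((Set.finite_Iio (K + 1 * C)).prod (Set.finite_Iio (K + 1 * C))))).subset ?_
    rintro x ⟨q, p, p', hq, h, hx⟩
    rw [hx]
    exact ⟨hlt 0 q hq, trivial, hlt 0 p ((rank_left hT hB h).trans hq),
      hlt 0 p' (by rw [rank_right h]; exact Nat.zero_le _)⟩
  -- The pattern consists of the transitions from counter `1`, with the target counter `0` or `1`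
  -- recorded; shifting it by `m` gives those from counter `m + 1`.
  have hpat : {x : ℕ × Fin k × ℕ × ℕ × ℕ | ∃ o o' p', x.2.2.1 ≤ 1 ∧
      SpineTrans T a₀ a₁ ∅ IB (run (.inr 1, o)) x.2.1 (run (.inr x.2.2.1, o')) p' ∧
        x.1 = e o ∧ x.2.2.2.1 = e o' ∧ x.2.2.2.2 = enc p'}.Finite := by
    refine ((Set.finite_Iio C).prod (Set.finite_univ.prod ((Set.finite_Iic 1).prod
      ((Set.finite_Iio C).prod (Set.finite_Iio K))))).subset ?_
    rintro ⟨c, a, d, c', r⟩ ⟨o, o', p', hd, h, rfl, rfl, rfl⟩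
    exact ⟨heC o, trivial, hd, heC o', hK p' (rank_right h)⟩
  obtain ⟨fixed, hfixed⟩ := exists_list_of_finite hfixed
  obtain ⟨pat, hpat⟩ := exists_list_of_finite hpat
  refine ⟨fun n => (K + (n + 1) * C, enc .empty, shiftedTransitions K C (enc .root) (e o₀)
    (enc .tagA) a₀ fixed pat n, [enc .root]), ?_, fun n => ?_⟩
  · exact (Primrec.nat_add.comp (Primrec.const K)
      (Primrec.nat_mul.comp Primrec.succ (Primrec.const C))).pair ((Primrec.const _).pair
        ((primrec_shiftedTransitions ..).pair (Primrec.const _)))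
  · refine TreeAutomatonCode.language_eq_of_encoding (V := {z | rank z ≤ n + 1}) _ henc
      (fun z hz => (hlt n z hz).le) (Nat.zero_le _) rfl ?_ ?_ (q₀ := .root) (Nat.zero_le _) rfl rfl
    · intro q hq a p p' h
      refine ⟨?_, (rank_right h).trans_le (Nat.zero_le _)⟩
      rcases spineTrans_singleton_iff.1 h with h | ⟨rfl, rfl, rfl, rfl⟩
      · exact (rank_left hT hB h).trans hq
      · exact le_refl (n + 1)
    · intro q hq a x y
      have htr : ∀ p p', (q, a, p, p') ∈ (spineAutomaton T a₀ a₁ {(.inr n, o₀)} IB).trans ↔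
          SpineTrans T a₀ a₁ ∅ IB q a p p' ∨
            q = .root ∧ a = a₀ ∧ p = .run (.inr n, o₀) ∧ p' = .tagA := fun p p' =>
        spineTrans_singleton_iff
      simp only [htr, shiftedTransitions, List.mem_append, List.mem_cons, hfixed,
        List.mem_flatMap, List.mem_range, List.mem_map, hpat, Set.mem_ofPred_eq]
      constructor
      · rintro (⟨q', p, p', -, h, heq⟩ | heq | ⟨m, hm, ⟨c, a', d, c', r⟩,
          ⟨o, o', p', hd, h, h1, h2, h3⟩, heq⟩)
        · simp only [Prod.mk.injEq, true_and] at heq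
          obtain ⟨h1, rfl, rfl⟩ := heq
          rw [henc h1]
          exact ⟨p, p', rfl, rfl, .inl h⟩
        · simp only [Prod.mk.injEq] at heq
          obtain ⟨h1, rfl, rfl, rfl⟩ := heq
          exact ⟨.run (.inr n, o₀), .tagA, (hrun _ _).symm, rfl, .inr ⟨henc h1, rfl, rfl, rfl⟩⟩
        · simp only [Prod.mk.injEq] at heq h1 h2 h3 h hd
          obtain ⟨h4, rfl, rfl, rfl⟩ := heq
          subst h1 h2 h3
          rw [← hrun] at h4
          rw [← henc h4]
          exact ⟨.run (.inr (m + d), o'), p', (hrun _ _).symm, rfl,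
            .inl ((spineTrans_count_iff hT).2 ⟨d, hd, o', rfl, h⟩)⟩
      · rintro ⟨p, p', rfl, rfl, h | ⟨rfl, rfl, rfl, rfl⟩⟩
        · by_cases hq1 : rank q ≤ 1
          · exact .inl ⟨q, p, p', hq1, h, rfl⟩
          · right; right
            rcases rank_eq_zero_or q with h0 | ⟨m, o, rfl⟩
            · omega
            · rcases m with _ | m
              · exact absurd le_rfl hq1
              · obtain ⟨d, hd, o', rfl, h'⟩ := (spineTrans_count_iff hT).1 h
                refine ⟨m, by simpa [rank] using hq, (e o, a, d, e o', enc p'),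
                  ⟨o, o', p', hd, h', rfl, rfl, rfl⟩, ?_⟩
                rw [hrun, hrun]
        · exact .inr (.inl (by rw [hrun]))

end FlagTransducer

/-! ### The reduction from non-acceptance -/

namespace WeightAutomaton

variable {τ P : Type} {W : WeightAutomaton τ P} {ℓ : ℕ} [NeZero ℓ]

theorem blockStep_iff {q q' : BlockState τ P ℓ} {x : τ × Fin ℓ} {b : Bool} :
    W.BlockStep q x b q' ↔
      (∃ m : Fin (ℓ + 1), q.2 = none ∧ W.step q.1 x.1 m q'.1 ∧ x.2 = 0 ∧
        b = decide (0 < (m : ℕ)) ∧ ∀ p : P, (p, q'.2) = blockNext p x.1 0 m) ∨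
      ∃ m : Fin (ℓ + 1), q.2 = some (x.1, x.2, m) ∧ q'.1 = q.1 ∧
        b = decide ((x.2 : ℕ) < m) ∧ ∀ p : P, (p, q'.2) = blockNext p x.1 x.2 m := by
  have hnext : ∀ (p p' : P) (u : τ) (j : Fin ℓ) (m : Fin (ℓ + 1)),
      (blockNext p u j m).1 = p ∧ (p', (blockNext p u j m).2) = blockNext p' u j m := by
    intro p p' u j m
    unfold blockNext
    split_ifs <;> exact ⟨rfl, rfl⟩
  constructor
  · rintro (@⟨p, p', u, m, h⟩ | ⟨p, u, j, m⟩)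
    · exact .inl ⟨m, rfl, by rwa [(hnext p' p' u 0 m).1], rfl, rfl, fun p => (hnext _ p _ _ _).2⟩
    · exact .inr ⟨m, rfl, (hnext p p u j m).1, rfl, fun p => (hnext _ p _ _ _).2⟩
  · obtain ⟨p, o⟩ := q
    obtain ⟨p', o'⟩ := q'
    obtain ⟨u, j⟩ := x
    rintro (⟨m, h1, h2, h3, h4, h5⟩ | ⟨m, h1, h2, h3, h4⟩)
    · dsimp only at h1 h2 h3 h5
      subst h1 h3 h4
      rw [h5]
      exact .start h2
    · dsimp only at h1 h2 h3 h4
      subst h1 h2 h3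
      rw [h4]
      exact .middle ..

end WeightAutomaton

namespace AffineMachine

open FlagTransducer WeightAutomaton HistoryState

variable {S Ρ : Type} {M : AffineMachine S Ρ} {B : ℕ} [NeZero (2 * B)] {α : Type}

theorem step_count_iff {m w : ℕ} {u : Ρ ⊕ Bool} {p : HistoryState S Ρ ⊕ ℕ} :
    (M.historyAutomaton B).step (.inr (m + 1)) u w p ↔ u = .inr true ∧ w = B ∧ p = .inr m := by
  constructor
  · rintro ⟨⟩
    exact ⟨rfl, rfl, rfl⟩
  · rintro ⟨rfl, rfl, rfl⟩
    exact .count_succ m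

theorem eq_succ_of_step_inr {m w : ℕ} {u : Ρ ⊕ Bool} {p : HistoryState S Ρ ⊕ ℕ}
    (h : (M.historyAutomaton B).step p u w (.inr m)) : p = .inr (m + 1) := by
  cases h
  rfl

/-- The counter drops when a new block is entered (`d = 0`) and is kept inside a block (`d = 1`). -/
theorem isCounting_historyTransducer (e : α → (Ρ ⊕ Bool) × Fin (2 * B)) :
    (M.historyTransducer B e).IsCounting where
  succ m o a b q := by
    change (M.historyAutomaton B).BlockStep _ _ _ _ ↔
      ∃ d ≤ 1, ∃ o', _ ∧ (M.historyAutomaton B).BlockStep _ _ _ _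
    simp only [blockStep_iff, step_count_iff (m := m), step_count_iff (m := 0)]
    obtain ⟨p, o'⟩ := q
    constructor
    · rintro (⟨w, h1, ⟨h2, h3, rfl⟩, h4⟩ | ⟨w, h1, rfl, h3⟩)
      · exact ⟨0, zero_le_one, o', rfl, .inl ⟨w, h1, ⟨h2, h3, rfl⟩, h4⟩⟩
      · exact ⟨1, le_rfl, o', rfl, .inr ⟨w, h1, rfl, h3⟩⟩
    · rintro ⟨d, hd, o'', h, ⟨w, h1, ⟨h2, h3, h4⟩, h5⟩ | ⟨w, h1, h2, h3⟩⟩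
      · obtain ⟨rfl, rfl⟩ := Prod.mk.inj h
        obtain rfl := Sum.inr.inj h4
        exact .inl ⟨w, h1, ⟨h2, h3, rfl⟩, h5⟩
      · obtain ⟨rfl, rfl⟩ := Prod.mk.inj h
        obtain rfl := Sum.inr.inj h2
        exact .inr ⟨w, h1, rfl, h3⟩
  zero o a b m o' h := by
    rcases blockStep_iff.1 h with ⟨w, -, h, -⟩ | ⟨w, -, h, -⟩
    · have := eq_succ_of_step_inr h
      simp at this
    · simpa using h
  inl p o a b m o' h := by
    rcases blockStep_iff.1 h with ⟨w, -, h, -⟩ | ⟨w, -, h, -⟩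
    · have := eq_succ_of_step_inr h
      simp at this
    · simp at h
  final m o h := by
    have := h.2
    simp [historyAutomaton] at this

theorem notMem_testBlockStates (m : ℕ) (o : Option ((Ρ ⊕ Bool) × Fin (2 * B) × Fin (2 * B + 1))) :
    (.inr m, o) ∉ testBlockStates S Ρ B := by
  rintro ⟨h | ⟨ρ, r, sg, h⟩, -⟩ <;> simp at h

/-- Non-acceptance reduces to the isomorphism of a regular set of trees with a fixed scattered
linear order. -/
theorem exists_reduction [Finite S] [Finite Ρ] [Nonempty Ρ] (M : AffineMachine S Ρ) :
    ∃ (k : ℕ) (X : Type) (_ : LinearOrder X) (f : ℕ → TreeAutomatonCode k),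
      IsScattered X ∧ Primrec f ∧
      ∀ g, TreesIso (f g).language X ↔ ¬ M.Accepts (fun r => bif r then g else 0) := by
  obtain ⟨B, hpos, hB⟩ := M.exists_coeffLE
  have : NeZero (2 * B) := ⟨by omega⟩
  obtain ⟨k, ⟨e⟩⟩ := Finite.exists_equiv_fin ((Ρ ⊕ Bool) × Fin (2 * B))
  -- The two register units already give two letters, so `a₀ < a₁` can be chosen.
  have hk : 1 < k := by
    have h : e (.inr false, 0) ≠ e (.inr true, 0) := e.injective.ne (by simp)
    have h' := fun h' => h (Fin.ext h')
    omega
  let T := M.historyTransducer B e.symm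
  have h01 : (⟨0, by omega⟩ : Fin k) < ⟨1, hk⟩ := Nat.zero_lt_one
  obtain ⟨f, hf, hlang⟩ := exists_primrec_code (M.isCounting_historyTransducer (B := B) e.symm)
    ⟨0, by omega⟩ ⟨1, hk⟩ none (notMem_testBlockStates (S := S) (Ρ := Ρ) (B := B))
  refine ⟨k, RowSum (fun w : ShortlexWord (Fin k) => T.contents (testBlockStates S Ρ B) w),
    inferInstance, f, RowSum.isScattered, hf, fun g => ?_⟩
  rw [← nonempty_iso_iff hB e.symm, hlang, language_spineAutomaton]
  obtain ⟨iso⟩ := treesIso_codedSet h01 (T.contents_bounded {countState S Ρ B g})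
    (T.contents_bounded (testBlockStates S Ρ B))
  exact ⟨fun ⟨i⟩ => ⟨iso.symm.trans i⟩, fun ⟨i⟩ => ⟨iso.trans i⟩⟩

end AffineMachine

/-! ### The main theorem -/

/-- Universality is what allows a single alphabet and a single order to serve for all `Π⁰₁` sets:
the set enters only through the input of one fixed machine. -/
theorem exists_universal_partrec : ∃ U : ℕ →. ℕ, Partrec U ∧
    ∀ p : ℕ → Prop, REPred p → ∃ h : ℕ → ℕ, Computable h ∧ ∀ n, p n ↔ (U (h n)).Dom := by
  refine ⟨fun x => Nat.Partrec.Code.eval (Denumerable.ofNat _ x.unpair.1) x.unpair.2, ?_, ?_⟩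
  · exact Nat.Partrec.Code.eval_part.comp
      ((Computable.ofNat _).comp (Computable.fst.comp Computable.unpair))
      (Computable.snd.comp Computable.unpair)
  · intro p hp
    have hp' : Partrec fun n => (Part.assert (p n) fun _ => Part.some ()).map fun _ => 0 :=
      Partrec.map hp (Computable.const 0).to₂
    obtain ⟨c, hc⟩ := Nat.Partrec.Code.exists_code.1 (Partrec.nat_iff.1 hp')
    refine ⟨fun n => Nat.pair (Encodable.encode c) n,
      (Primrec₂.natPair.comp (Primrec.const _) Primrec.id).to_comp, fun n => ?_⟩
    simp only [Nat.unpair_pair, Denumerable.ofNat_encode, hc]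
    exact ⟨fun h => ⟨h, trivial⟩, fun h => h.1⟩

theorem mainTheorem1 :
    ∃ (k : ℕ) (X : Type) (_ : LinearOrder X),
      IsScattered X ∧
      PiZeroOneHard (fun c : TreeAutomatonCode k => TreesIso c.language X) := by
  obtain ⟨U, hU, huniv⟩ := exists_universal_partrec
  obtain ⟨S, Ρ, _, _, _, M, g, hg, hM⟩ := Turing.exists_affineMachine hU
  obtain ⟨k, X, _, f, hX, hf, hiso⟩ := M.exists_reduction
  refine ⟨k, X, inferInstance, hX, fun P hP => ?_⟩
  obtain ⟨h, hh, hdom⟩ := huniv _ hP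
  refine ⟨fun n => f (g (h n)), hf.to_comp.comp (hg.comp hh), fun n => ?_⟩
  change P n ↔ TreesIso (f (g (h n))).language X
  rw [hiso, hM, ← hdom, not_not]
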